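/- Let $D,G\in\mathbb R^{d\times d}$, let $\gamma\in L^1(\mathbb R^+;\mathbb R^{d\times d})$, and let $r$ be the differential resolvent, i.e. the solution of $$r'(t)=-Dr(t)-\int_0^t\gamma(t-s)r(s)\,ds\quad(t\ge 0),\qquad r(0)=I .$$ Assume that $r\in L^1(\mathbb R^+;\mathbb R^{d\times d})$. Let $\varphi\in L^2(\mathbb R;\mathbb R^{d\times d})$, let $W$ and $\widetilde W$ be two-sided standard $d$-dimensional Brownian motions on a probability space which are either the same or independent of each other, and let $F=F_0+G\dot W$, where $F_0$ is a measurable process with $F_0(t)=\int_{-\infty}^{\infty}\varphi(t-s)\,d\widetilde W(s)$ almost surely for every $t\in\mathbb R$. A strong solution of the generalized Langevin equation with infinite time horizon $$\dot V(t)=-DV(t)-\int_{-\infty}^t\gamma(t-s)V(s)\,ds+F(t),\qquad t\in\mathbb R,$$ is a measurable process $V$ for which the integrals below converge absolutely almost surely and which satisfies, for all $t_1\le t_2$, almost surely $$V(t_2)-V(t_1)=\int_{t_1}^{t_2}\Bigl(-DV(t)-\int_{-\infty}^t\gamma(t-s)V(s)\,ds+F_0(t)\Bigr)dt+G\bigl(W(t_2)-W(t_1)\bigr);$$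 it is called bounded if $V(t)$ is square-integrable for every $t$ and $\sup_{t\in\mathbb R}\mathbb E|V(t)|^2<\infty$. Then there is a bounded strong solution $V_\infty$ (which can be chosen to satisfy the integrated equation almost surely simultaneously for all $t_1\le t_2$), it is unique in the sense that every bounded strong solution $V$ satisfies $V(t)=V_\infty(t)$ almost surely for every $t\in\mathbb R$, and $V_\infty$ is a centered stationary Gaussian process. Its autocorrelation function $C_{V_\infty}(t)=\mathbb E\bigl(V_\infty(s+t)V_\infty(s)^*\bigr)$, $s\in\mathbb R$, is given for $t\ge 0$ by $$C_{V_\infty}(t)=\int_0^\infty r(t+\tau)GG^*r(\tau)^*\,d\tau+\int_0^\infty\!\!\int_0^\infty r(\tau)\,\chi(t+\tau'-\tau)\,r(\tau')^*\,d\tau'\,d\tau ,$$ where, with $\overset{\leftarrow}{\varphi}(s)=\varphi(-s)$ and with $*$ between two functions denoting convolution, $\chi=\varphi G^*+G\overset{\leftarrow}{\varphi}{}^*+\varphi*\overset{\leftarrow}{\varphi}{}^*$ if $\widetilde W=W$, and $\chi=\varphi*\overset{\leftarrow}{\varphi}{}^*$ if $W$ and $\widetilde W$ are independent. Moreover, for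 every symmetric positive definite $\Sigma\in\mathbb R^{d\times d}$ and every $t\ge 0$, $$C_{V_\infty}(t)=r(t)\Sigma+\int_0^\infty r(t+\tau)(GG^*-D\Sigma-\Sigma D^*)r(\tau)^*\,d\tau+\int_0^\infty\!\!\int_0^\infty r(\tau)\,(\chi-\gamma_\Sigma)(t+\tau'-\tau)\,r(\tau')^*\,d\tau'\,d\tau ,$$ where $\gamma_\Sigma(t)=\gamma(t)\Sigma$ for $t>0$, $\gamma_\Sigma(t)=\Sigma\gamma(-t)^*$ for $t<0$, and $\gamma_\Sigma(0)=\tfrac12(\gamma(0)\Sigma+\Sigma\gamma(0)^*)$. All integrals in both formulas converge absolutely. -/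

import Mathlib

open MeasureTheory ProbabilityTheory Filter Set
open scoped Topology Matrix ENNReal

noncomputable section

/-! Vectors in `ℝᵈ` are functions `Fin d → ℝ`, matrices are `Matrix (Fin d) (Fin d) ℝ`; integrals,
derivatives and `Lᵖ` conditions for matrix-valued functions are taken entry by entry. -/

namespace GLE

variable {d : ℕ} {Ω : Type*} [MeasurableSpace Ω]

/-! ### Deterministic objects -/

/-- `f ∈ L¹(ℝ⁺)` for a matrix-valued function `f` (only its values on `(0, ∞)` matter). -/
def IsL1Pos (f : ℝ → Matrix (Fin d) (Fin d) ℝ) : Prop :=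
  ∀ i j, IntegrableOn (fun t => f t i j) (Ioi 0)

/-- `f ∈ L²(ℝ)` for a matrix-valued function `f`. -/
def IsL2 (f : ℝ → Matrix (Fin d) (Fin d) ℝ) : Prop :=
  ∀ i j, MemLp (fun t => f t i j) 2 volume

/-- `r` is the differential resolvent on `[0, ∞)`:
`r'(t) = -D r(t) - ∫₀ᵗ γ(t - s) r(s) ds` for all `t ≥ 0`, and `r(0) = I`. -/
structure IsDifferentialResolvent (D : Matrix (Fin d) (Fin d) ℝ)
    (γ r : ℝ → Matrix (Fin d) (Fin d) ℝ) : Prop where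
  initial : r 0 = 1
  deriv : ∀ t, 0 ≤ t → ∀ i j, HasDerivWithinAt (fun u => r u i j)
    (-(D * r t) i j - ∫ s in (0 : ℝ)..t, (γ (t - s) * r s) i j) (Ici 0) t

/-- `γ_Σ(t) = γ(t) Σ` for `t > 0`, `Σ γ(-t)ᵀ` for `t < 0`, and the mean of both for `t = 0`. -/
def gammaSigma (γ : ℝ → Matrix (Fin d) (Fin d) ℝ) (S : Matrix (Fin d) (Fin d) ℝ) (t : ℝ) :
    Matrix (Fin d) (Fin d) ℝ :=
  if 0 < t then γ t * S
  else if t < 0 then S * (γ (-t))ᵀ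
  else (1 / 2 : ℝ) • (γ 0 * S + S * (γ 0)ᵀ)

/-- The convolution of `φ` with its transposed time reversal,
`t ↦ ∫ φ(t - s) φ(-s)ᵀ ds`. -/
def convReversal (φ : ℝ → Matrix (Fin d) (Fin d) ℝ) (t : ℝ) : Matrix (Fin d) (Fin d) ℝ :=
  Matrix.of fun i j => ∫ s, (φ (t - s) * (φ (-s))ᵀ) i j

/-- `χ = κ (φ Gᵀ + G φ(-·)ᵀ) + φ * φ(-·)ᵀ`; here `κ = 1` if the two Brownian motions coincide and
`κ = 0` if they are independent. -/
def chi (φ : ℝ → Matrix (Fin d) (Fin d) ℝ) (G : Matrix (Fin d) (Fin d) ℝ) (κ : ℝ) (t : ℝ) :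
    Matrix (Fin d) (Fin d) ℝ :=
  κ • (φ t * Gᵀ + G * (φ (-t))ᵀ) + convReversal φ t

/-- `∫₀^∞ r(t + τ) M r(τ)ᵀ dτ`. -/
def singleTerm (r : ℝ → Matrix (Fin d) (Fin d) ℝ) (M : Matrix (Fin d) (Fin d) ℝ) (t : ℝ) :
    Matrix (Fin d) (Fin d) ℝ :=
  Matrix.of fun i j => ∫ τ in Ioi (0 : ℝ), (r (t + τ) * M * (r τ)ᵀ) i j

/-- `∫₀^∞ ∫₀^∞ r(τ) k(t + τ' - τ) r(τ')ᵀ dτ' dτ`. -/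
def doubleTerm (r k : ℝ → Matrix (Fin d) (Fin d) ℝ) (t : ℝ) : Matrix (Fin d) (Fin d) ℝ :=
  Matrix.of fun i j =>
    ∫ τ in Ioi (0 : ℝ), ∫ τ' in Ioi (0 : ℝ), (r τ * k (t + τ' - τ) * (r τ')ᵀ) i j

/-- Absolute convergence of the integral in `singleTerm r M t`. -/
def SingleTermConverges (r : ℝ → Matrix (Fin d) (Fin d) ℝ) (M : Matrix (Fin d) (Fin d) ℝ)
    (t : ℝ) : Prop :=
  ∀ i j, IntegrableOn (fun τ : ℝ => (r (t + τ) * M * (r τ)ᵀ) i j) (Ioi 0)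

/-- Absolute convergence of the double integral in `doubleTerm r k t`. -/
def DoubleTermConverges (r k : ℝ → Matrix (Fin d) (Fin d) ℝ) (t : ℝ) : Prop :=
  ∀ i j, IntegrableOn (fun p : ℝ × ℝ => (r p.1 * k (t + p.2 - p.1) * (r p.2)ᵀ) i j)
    (Ioi 0 ×ˢ Ioi 0)

/-! ### Brownian motion and the Wiener integral -/

/-- `W` is a two-sided standard `d`-dimensional Brownian motion: `W(0) = 0`, the increments over
consecutive intervals of the real line are independent, `W(t) - W(s) ∼ 𝒩(0, (t - s) I)` for
`s ≤ t`, and the paths are almost surely continuous. -/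
structure IsTwoSidedBrownian (W : ℝ → Ω → Fin d → ℝ) (P : Measure Ω) : Prop where
  measurable : ∀ t, Measurable (W t)
  zero : ∀ᵐ ω ∂P, W 0 ω = 0
  indep_increments : HasIndepIncrements W P
  law_increment : ∀ s t, s ≤ t →
    P.map (fun ω => W t ω - W s ω) = Measure.pi fun _ => gaussianReal 0 (t - s).toNNReal
  continuous_paths : ∀ᵐ ω ∂P, Continuous fun t => W t ω

/-- A matrix-valued step function on the real line: finitely many bounded intervals
`(left k, right k]` with constant values `value k`. -/
structure StepFunction (d : ℕ) where
  size : ℕ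
  left : Fin size → ℝ
  right : Fin size → ℝ
  left_le_right : ∀ k, left k ≤ right k
  value : Fin size → Matrix (Fin d) (Fin d) ℝ

/-- The function `∑ₖ value k · 1_{(left k, right k]}`. -/
def StepFunction.toFun (S : StepFunction d) (s : ℝ) : Matrix (Fin d) (Fin d) ℝ :=
  ∑ k, (Ioc (S.left k) (S.right k)).indicator (fun _ => S.value k) s

/-- The elementary integral `∑ₖ value k (W(right k) - W(left k))`. -/
def StepFunction.integral (S : StepFunction d) (W : ℝ → Ω → Fin d → ℝ) (ω : Ω) : Fin d → ℝ :=
  ∑ k, S.value k *ᵥ (W (S.right k) ω - W (S.left k) ω)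

/-- `X` is (a version of) the Wiener integral `∫ Φ(s) dW(s)` of the square-integrable `Φ`: for some
step functions converging to `Φ` in `L²(ℝ)`, their elementary integrals converge to `X` in
`L²(P)`. -/
def IsWienerIntegral (W : ℝ → Ω → Fin d → ℝ) (P : Measure Ω)
    (Φ : ℝ → Matrix (Fin d) (Fin d) ℝ) (X : Ω → Fin d → ℝ) : Prop :=
  IsL2 Φ ∧ (∀ i, MemLp (fun ω => X ω i) 2 P) ∧
  ∃ S : ℕ → StepFunction d,
    (∀ i j, Tendsto (fun n => eLpNorm (fun s => (S n).toFun s i j - Φ s i j) 2 volume)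
      atTop (𝓝 0)) ∧
    (∀ i, Tendsto (fun n => eLpNorm (fun ω => (S n).integral W ω i - X ω i) 2 P) atTop (𝓝 0))

/-- `F₀` is a measurable process with `F₀(t) = ∫ φ(t - s) dW̃(s)` almost surely, for every `t`. -/
structure IsColoredNoise (φ : ℝ → Matrix (Fin d) (Fin d) ℝ) (W' : ℝ → Ω → Fin d → ℝ)
    (P : Measure Ω) (F₀ : ℝ → Ω → Fin d → ℝ) : Prop where
  measurable : Measurable (Function.uncurry F₀)
  wiener : ∀ t, IsWienerIntegral W' P (fun s => φ (t - s)) (F₀ t)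

/-! ### The generalized Langevin equation with infinite time horizon -/

/-- `-D V(t) - ∫_{-∞}^t γ(t - s) V(s) ds + F₀(t)`, along the path of `ω`. -/
def drift (D : Matrix (Fin d) (Fin d) ℝ) (γ : ℝ → Matrix (Fin d) (Fin d) ℝ)
    (F₀ V : ℝ → Ω → Fin d → ℝ) (ω : Ω) (t : ℝ) : Fin d → ℝ :=
  -(D *ᵥ V t ω) - (∫ s in Iio t, γ (t - s) *ᵥ V s ω) + F₀ t ω

/-- The equation `V̇ = -D V - ∫_{-∞}^t γ(t - s) V(s) ds + F₀ + G Ẇ`, integrated over `[t₁, t₂]`,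
along the path of `ω`. -/
def IntegratedEquation (D G : Matrix (Fin d) (Fin d) ℝ) (γ : ℝ → Matrix (Fin d) (Fin d) ℝ)
    (F₀ W V : ℝ → Ω → Fin d → ℝ) (t₁ t₂ : ℝ) (ω : Ω) : Prop :=
  V t₂ ω - V t₁ ω = (∫ t in t₁..t₂, drift D γ F₀ V ω t) + G *ᵥ (W t₂ ω - W t₁ ω)

/-- `V` is a strong solution of the generalized Langevin equation with infinite time horizon:
a measurable process for which, almost surely, all integrals converge absolutely, and which
satisfies, for all `t₁ ≤ t₂`, the integrated equation almost surely. -/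
structure IsStrongSolution (D G : Matrix (Fin d) (Fin d) ℝ) (γ : ℝ → Matrix (Fin d) (Fin d) ℝ)
    (F₀ W : ℝ → Ω → Fin d → ℝ) (P : Measure Ω) (V : ℝ → Ω → Fin d → ℝ) : Prop where
  measurable : Measurable (Function.uncurry V)
  memory_integrable : ∀ᵐ ω ∂P, ∀ᵐ t : ℝ,
    IntegrableOn (fun s => γ (t - s) *ᵥ V s ω) (Iio t)
  drift_integrable : ∀ᵐ ω ∂P, ∀ t₁ t₂ : ℝ, IntervalIntegrable (drift D γ F₀ V ω) volume t₁ t₂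
  equation : ∀ t₁ t₂, t₁ ≤ t₂ → ∀ᵐ ω ∂P, IntegratedEquation D G γ F₀ W V t₁ t₂ ω

/-- `V` is bounded in mean square: `sup_t 𝔼 |V(t)|² < ∞`. -/
def IsMeanSquareBounded (V : ℝ → Ω → Fin d → ℝ) (P : Measure Ω) : Prop :=
  (∀ t i, MemLp (fun ω => V t ω i) 2 P) ∧ ∃ C : ℝ, ∀ t, ∫ ω, ∑ i, (V t ω i) ^ 2 ∂P ≤ C

/-- Stationarity: the finite-dimensional distributions are invariant under time shifts. -/
def IsStationary (V : ℝ → Ω → Fin d → ℝ) (P : Measure Ω) : Prop :=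
  ∀ (I : Finset ℝ) (h : ℝ),
    IdentDistrib (fun ω (t : I) => V ((t : ℝ) + h) ω) (fun ω (t : I) => V (t : ℝ) ω) P P

/-- The matrix `𝔼 (V(s) V(t)ᵀ)`. -/
def correlation (V : ℝ → Ω → Fin d → ℝ) (P : Measure Ω) (s t : ℝ) : Matrix (Fin d) (Fin d) ℝ :=
  Matrix.of fun i j => ∫ ω, V s ω i * V t ω j ∂P

end GLE

end

/-!
Extend the resolvent and the memory kernel by zero to functions `R` and `Γ` on the whole line. The
solution is the moving average `V = R * (F₀ + G Ẇ)` of the noise over the whole past, that is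
`V(t) = ∫ R(t - u) G dW(u) + ∫ R(t - s) F₀(s) ds` (`resolventProcess`).

*Reduction to a deterministic equation.* Fix a square integrable random vector `ξ` and put
`v(t) = 𝔼 (V(t) ξᵀ)`. An identity between square integrable vectors holds almost surely if and only
if it holds after testing against all `ξ`. Since the Wiener integral is an isometry, its adjoint
applied to `ξ` gives a square integrable function playing the role of `u ↦ 𝔼 (Ẇ(u) ξᵀ)`
(`whiteDensity`). The stochastic equation thus becomes the linear equation
`v' = -D v - Γ * v + f` with
a forcing term `f` in `L¹ + L^∞`, for functions with values in the Banach algebra of operators of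
`ℝᵈ`. It is solved by `v = R * f` (`IsExtendedResolvent.conv_solves`). For uniqueness, the
difference `y` of two bounded solutions satisfies the homogeneous equation. The resolvent equation
with the factors in the other order (`IsExtendedResolvent.density_eq`) turns the convolution of this
equation with `R` into the vanishing of all integrals of `y`
(`IsExtendedResolvent.eq_zero_of_bounded`). This gives `resolventProcess_equation` and
`ae_eq_of_equation`. Integrating the drift along the paths yields a version which satisfies the
equation simultaneously for all times (`exists_version`).

*Gaussian law.* The closed span in `L²(P)` of the two Brownian motions consists of centered Gaussian
variables (`map_eq_gaussianReal_of_mem_noiseSpace`), because characteristic functions pass to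
limits in `L²`. The coordinates of `V(t)` belong to it, for the convolution with `R` is orthogonal
to everything that `F₀` is orthogonal to. Hence `V` is a centered Gaussian process, and stationarity
only has to be checked on correlations.

*Autocorrelation.* The isometry relations, with the factor `κ` between the two Brownian motions,
and Fubini's theorem give the first formula (`correlation_resolventProcess`). The second one differs
from it by the identity
`r(t) Σ = ∫ r(t + τ) (D Σ + Σ Dᵀ) r(τ)ᵀ dτ + ∫∫ r(σ) γ_Σ(t + τ - σ) r(τ)ᵀ dτ dσ`
(`mul_eq_singleTerm_add_doubleTerm`), obtained by integrating the derivative of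
`τ ↦ r(t + τ) Σ r(τ)ᵀ` over `(0, ∞)`.
-/

set_option linter.unusedSectionVars false
open scoped InnerProductSpace

namespace GLE

/-! ### Convolutions in a Banach algebra -/

section Convolution

variable {A : Type*} [NormedRing A] [NormedAlgebra ℝ A]

/-- The convolution `t ↦ ∫ f(t - s) g(s) ds` over the whole real line, with values in a Banach
algebra; the order of the factors matters. -/
noncomputable def conv (f g : ℝ → A) (t : ℝ) : A := ∫ s, f (t - s) * g s

lemma conv_eq_convolution (f g : ℝ → A) :
    conv f g = convolution f g (ContinuousLinearMap.mul ℝ A) volume := by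
  ext t
  rw [convolution_eq_swap]
  rfl

lemma convolutionExistsAt_iff_integrable (f g : ℝ → A) (t : ℝ) :
    ConvolutionExistsAt f g t (ContinuousLinearMap.mul ℝ A) volume ↔
      Integrable fun s => f (t - s) * g s := by
  rw [convolutionExistsAt_iff_integrable_swap]
  rfl

/-- Membership in `L¹(ℝ) + L^∞(ℝ)`. This class contains `L²(ℝ)`, and it is stable under
convolution with integrable functions. -/
def IsL1AddLinf (y : ℝ → A) : Prop :=
  ∃ y₁ y₂ : ℝ → A, Integrable y₁ ∧ AEStronglyMeasurable y₂ volume ∧ (∃ C, ∀ s, ‖y₂ s‖ ≤ C) ∧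
    y = fun s => y₁ s + y₂ s

lemma IsL1AddLinf.of_integrable {y : ℝ → A} (hy : Integrable y) : IsL1AddLinf y :=
  ⟨y, fun _ => 0, hy, aestronglyMeasurable_const, ⟨0, by simp⟩, by simp⟩

lemma IsL1AddLinf.of_bounded {y : ℝ → A} (hy : AEStronglyMeasurable y volume)
    (hC : ∃ C, ∀ s, ‖y s‖ ≤ C) : IsL1AddLinf y :=
  ⟨fun _ => 0, y, integrable_zero _ _ _, hy, hC, by simp⟩

lemma IsL1AddLinf.add {y z : ℝ → A} (hy : IsL1AddLinf y) (hz : IsL1AddLinf z) :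
    IsL1AddLinf fun t => y t + z t := by
  obtain ⟨y₁, y₂, h1, h2, ⟨C, hC⟩, rfl⟩ := hy
  obtain ⟨z₁, z₂, k1, k2, ⟨C', hC'⟩, rfl⟩ := hz
  refine ⟨fun s => y₁ s + z₁ s, fun s => y₂ s + z₂ s, h1.add k1, h2.add k2,
    ⟨C + C', fun s => (norm_add_le _ _).trans (add_le_add (hC s) (hC' s))⟩, ?_⟩
  ext s
  exact add_add_add_comm _ _ _ _

lemma IsL1AddLinf.of_memLp_two {y : ℝ → A} (hy : MemLp y 2 volume) : IsL1AddLinf y := by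
  classical
  -- it suffices to split a strongly measurable representative where its norm exceeds `1`
  obtain ⟨z, hz, hyz⟩ := hy.1
  have hz2 : MemLp z 2 volume := hy.ae_eq hyz
  have hms : MeasurableSet {s | 1 < ‖z s‖} :=
    measurableSet_lt measurable_const hz.norm.measurable
  refine ⟨fun s => (y s - z s) + indicator {s | 1 < ‖z s‖} z s,
    fun s => indicator {s | 1 < ‖z s‖}ᶜ z s, ?_, ?_, ⟨1, fun s => ?_⟩, ?_⟩
  · refine Integrable.add ((integrable_zero _ _ _).congr ?_) ?_
    · filter_upwards [hyz] with s hs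
      simp [hs]
    · refine (hz2.integrable_norm_pow (by norm_num)).mono
        (hz.indicator hms).aestronglyMeasurable (ae_of_all _ fun s => ?_)
      by_cases h : s ∈ {s | 1 < ‖z s‖}
      · have h' : 1 < ‖z s‖ := h
        rw [indicator_of_mem h]
        simp only [norm_pow, norm_norm]
        nlinarith
      · rw [indicator_of_notMem h]
        simp only [norm_zero]
        positivity
  · exact (hz.indicator hms.compl).aestronglyMeasurable
  · by_cases h : 1 < ‖z s‖
    · simp [indicator, h]
    · simpa [indicator, h] using not_lt.1 h
  · ext s
    have := congrFun (indicator_self_add_compl {s | 1 < ‖z s‖} z) s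
    simp only [Pi.add_apply] at this
    rw [add_assoc, this]
    abel

lemma integrable_mul_prod_of_integrable {M y : ℝ → A} (hM : Integrable M) (hy : Integrable y) :
    Integrable (fun p : ℝ × ℝ => M (p.1 - p.2) * y p.2) (volume.prod volume) :=
  Integrable.convolution_integrand (ContinuousLinearMap.mul ℝ A).flip hy hM

lemma integrable_indicator_mul_prod {M : ℝ → A} (hM : Integrable M) {S : Set ℝ}
    (hSm : MeasurableSet S) (hS : volume S ≠ ∞) :
    Integrable (fun p : ℝ × ℝ => indicator S (fun _ => (1 : ℝ)) p.1 • M (p.1 - p.2))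
      (volume.prod volume) := by
  have h1 : Integrable (indicator S (fun _ => (1 : ℝ))) :=
    (integrable_indicator_iff hSm).2 (integrableOn_const hS)
  have := (Integrable.convolution_integrand (ContinuousLinearMap.lsmul ℝ ℝ) h1 hM.comp_neg).swap
  refine this.congr (ae_of_all _ fun p => ?_)
  simp

lemma IsL1AddLinf.integrable_mul_prod {M y : ℝ → A} (hM : Integrable M) (hy : IsL1AddLinf y)
    {S : Set ℝ} (hSm : MeasurableSet S) (hS : volume S ≠ ∞) :
    Integrable (fun p : ℝ × ℝ => M (p.1 - p.2) * y p.2) ((volume.restrict S).prod volume) := by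
  obtain ⟨y₁, y₂, h1, h2, ⟨C, hC⟩, rfl⟩ := hy
  have hr : (volume.restrict S).prod (volume : Measure ℝ)
      = ((volume : Measure ℝ).prod (volume : Measure ℝ)).restrict (S ×ˢ univ) := by
    rw [← Measure.prod_restrict, Measure.restrict_univ]
  simp only [mul_add]
  refine Integrable.add ?_ ?_
  · rw [hr]
    exact (integrable_mul_prod_of_integrable hM h1).restrict
  · refine Integrable.mul_bdd (c := C) ?_ h2.comp_snd (ae_of_all _ fun p => hC _)
    rw [hr]
    refine ((integrable_indicator_mul_prod hM hSm hS).restrict (s := S ×ˢ univ)).congr ?_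
    filter_upwards [ae_restrict_mem (hSm.prod MeasurableSet.univ)] with p hp
    rw [indicator_of_mem hp.1, one_smul]

lemma integrable_mul_of_bounded {M y : ℝ → A} (hM : Integrable M)
    (hy : AEStronglyMeasurable y volume) {C : ℝ} (hC : ∀ s, ‖y s‖ ≤ C) (t : ℝ) :
    Integrable fun s => M (t - s) * y s :=
  (hM.comp_sub_left t).mul_bdd hy (ae_of_all _ hC)

lemma IsL1AddLinf.integrable_mul {M y : ℝ → A} (hM : Integrable M) (hMb : ∃ C, ∀ s, ‖M s‖ ≤ C)
    (hy : IsL1AddLinf y) (t : ℝ) : Integrable fun s => M (t - s) * y s := by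
  obtain ⟨y₁, y₂, h1, h2, ⟨C, hC⟩, rfl⟩ := hy
  obtain ⟨C', hC'⟩ := hMb
  simp only [mul_add]
  exact (h1.bdd_mul (hM.comp_sub_left t).aestronglyMeasurable
    (ae_of_all _ fun s => hC' _)).add (integrable_mul_of_bounded hM h2 hC t)

lemma IsL1AddLinf.ae_integrable_mul {M y : ℝ → A} (hM : Integrable M) (hy : IsL1AddLinf y) :
    ∀ᵐ t, Integrable fun s => M (t - s) * y s := by
  obtain ⟨y₁, y₂, h1, h2, ⟨C, hC⟩, rfl⟩ := hy
  filter_upwards [(integrable_mul_prod_of_integrable hM h1).prod_right_ae] with t ht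
  simp only [mul_add]
  exact ht.add (integrable_mul_of_bounded hM h2 hC t)

lemma integrable_conv {f g : ℝ → A} (hf : Integrable f) (hg : Integrable g) :
    Integrable (conv f g) := by
  rw [conv_eq_convolution]
  exact hf.integrable_convolution _ hg

lemma norm_conv_le {M y : ℝ → A} (hM : Integrable M) {C : ℝ} (hC : ∀ s, ‖y s‖ ≤ C) (t : ℝ) :
    ‖conv M y t‖ ≤ (∫ s, ‖M s‖) * C := by
  calc ‖conv M y t‖ ≤ ∫ s, ‖M (t - s)‖ * C :=
        norm_integral_le_of_norm_le ((hM.comp_sub_left t).norm.mul_const C)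
          (ae_of_all _ fun s => (norm_mul_le _ _).trans
            (mul_le_mul_of_nonneg_left (hC s) (norm_nonneg _)))
    _ = (∫ s, ‖M s‖) * C := by
        rw [integral_mul_const, integral_sub_left_eq_self (fun s => ‖M s‖) volume t]

lemma aestronglyMeasurable_conv {M y : ℝ → A} (hM : AEStronglyMeasurable M volume)
    (hy : AEStronglyMeasurable y volume) : AEStronglyMeasurable (conv M y) volume := by
  have := AEStronglyMeasurable.convolution_integrand (ContinuousLinearMap.mul ℝ A).flip
    (μ := (volume : Measure ℝ)) (ν := volume) hy hM
  exact this.integral_prod_right'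

lemma IsL1AddLinf.conv {M y : ℝ → A} (hM : Integrable M) (hy : IsL1AddLinf y) :
    IsL1AddLinf (fun t => conv M y t) := by
  obtain ⟨y₁, y₂, h1, h2, ⟨C, hC⟩, rfl⟩ := hy
  refine ⟨fun t => GLE.conv M (fun s => y₁ s + y₂ s) t - GLE.conv M y₂ t, GLE.conv M y₂, ?_,
    aestronglyMeasurable_conv hM.1 h2, ⟨_, norm_conv_le hM hC⟩, by simp⟩
  refine (integrable_conv hM h1).congr ?_
  filter_upwards [(integrable_mul_prod_of_integrable hM h1).prod_right_ae] with t ht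
  simp only [GLE.conv, mul_add]
  rw [integral_add ht (integrable_mul_of_bounded hM h2 hC t), add_sub_cancel_right]

lemma conv_congr_right {M y z : ℝ → A} (h : y =ᵐ[volume] z) (t : ℝ) :
    conv M y t = conv M z t := by
  refine integral_congr_ae ?_
  filter_upwards [h] with s hs
  rw [hs]

lemma conv_add_right_ae {M y z : ℝ → A} (hM : Integrable M) (hy : IsL1AddLinf y)
    (hz : IsL1AddLinf z) :
    ∀ᵐ t, conv M (fun s => y s + z s) t = conv M y t + conv M z t := by
  filter_upwards [hy.ae_integrable_mul hM, hz.ae_integrable_mul hM] with t h1 h2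
  simp only [conv, mul_add]
  exact integral_add h1 h2

lemma conv_add_left_ae {M N y : ℝ → A} (hM : Integrable M) (hN : Integrable N)
    (hy : IsL1AddLinf y) :
    ∀ᵐ t, conv (fun s => M s + N s) y t = conv M y t + conv N y t := by
  filter_upwards [hy.ae_integrable_mul hM, hy.ae_integrable_mul hN] with t h1 h2
  simp only [conv, add_mul]
  exact integral_add h1 h2

variable [CompleteSpace A]

lemma conv_assoc_ae_of_integrable {f g y : ℝ → A} (hf : Integrable f) (hg : Integrable g)
    (hy : Integrable y) : ∀ᵐ t, conv f (conv g y) t = conv (conv f g) y t := by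
  have hn := (hg.norm.integrable_convolution (ContinuousLinearMap.mul ℝ ℝ) hy.norm)
  filter_upwards [hf.norm.ae_convolution_exists (ContinuousLinearMap.mul ℝ ℝ) hn] with t ht
  simp only [conv_eq_convolution]
  refine (convolution_assoc (ContinuousLinearMap.mul ℝ A) (ContinuousLinearMap.mul ℝ A)
    (ContinuousLinearMap.mul ℝ A) (ContinuousLinearMap.mul ℝ A) mul_assoc
    hf.1 hg.1 hy.1 (hf.ae_convolution_exists _ hg)
    (hg.norm.ae_convolution_exists _ hy.norm) ht).symm

lemma conv_assoc_of_bounded {f g y : ℝ → A} (hf : Integrable f) (hg : Integrable g)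
    (hy : AEStronglyMeasurable y volume) {C : ℝ} (hC : ∀ s, ‖y s‖ ≤ C) (t : ℝ) :
    conv f (conv g y) t = conv (conv f g) y t := by
  have hb := norm_conv_le (A := ℝ) (M := fun s => ‖g s‖) (y := fun s => ‖y s‖) hg.norm (C := C)
    (fun s => by simpa using hC s)
  simp only [conv_eq_convolution] at hb ⊢
  refine (convolution_assoc (ContinuousLinearMap.mul ℝ A) (ContinuousLinearMap.mul ℝ A)
    (ContinuousLinearMap.mul ℝ A) (ContinuousLinearMap.mul ℝ A) mul_assoc
    hf.1 hg.1 hy (hf.ae_convolution_exists _ hg) (ae_of_all _ fun x => ?_) ?_).symm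
  · rw [convolutionExistsAt_iff_integrable]
    exact integrable_mul_of_bounded hg.norm hy.norm (fun s => by simpa using hC s) x
  · rw [convolutionExistsAt_iff_integrable]
    refine integrable_mul_of_bounded hf.norm ?_ hb t
    rw [← conv_eq_convolution]
    exact aestronglyMeasurable_conv hg.norm.1 hy.norm

lemma conv_assoc_ae {f g y : ℝ → A} (hf : Integrable f) (hg : Integrable g)
    (hy : IsL1AddLinf y) : ∀ᵐ t, conv f (conv g y) t = conv (conv f g) y t := by
  obtain ⟨y₁, y₂, h1, h2, ⟨C, hC⟩, rfl⟩ := hy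
  have e1 := IsL1AddLinf.of_integrable h1
  have e2 := IsL1AddLinf.of_bounded h2 ⟨C, hC⟩
  filter_upwards [conv_assoc_ae_of_integrable hf hg h1,
    conv_add_right_ae (integrable_conv hf hg) e1 e2,
    conv_add_right_ae hf (e1.conv hg) (e2.conv hg)] with t a1 a2 a3
  rw [a2, conv_congr_right (conv_add_right_ae hg e1 e2) t, a3, a1,
    conv_assoc_of_bounded hf hg h2 hC]

end Convolution

/-! ### Linear Volterra equations in a Banach algebra -/

section Resolvent

variable {A : Type*} [NormedRing A] [NormedAlgebra ℝ A] [CompleteSpace A]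

/-- `R` is the differential resolvent, extended by zero to negative times, of the memory kernel
`Γ` (again extended by zero) and the friction coefficient `D`, in integrated form and with values
in a Banach algebra. -/
structure IsExtendedResolvent (D : A) (Γ R : ℝ → A) : Prop where
  kernel_integrable : Integrable Γ
  kernel_zero : ∀ t, t < 0 → Γ t = 0
  integrable : Integrable R
  zero : ∀ t, t < 0 → R t = 0
  eq : ∀ t, R t = indicator (Ici 0) (fun _ => 1) t - ∫ u in Iic t, (D * R u + conv Γ R u)

lemma ae_eq_zero_of_forall_integral_Ioc {E : Type*} [NormedAddCommGroup E] [NormedSpace ℝ E]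
    [CompleteSpace E] {y : ℝ → E} (hy : LocallyIntegrable y volume)
    (h : ∀ t₁ t₂, t₁ ≤ t₂ → ∫ t in Ioc t₁ t₂, y t = 0) : y =ᵐ[volume] 0 := by
  filter_upwards [_root_.LocallyIntegrable.ae_hasDerivAt_integral hy] with x hx
  refine (hx 0).unique ((hasDerivAt_const x (0 : E)).congr_of_eventuallyEq
    (Eventually.of_forall fun t => ?_))
  beta_reduce
  rcases le_total 0 t with ht | ht
  · rw [intervalIntegral.integral_of_le ht, h 0 t ht]
  · rw [intervalIntegral.integral_of_ge ht, h t 0 ht, neg_zero]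

lemma conv_eq_zero_of_neg {f g : ℝ → A} (hf : ∀ t, t < 0 → f t = 0) (hg : ∀ t, t < 0 → g t = 0)
    {t : ℝ} (ht : t < 0) : conv f g t = 0 := by
  refine integral_eq_zero_of_ae (ae_of_all _ fun s => ?_)
  rcases lt_or_ge s 0 with hs | hs
  · simp [hg s hs]
  · simp [hf (t - s) (by linarith)]

lemma setIntegral_Iic_eq_intervalIntegral {f : ℝ → A} (hf : ∀ t, t < 0 → f t = 0) {t : ℝ}
    (ht : 0 ≤ t) : ∫ u in Iic t, f u = ∫ u in (0 : ℝ)..t, f u := by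
  rw [intervalIntegral.integral_of_le ht, ← integral_Icc_eq_integral_Ioc]
  refine (setIntegral_eq_of_subset_of_forall_sdiff_eq_zero measurableSet_Iic
    (fun x hx => hx.2) fun x hx => hf x ?_)
  by_contra h
  exact hx.2 ⟨not_lt.1 h, hx.1⟩

lemma continuous_integral_Iic {f : ℝ → A} (hf : Integrable f) :
    Continuous fun t => ∫ u in Iic t, f u := by
  have h : (fun t => ∫ u in Iic t, f u) =
      fun t => (∫ u in Iic 0, f u) + ∫ u in (0 : ℝ)..t, f u := by
    ext t
    rw [← intervalIntegral.integral_Iic_sub_Iic hf.integrableOn hf.integrableOn]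
    abel
  rw [h]
  exact continuous_const.add
    (intervalIntegral.continuous_primitive (fun _ _ => hf.intervalIntegrable) 0)

/-- A homogeneous linear Volterra equation has no nonzero solutions: iterating it bounds the
solution by `C (K t)ⁿ / n!` for all `n`. -/
lemma eq_zero_of_volterra {D : A} {Γ e : ℝ → A} (hΓ : Integrable Γ)
    (hΓ0 : ∀ t, t < 0 → Γ t = 0) (he0 : ∀ t, t < 0 → e t = 0) {C : ℝ} (hC : ∀ t, ‖e t‖ ≤ C)
    (heq : ∀ t, e t = -∫ u in Iic t, (D * e u + conv Γ e u)) (t : ℝ) : e t = 0 := by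
  set K : ℝ := ‖D‖ + ∫ s, ‖Γ s‖ with hK
  have hΓn : 0 ≤ ∫ s, ‖Γ s‖ := integral_nonneg fun s => norm_nonneg _
  have hK0 : 0 ≤ K := by positivity
  have hC0 : 0 ≤ C := (norm_nonneg _).trans (hC 0)
  have key : ∀ n : ℕ, ∀ t, 0 ≤ t → ‖e t‖ ≤ C * ((K * t) ^ n / n.factorial) := by
    intro n
    induction n with
    | zero => intro t _; simpa using hC t
    | succ n ih =>
      intro t ht
      have hbd : ∀ u, 0 ≤ u →
          ‖D * e u + conv Γ e u‖ ≤ C * K ^ (n + 1) / n.factorial * u ^ n := by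
        intro u hu
        have h1 : ‖D * e u‖ ≤ ‖D‖ * (C * ((K * u) ^ n / n.factorial)) :=
          (norm_mul_le _ _).trans (mul_le_mul_of_nonneg_left (ih u hu) (norm_nonneg _))
        have h2 : ‖conv Γ e u‖ ≤ (∫ s, ‖Γ s‖) * (C * ((K * u) ^ n / n.factorial)) := by
          calc ‖conv Γ e u‖ ≤ ∫ s, ‖Γ (u - s)‖ * (C * ((K * u) ^ n / n.factorial)) := by
                refine norm_integral_le_of_norm_le ((hΓ.comp_sub_left u).norm.mul_const _)
                  (ae_of_all _ fun s => ?_)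
                refine (norm_mul_le _ _).trans ?_
                rcases lt_or_ge u s with hs | hs
                · simp [hΓ0 (u - s) (by linarith)]
                · refine mul_le_mul_of_nonneg_left ?_ (norm_nonneg _)
                  rcases lt_or_ge s 0 with hs0 | hs0
                  · rw [he0 s hs0, norm_zero]
                    positivity
                  · refine (ih s hs0).trans ?_
                    gcongr
            _ = _ := by
                rw [integral_mul_const, integral_sub_left_eq_self (fun s => ‖Γ s‖) volume u]
        calc ‖D * e u + conv Γ e u‖ ≤ ‖D * e u‖ + ‖conv Γ e u‖ := norm_add_le _ _
          _ ≤ K * (C * ((K * u) ^ n / n.factorial)) := by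
              rw [hK, add_mul]
              exact add_le_add h1 h2
          _ = _ := by rw [mul_pow]; ring
      rw [heq t, norm_neg, setIntegral_Iic_eq_intervalIntegral (fun u hu => by
        simp [he0 u hu, conv_eq_zero_of_neg hΓ0 he0 hu]) ht]
      calc ‖∫ u in (0 : ℝ)..t, (D * e u + conv Γ e u)‖
          ≤ ∫ u in (0 : ℝ)..t, C * K ^ (n + 1) / n.factorial * u ^ n :=
            intervalIntegral.norm_integral_le_of_norm_le ht
              (ae_of_all _ fun u hu => hbd u hu.1.le)
              (Continuous.intervalIntegrable (by fun_prop) _ _)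
        _ = C * ((K * t) ^ (n + 1) / (n + 1).factorial) := by
            rw [intervalIntegral.integral_const_mul, integral_pow, Nat.factorial_succ]
            push_cast
            field_simp
            ring_nf
  rcases lt_or_ge t 0 with ht | ht
  · exact he0 t ht
  · have hlim : Tendsto (fun n : ℕ => C * ((K * t) ^ n / n.factorial)) atTop (𝓝 (C * 0)) :=
      (FloorSemiring.tendsto_pow_div_factorial_atTop (K * t)).const_mul C
    rw [mul_zero] at hlim
    exact norm_le_zero_iff.1 (ge_of_tendsto' hlim fun n => key n t ht)

lemma integral_Iic_sub_mul {M y : ℝ → A} (hM : Integrable M) (hy : Integrable y) (t : ℝ) :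
    ∫ s, (∫ u in Iic (t - s), M u) * y s = ∫ u in Iic t, conv M y u := by
  have hi : Integrable (fun p : ℝ × ℝ => M (p.1 - p.2) * y p.2)
      ((volume.restrict (Iic t)).prod volume) := by
    have hr : (volume.restrict (Iic t)).prod (volume : Measure ℝ)
        = ((volume : Measure ℝ).prod (volume : Measure ℝ)).restrict (Iic t ×ˢ univ) := by
      rw [← Measure.prod_restrict, Measure.restrict_univ]
    rw [hr]
    exact (integrable_mul_prod_of_integrable hM hy).restrict
  unfold conv
  rw [integral_integral_swap hi]
  refine integral_congr_ae (ae_of_all _ fun s => ?_)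
  simp only
  rw [integral_mul_const_of_integrable (hM.comp_sub_right s).restrict,
    ← integral_indicator measurableSet_Iic, ← integral_indicator measurableSet_Iic,
    ← integral_sub_right_eq_self _ s]
  congr 2
  ext u
  simp [indicator]

lemma mul_integral_Iic_sub {M y : ℝ → A} (hM : Integrable M) (hy : Integrable y) (t : ℝ) :
    ∫ s, y s * (∫ u in Iic (t - s), M u) = ∫ u in Iic t, conv y M u := by
  have hi : Integrable (fun p : ℝ × ℝ => y p.2 * M (p.1 - p.2))
      ((volume.restrict (Iic t)).prod volume) := by
    have hr : (volume.restrict (Iic t)).prod (volume : Measure ℝ)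
        = ((volume : Measure ℝ).prod (volume : Measure ℝ)).restrict (Iic t ×ˢ univ) := by
      rw [← Measure.prod_restrict, Measure.restrict_univ]
    rw [hr]
    exact (Integrable.convolution_integrand (ContinuousLinearMap.mul ℝ A) hy hM).restrict
  have hc : ∀ u, conv y M u = ∫ s, y s * M (u - s) := fun u => by
    rw [conv, ← integral_sub_left_eq_self _ volume u]
    simp
  simp only [hc]
  rw [integral_integral_swap hi]
  refine integral_congr_ae (ae_of_all _ fun s => ?_)
  simp only
  rw [integral_const_mul_of_integrable (hM.comp_sub_right s).restrict,
    ← integral_indicator measurableSet_Iic, ← integral_indicator measurableSet_Iic,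
    ← integral_sub_right_eq_self _ s]
  congr 2
  ext u
  simp [indicator]

/-- If the function `R` has a unit jump at `0` and otherwise the density `-M`, then `R ⋆ y` is
absolutely continuous with density `y - M ⋆ y`. -/
lemma conv_sub_conv {M R y : ℝ → A} (hM : Integrable M) (hR : Integrable R)
    (hRb : ∃ C, ∀ s, ‖R s‖ ≤ C)
    (hRM : ∀ t, R t = indicator (Ici 0) (fun _ => 1) t - ∫ u in Iic t, M u)
    (hy : IsL1AddLinf y) {t₁ t₂ : ℝ} (h12 : t₁ ≤ t₂) :
    conv R y t₂ - conv R y t₁ = ∫ t in Ioc t₁ t₂, (y t - conv M y t) := by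
  have hi := hy.integrable_mul_prod hM (measurableSet_Ioc (a := t₁) (b := t₂))
    measure_Ioc_lt_top.ne
  have hyloc : IntegrableOn y (Ioc t₁ t₂) := by
    obtain ⟨y₁, y₂, h1, h2, ⟨C, hC⟩, rfl⟩ := hy
    refine h1.integrableOn.add (Integrable.mono' (integrableOn_const (C := C)
      measure_Ioc_lt_top.ne) h2.restrict (ae_of_all _ hC))
  have hdiff : ∀ s, R (t₂ - s) - R (t₁ - s) =
      indicator (Ioc t₁ t₂) (fun _ => (1 : A)) s - ∫ t in Ioc t₁ t₂, M (t - s) := by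
    intro s
    rw [hRM, hRM, ← intervalIntegral.integral_of_le h12,
      intervalIntegral.integral_comp_sub_right M s,
      ← intervalIntegral.integral_Iic_sub_Iic hM.integrableOn hM.integrableOn]
    have : indicator (Ioc t₁ t₂) (fun _ => (1 : A)) s =
        indicator (Ici 0) (fun _ => 1) (t₂ - s) - indicator (Ici 0) (fun _ => 1) (t₁ - s) := by
      simp only [indicator, mem_Ioc, mem_Ici, sub_nonneg]
      by_cases ha : s ≤ t₁
      · simp [ha, ha.trans h12, not_lt.2 ha]
      · by_cases hb : s ≤ t₂ <;> simp [ha, hb, not_le.1 ha]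
    rw [this]
    abel
  have e1 := hy.integrable_mul hR hRb
  unfold conv
  rw [← integral_sub (e1 t₂) (e1 t₁), integral_sub hyloc hi.integral_prod_left,
    integral_integral_swap hi, ← integral_indicator measurableSet_Ioc,
    ← integral_sub (hyloc.integrable_indicator measurableSet_Ioc) hi.integral_prod_right]
  refine integral_congr_ae (ae_of_all _ fun s => ?_)
  simp only
  rw [← sub_mul, hdiff, sub_mul,
    integral_mul_const_of_integrable (hM.comp_sub_right s).restrict]
  congr 1
  simp [indicator]

lemma integrable_left_density {D : A} {Γ R : ℝ → A} (hΓ : Integrable Γ) (hR : Integrable R) :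
    Integrable fun u => D * R u + conv Γ R u :=
  (hR.const_mul D).add (integrable_conv hΓ hR)

namespace IsExtendedResolvent

variable {D : A} {Γ R : ℝ → A} (h : IsExtendedResolvent D Γ R)
include h

lemma integrable_density : Integrable fun u => D * R u + conv Γ R u :=
  integrable_left_density h.kernel_integrable h.integrable

lemma integrable_density_right : Integrable fun u => R u * D + conv R Γ u :=
  (h.integrable.mul_const D).add (integrable_conv h.integrable h.kernel_integrable)

lemma bounded : ∃ C, ∀ t, ‖R t‖ ≤ C := by
  refine ⟨‖(1 : A)‖ + ∫ u, ‖D * R u + conv Γ R u‖, fun t => ?_⟩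
  rw [h.eq t]
  refine (norm_sub_le _ _).trans (add_le_add ?_ ?_)
  · exact norm_indicator_le_norm_self (fun _ => (1 : A)) t
  · exact (norm_integral_le_integral_norm _).trans
      (setIntegral_le_integral h.integrable_density.norm (ae_of_all _ fun _ => norm_nonneg _))

/-- The resolvent also satisfies the equation with the factors in the other order. The difference
`e` of the two densities satisfies the Volterra equation `e' = -D e - Γ ⋆ e`. -/
lemma density_eq (t : ℝ) : D * R t + conv Γ R t = R t * D + conv R Γ t := by
  set N : ℝ → A := fun u => D * R u + conv Γ R u with hN
  set N' : ℝ → A := fun u => R u * D + conv R Γ u with hN'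
  have iN : Integrable N := h.integrable_density
  have iN' : Integrable N' := h.integrable_density_right
  have iΓ := h.kernel_integrable
  have iR := h.integrable
  set e : ℝ → A := fun u => N' u - N u with he
  have ie : Integrable e := iN'.sub iN
  -- the commutator of the kernel `D δ + Γ` with `N`
  have hcomm : ∀ᵐ u, N u * D + conv N Γ u - D * N u - conv Γ N u = D * e u + conv Γ e u := by
    have eR := IsL1AddLinf.of_integrable iR
    have eΓ := IsL1AddLinf.of_integrable iΓ
    have i1 := integrable_conv iΓ iR
    have i2 := integrable_conv iR iΓ
    filter_upwards [conv_assoc_ae iΓ iR eΓ, eΓ.ae_integrable_mul (iR.const_mul D),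
      eΓ.ae_integrable_mul i1, eΓ.ae_integrable_mul iR,
      (IsL1AddLinf.of_integrable iN).ae_integrable_mul iΓ,
      (IsL1AddLinf.of_integrable iN').ae_integrable_mul iΓ, eR.ae_integrable_mul iΓ,
      (IsL1AddLinf.of_integrable i2).ae_integrable_mul iΓ]
      with u h1 h2 h3 h4 h5 h6 h7 h8
    have a1 : conv N Γ u = D * conv R Γ u + conv (conv Γ R) Γ u := by
      simp only [conv, hN, add_mul] at h2 h3 ⊢
      rw [integral_add h2 h3]
      congr 1
      simp only [mul_assoc]
      rw [integral_const_mul_of_integrable h4]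
    have a2 : conv Γ e u = conv Γ N' u - conv Γ N u := by
      simp only [conv, he, mul_sub]
      exact integral_sub h6 h5
    have a3 : conv Γ N' u = conv Γ R u * D + conv Γ (conv R Γ) u := by
      have h7' : Integrable fun s => Γ (u - s) * (R s * D) := by
        simpa only [mul_assoc] using h7.mul_const D
      simp only [conv, hN', mul_add] at h8 ⊢
      rw [integral_add h7' h8]
      congr 1
      simp only [← mul_assoc]
      rw [integral_mul_const_of_integrable h7]
    rw [a2, a3, a1, h1, he]
    simp only [hN, hN', mul_add, add_mul, mul_sub]
    simp only [mul_assoc]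
    abel
  have hR : ∀ t, R t = indicator (Ici 0) (fun _ => 1) t - ∫ u in Iic t, N u := h.eq
  -- convolving with the two parts of `R`: the jump part commutes with `Γ`
  have hH : ∀ t s, Γ s * indicator (Ici (0 : ℝ)) (fun _ => (1 : A)) (t - s) =
      indicator (Ici (0 : ℝ)) (fun _ => (1 : A)) (t - s) * Γ s := by
    intro t s
    by_cases hs : s ≤ t <;> simp [indicator, hs]
  have hmeasn : Continuous fun t => ∫ u in Iic t, N u := continuous_integral_Iic iN
  have hnb : ∀ t, ‖∫ u in Iic t, N u‖ ≤ ∫ u, ‖N u‖ := fun t =>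
    (norm_integral_le_integral_norm _).trans
      (setIntegral_le_integral iN.norm (ae_of_all _ fun _ => norm_nonneg _))
  have hΓR : ∀ t, conv Γ R t = ∫ s, Γ s * R (t - s) := fun t => by
    rw [conv, ← integral_sub_left_eq_self _ volume t]
    simp
  have heq : ∀ t, e t = -∫ u in Iic t, (D * e u + conv Γ e u) := by
    intro t
    have hHm : AEStronglyMeasurable (fun s => indicator (Ici (0 : ℝ)) (fun _ => (1 : A)) (t - s))
        volume :=
      ((stronglyMeasurable_const.indicator measurableSet_Ici).comp_measurable
        (by fun_prop : Measurable fun s : ℝ => t - s)).aestronglyMeasurable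
    have hnm : AEStronglyMeasurable (fun s => ∫ u in Iic (t - s), N u) volume :=
      (hmeasn.comp (by fun_prop : Continuous fun s : ℝ => t - s)).aestronglyMeasurable
    have hHb : ∀ s, ‖indicator (Ici (0 : ℝ)) (fun _ => (1 : A)) (t - s)‖ ≤ ‖(1 : A)‖ := fun s =>
      norm_indicator_le_norm_self (fun _ => (1 : A)) _
    have b1 : conv R Γ t = (∫ s, indicator (Ici (0 : ℝ)) (fun _ => (1 : A)) (t - s) * Γ s)
        - ∫ u in Iic t, conv N Γ u := by
      rw [← integral_Iic_sub_mul iN iΓ, ← integral_sub (iΓ.bdd_mul hHm (ae_of_all _ hHb))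
        (iΓ.bdd_mul hnm (ae_of_all _ fun s => hnb _))]
      simp only [conv, hR, sub_mul]
    have b2 : conv Γ R t = (∫ s, indicator (Ici (0 : ℝ)) (fun _ => (1 : A)) (t - s) * Γ s)
        - ∫ u in Iic t, conv Γ N u := by
      rw [← mul_integral_Iic_sub iN iΓ, ← integral_sub (iΓ.bdd_mul hHm (ae_of_all _ hHb))
        (iΓ.mul_bdd hnm (ae_of_all _ fun s => hnb _)), hΓR]
      simp only [hR, mul_sub, hH]
    have b3 : R t * D - D * R t = -((∫ u in Iic t, N u * D) - ∫ u in Iic t, D * N u) := by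
      rw [integral_mul_const_of_integrable iN.restrict,
        integral_const_mul_of_integrable iN.restrict, hR]
      rw [sub_mul, mul_sub]
      by_cases ht : t ∈ Ici (0 : ℝ)
      · simp [indicator, ht]
      · simp only [indicator, ht, if_false, zero_mul, mul_zero]
        abel
    have b4 : e t = (R t * D - D * R t) + (conv R Γ t - conv Γ R t) := by
      simp only [he, hN, hN']
      abel
    rw [b4, b3, b1, b2, ← integral_congr_ae (ae_restrict_of_ae hcomm), integral_sub, integral_sub,
      integral_add]
    · abel
    all_goals
      have j1 := (iN.mul_const D).restrict (s := Iic t)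
      have j2 := (integrable_conv iN iΓ).restrict (s := Iic t)
      have j3 := (iN.const_mul D).restrict (s := Iic t)
      have j4 := (integrable_conv iΓ iN).restrict (s := Iic t)
      first
        | exact j1 | exact j2 | exact j3 | exact j4 | exact j1.add j2 | exact (j1.add j2).sub j3
  have he0 : ∀ t, t < 0 → e t = 0 := fun t ht => by
    simp [he, hN, hN', h.zero t ht, conv_eq_zero_of_neg h.kernel_zero h.zero ht,
      conv_eq_zero_of_neg h.zero h.kernel_zero ht]
  have hz := eq_zero_of_volterra iΓ h.kernel_zero he0 (C := ∫ u, ‖D * e u + conv Γ e u‖)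
    (fun t => by
      rw [heq t, norm_neg]
      exact (norm_integral_le_integral_norm _).trans (setIntegral_le_integral
        ((ie.const_mul D).add (integrable_conv iΓ ie)).norm (ae_of_all _ fun _ => norm_nonneg _)))
    heq t
  exact (sub_eq_zero.1 hz).symm

/-- Convolution with the resolvent solves the inhomogeneous linear equation. -/
lemma conv_solves {f : ℝ → A} (hf : IsL1AddLinf f) {t₁ t₂ : ℝ} (h12 : t₁ ≤ t₂) :
    conv R f t₂ - conv R f t₁ =
      ∫ t in Ioc t₁ t₂, (f t - (D * conv R f t + conv Γ (conv R f) t)) := by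
  rw [conv_sub_conv h.integrable_density h.integrable h.bounded h.eq hf h12]
  refine integral_congr_ae (ae_restrict_of_ae ?_)
  filter_upwards [conv_add_left_ae (h.integrable.const_mul D)
    (integrable_conv h.kernel_integrable h.integrable) hf,
    conv_assoc_ae h.kernel_integrable h.integrable hf] with t h1 h2
  rw [h1, h2]
  congr 2
  simp only [conv, mul_assoc]
  rw [integral_const_mul_of_integrable (hf.integrable_mul h.integrable h.bounded t)]

/-- The homogeneous linear equation on the whole real line has no nonzero bounded solution. -/
lemma eq_zero_of_bounded {y : ℝ → A} (hy : AEStronglyMeasurable y volume) {C : ℝ}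
    (hC : ∀ t, ‖y t‖ ≤ C)
    (heq : ∀ t₁ t₂, t₁ ≤ t₂ → y t₂ - y t₁ = -∫ t in Ioc t₁ t₂, (D * y t + conv Γ y t)) (t : ℝ) :
    y t = 0 := by
  have iΓ := h.kernel_integrable
  have iR := h.integrable
  have hyl : IsL1AddLinf y := .of_bounded hy ⟨C, hC⟩
  set g : ℝ → A := fun t => D * y t + conv Γ y t with hg
  have hgm : AEStronglyMeasurable g volume :=
    (hy.const_mul D).add (aestronglyMeasurable_conv iΓ.1 hy)
  have hgb : ∀ t, ‖g t‖ ≤ ‖D‖ * C + (∫ s, ‖Γ s‖) * C := fun t =>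
    (norm_add_le _ _).trans (add_le_add ((norm_mul_le _ _).trans
      (mul_le_mul_of_nonneg_left (hC t) (norm_nonneg _))) (norm_conv_le iΓ hC t))
  -- `R ⋆ g` is the convolution of `y` with the density of `-R`
  have hRg : ∀ t, conv R g t = conv (fun u => D * R u + conv Γ R u) y t := by
    intro t
    have h1 := integrable_mul_of_bounded iR ((hy.const_mul D)) (C := ‖D‖ * C)
      (fun s => (norm_mul_le _ _).trans (mul_le_mul_of_nonneg_left (hC s) (norm_nonneg _))) t
    have h2 := integrable_mul_of_bounded iR (aestronglyMeasurable_conv iΓ.1 hy)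
      (norm_conv_le iΓ hC) t
    have h3 : Integrable fun s => R (t - s) * D * y s := by simpa only [mul_assoc] using h1
    have h4 := integrable_mul_of_bounded (integrable_conv iR iΓ) hy hC t
    have h5 : (fun u => D * R u + conv Γ R u) = fun u => R u * D + conv R Γ u :=
      funext h.density_eq
    have h6 := conv_assoc_of_bounded iR iΓ hy hC t
    rw [h5]
    simp only [conv, hg, mul_add, add_mul] at h2 h4 h6 ⊢
    rw [integral_add h1 h2, integral_add h3 h4, ← h6]
    simp only [mul_assoc]
  -- hence the integral of `y` over every interval vanishes
  have hint : ∀ t₁ t₂, t₁ ≤ t₂ → ∫ t in Ioc t₁ t₂, y t = 0 := by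
    intro t₁ t₂ h12
    have e1 := conv_sub_conv h.integrable_density iR h.bounded h.eq hyl h12
    have hyloc : IntegrableOn y (Ioc t₁ t₂) :=
      Integrable.mono' (integrableOn_const (C := C) measure_Ioc_lt_top.ne) hy.restrict
        (ae_of_all _ hC)
    have hNloc : IntegrableOn (conv (fun u => D * R u + conv Γ R u) y) (Ioc t₁ t₂) :=
      Integrable.mono' (integrableOn_const measure_Ioc_lt_top.ne)
        (aestronglyMeasurable_conv h.integrable_density.1 hy).restrict
        (ae_of_all _ (norm_conv_le h.integrable_density hC))
    rw [integral_sub hyloc hNloc] at e1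
    have e2 : conv R y t₂ - conv R y t₁ = -∫ t in Ioc t₁ t₂, conv R g t := by
      have c : ∀ t, conv R y t = ∫ s, R s * y (t - s) := fun t => by
        rw [conv, ← integral_sub_left_eq_self _ volume t]
        simp
      have c' : ∀ t, conv R g t = ∫ s, R s * g (t - s) := fun t => by
        rw [conv, ← integral_sub_left_eq_self _ volume t]
        simp
      have i1 : ∀ t, Integrable fun s => R s * y (t - s) := fun t =>
        iR.mul_bdd (hy.comp_quasiMeasurePreserving
          (quasiMeasurePreserving_sub_left_of_right_invariant volume t)) (ae_of_all _ fun s => hC _)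
      have hi : Integrable (fun p : ℝ × ℝ => R p.2 * g (p.1 - p.2))
          ((volume.restrict (Ioc t₁ t₂)).prod volume) := by
        have hfin : Integrable (fun p : ℝ × ℝ => R p.2)
            ((volume.restrict (Ioc t₁ t₂)).prod volume) :=
          iR.comp_snd _
        refine hfin.mul_bdd (c := ‖D‖ * C + (∫ s, ‖Γ s‖) * C) ?_ (ae_of_all _ fun p => hgb _)
        have hq : AEStronglyMeasurable (fun p : ℝ × ℝ => g (p.1 - p.2))
            ((volume : Measure ℝ).prod volume) :=
          hgm.comp_quasiMeasurePreserving (quasiMeasurePreserving_sub_of_right_invariant _ _)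
        refine hq.mono_measure ?_
        exact Measure.prod_mono Measure.restrict_le_self le_rfl
      simp only [c, c']
      rw [← integral_sub (i1 t₂) (i1 t₁), integral_integral_swap hi, ← integral_neg]
      refine integral_congr_ae (ae_of_all _ fun s => ?_)
      have hgloc : IntegrableOn (fun t => g (t - s)) (Ioc t₁ t₂) :=
        Integrable.mono' (integrableOn_const measure_Ioc_lt_top.ne)
          (hgm.comp_quasiMeasurePreserving
            (measurePreserving_sub_right volume s).quasiMeasurePreserving).restrict
          (ae_of_all _ fun t => hgb _)
      simp only
      rw [← mul_sub, heq _ _ (sub_le_sub_right h12 s), integral_const_mul_of_integrable hgloc,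
        mul_neg, ← intervalIntegral.integral_of_le (sub_le_sub_right h12 s),
        ← intervalIntegral.integral_of_le h12,
        intervalIntegral.integral_comp_sub_right (fun t => g t) s]
    rw [e2] at e1
    simp only [hRg] at e1
    exact sub_eq_neg_self.1 e1.symm
  have hloc : LocallyIntegrable y volume := by
    refine (locallyIntegrable_const C).mono hy (ae_of_all _ fun t => ?_)
    simpa using (hC t).trans (le_abs_self C)
  have hae : y =ᵐ[volume] 0 := ae_eq_zero_of_forall_integral_Ioc hloc hint
  -- the right-hand side of the equation vanishes, so `y` is constant
  have hconst : ∀ t₁ t₂, t₁ ≤ t₂ → y t₂ = y t₁ := by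
    intro t₁ t₂ h12
    rw [← sub_eq_zero, heq t₁ t₂ h12, neg_eq_zero]
    refine integral_eq_zero_of_ae (ae_restrict_of_ae ?_)
    filter_upwards [hae] with t ht
    rw [conv_congr_right hae t, ht]
    simp [conv]
  obtain ⟨s, hs⟩ := hae.exists
  have hs' : y s = 0 := hs
  rcases le_total s t with hst | hst
  · rw [hconst s t hst, hs']
  · rw [← hconst t s hst, hs']

end IsExtendedResolvent
end Resolvent

/-! ### Matrix-valued functions as operator-valued functions -/

section MatrixOperators

variable {d : ℕ}

/-- The Banach algebra of operators of `ℝᵈ`, in which matrix-valued functions are integrated,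
differentiated and convolved. -/
abbrev Op (d : ℕ) : Type := (Fin d → ℝ) →L[ℝ] (Fin d → ℝ)

/-- The operator of a matrix. -/
noncomputable def matOp (M : Matrix (Fin d) (Fin d) ℝ) : Op d :=
  LinearMap.toContinuousLinearMap (Matrix.toLin' M)

@[simp] lemma matOp_apply (M : Matrix (Fin d) (Fin d) ℝ) (v : Fin d → ℝ) :
    matOp M v = M *ᵥ v := by simp [matOp]

/-- The matrix entries of an operator. -/
noncomputable def entry (i j : Fin d) : Op d →L[ℝ] ℝ :=
  (ContinuousLinearMap.proj i).comp (ContinuousLinearMap.apply ℝ (Fin d → ℝ) (Pi.single j 1))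

@[simp] lemma entry_matOp (M : Matrix (Fin d) (Fin d) ℝ) (i j : Fin d) :
    entry i j (matOp M) = M i j := by simp [entry]

lemma op_ext {a b : Op d} (h : ∀ i j, entry i j a = entry i j b) : a = b := by
  refine ContinuousLinearMap.coe_injective (LinearMap.pi_ext' fun j => LinearMap.ext_ring ?_)
  ext i
  simpa [entry] using h i j

/-- The matrix of an operator. -/
noncomputable def opMat (a : Op d) : Matrix (Fin d) (Fin d) ℝ := Matrix.of fun i j => entry i j a

@[simp] lemma opMat_apply (a : Op d) (i j : Fin d) : opMat a i j = entry i j a := rfl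

@[simp] lemma matOp_opMat (a : Op d) : matOp (opMat a) = a := op_ext fun i j => by simp

@[simp] lemma opMat_matOp (M : Matrix (Fin d) (Fin d) ℝ) : opMat (matOp M) = M := by
  ext i j
  simp

lemma matOp_injective : Function.Injective (matOp (d := d)) := fun M N h => by
  rw [← opMat_matOp M, h, opMat_matOp]

@[simp] lemma matOp_add (M N : Matrix (Fin d) (Fin d) ℝ) : matOp (M + N) = matOp M + matOp N :=
  op_ext fun i j => by simp

@[simp] lemma matOp_sub (M N : Matrix (Fin d) (Fin d) ℝ) : matOp (M - N) = matOp M - matOp N :=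
  op_ext fun i j => by simp

@[simp] lemma matOp_smul (c : ℝ) (M : Matrix (Fin d) (Fin d) ℝ) : matOp (c • M) = c • matOp M :=
  op_ext fun i j => by simp

@[simp] lemma matOp_zero : matOp (0 : Matrix (Fin d) (Fin d) ℝ) = 0 := op_ext fun i j => by simp

@[simp] lemma matOp_one : matOp (1 : Matrix (Fin d) (Fin d) ℝ) = 1 := by
  ext v
  simp

@[simp] lemma matOp_mul (M N : Matrix (Fin d) (Fin d) ℝ) : matOp (M * N) = matOp M * matOp N := by
  ext v
  simp

lemma entry_mul (a b : Op d) (i j : Fin d) :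
    entry i j (a * b) = ∑ k, entry i k a * entry k j b := by
  rw [← matOp_opMat a, ← matOp_opMat b, ← matOp_mul, entry_matOp, Matrix.mul_apply]
  simp

/-- The transposition of operators. -/
noncomputable def trOp : Op d →L[ℝ] Op d :=
  LinearMap.toContinuousLinearMap
    { toFun := fun a => matOp (opMat a)ᵀ
      map_add' := fun a b => op_ext fun i j => by simp
      map_smul' := fun c a => op_ext fun i j => by simp }

@[simp] lemma trOp_matOp (M : Matrix (Fin d) (Fin d) ℝ) : trOp (matOp M) = matOp Mᵀ := by
  simp [trOp]

@[simp] lemma entry_trOp (a : Op d) (i j : Fin d) : entry i j (trOp a) = entry j i a := by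
  simp [trOp]

lemma trOp_mul (a b : Op d) : trOp (a * b) = trOp b * trOp a := by
  rw [← matOp_opMat a, ← matOp_opMat b, ← matOp_mul, trOp_matOp, Matrix.transpose_mul, matOp_mul,
    trOp_matOp, trOp_matOp]

lemma trOp_one : trOp (1 : Op d) = 1 := by
  rw [← matOp_one, trOp_matOp, Matrix.transpose_one]

/-- The passage from the entries of a matrix to its operator, as a continuous linear map. -/
noncomputable def entriesToOp : (Fin d → Fin d → ℝ) →L[ℝ] Op d :=
  LinearMap.toContinuousLinearMap
    { toFun := fun a => matOp (Matrix.of a)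
      map_add' := fun a b => op_ext fun i j => by simp
      map_smul' := fun c a => op_ext fun i j => by simp }

lemma entriesToOp_apply (M : Matrix (Fin d) (Fin d) ℝ) :
    entriesToOp (fun i j => M i j) = matOp M := op_ext fun i j => by simp [entriesToOp]

lemma exists_norm_matOp_le {ι : Type*} {f : ι → Matrix (Fin d) (Fin d) ℝ}
    (h : ∀ i j, ∃ C, ∀ t, |f t i j| ≤ C) : ∃ C, ∀ t, ‖matOp (f t)‖ ≤ C := by
  choose C hC using h
  refine ⟨‖entriesToOp (d := d)‖ * ∑ i, ∑ j, |C i j|, fun t => ?_⟩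
  rw [← entriesToOp_apply]
  refine (entriesToOp.le_opNorm _).trans (mul_le_mul_of_nonneg_left ?_ (norm_nonneg _))
  have h0 : ∀ i, 0 ≤ ∑ j, |C i j| := fun i => Finset.sum_nonneg fun j _ => abs_nonneg _
  refine (pi_norm_le_iff_of_nonneg (Finset.sum_nonneg fun i _ => h0 i)).2 fun i => ?_
  refine le_trans ?_ (Finset.single_le_sum (fun i _ => h0 i) (Finset.mem_univ i))
  refine (pi_norm_le_iff_of_nonneg (h0 i)).2 fun j => ?_
  refine le_trans ?_ (Finset.single_le_sum (fun j _ => abs_nonneg (C i j)) (Finset.mem_univ j))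
  exact (hC i j t).trans (le_abs_self _)

section Integrals

variable {X : Type*} [MeasurableSpace X] {μ : Measure X}

lemma integrable_matOp {f : X → Matrix (Fin d) (Fin d) ℝ}
    (h : ∀ i j, Integrable (fun x => f x i j) μ) : Integrable (fun x => matOp (f x)) μ := by
  simp only [← entriesToOp_apply]
  exact entriesToOp.integrable_comp (.of_eval fun i => .of_eval fun j => h i j)

lemma integrable_entry {f : X → Op d} (h : Integrable f μ) (i j : Fin d) :
    Integrable (fun x => entry i j (f x)) μ := (entry i j).integrable_comp h

lemma integrable_op {f : X → Op d} (h : ∀ i j, Integrable (fun x => entry i j (f x)) μ) :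
    Integrable f μ := by
  simpa using integrable_matOp (f := fun x => opMat (f x)) h

lemma memLp_matOp {f : X → Matrix (Fin d) (Fin d) ℝ} {p : ℝ≥0∞}
    (h : ∀ i j, MemLp (fun x => f x i j) p μ) : MemLp (fun x => matOp (f x)) p μ := by
  simp only [← entriesToOp_apply]
  exact entriesToOp.comp_memLp' (.of_eval fun i => .of_eval fun j => h i j)

lemma aestronglyMeasurable_matOp {f : X → Matrix (Fin d) (Fin d) ℝ}
    (h : ∀ i j, AEStronglyMeasurable (fun x => f x i j) μ) :
    AEStronglyMeasurable (fun x => matOp (f x)) μ := by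
  simp only [← entriesToOp_apply]
  exact entriesToOp.continuous.comp_aestronglyMeasurable
    (aemeasurable_pi_iff.2 fun i => aemeasurable_pi_iff.2 fun j =>
      (h i j).aemeasurable).aestronglyMeasurable

lemma entry_integral {f : X → Op d} (h : Integrable f μ) (i j : Fin d) :
    entry i j (∫ x, f x ∂μ) = ∫ x, entry i j (f x) ∂μ :=
  ((entry i j).integral_comp_comm h).symm

end Integrals

lemma hasDerivAt_matOp {f : ℝ → Matrix (Fin d) (Fin d) ℝ} {f' : Matrix (Fin d) (Fin d) ℝ} {t : ℝ}
    (h : ∀ i j, HasDerivAt (fun u => f u i j) (f' i j) t) :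
    HasDerivAt (fun u => matOp (f u)) (matOp f') t := by
  simp only [← entriesToOp_apply]
  exact entriesToOp.hasFDerivAt.comp_hasDerivAt t
    (hasDerivAt_pi.2 fun i => hasDerivAt_pi.2 fun j => h i j)

lemma continuousOn_matOp {f : ℝ → Matrix (Fin d) (Fin d) ℝ} {s : Set ℝ}
    (h : ∀ i j, ContinuousOn (fun u => f u i j) s) : ContinuousOn (fun u => matOp (f u)) s := by
  simp only [← entriesToOp_apply]
  exact entriesToOp.continuous.comp_continuousOn
    (continuousOn_pi.2 fun i => continuousOn_pi.2 fun j => h i j)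

end MatrixOperators

/-! ### The resolvent and the memory kernel on the whole real line -/

section Extension

variable {d : ℕ}

/-- A matrix-valued function on `[0, ∞)`, extended by zero. -/
noncomputable def extendZero (r : ℝ → Matrix (Fin d) (Fin d) ℝ) : ℝ → Matrix (Fin d) (Fin d) ℝ :=
  indicator (Ici 0) r

lemma extendZero_of_nonneg (r : ℝ → Matrix (Fin d) (Fin d) ℝ) {t : ℝ} (ht : 0 ≤ t) :
    extendZero r t = r t := indicator_of_mem (by exact ht) r

lemma extendZero_of_neg (r : ℝ → Matrix (Fin d) (Fin d) ℝ) {t : ℝ} (ht : t < 0) :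
    extendZero r t = 0 := indicator_of_notMem (by simpa using ht) r

/-- `Γ` is a measurable version of the memory kernel `γ`, extended by zero to `(-∞, 0]`. -/
structure IsExtendedKernel (γ Γ : ℝ → Matrix (Fin d) (Fin d) ℝ) : Prop where
  measurable : ∀ i j, Measurable fun t => Γ t i j
  integrable : ∀ i j, Integrable fun t => Γ t i j
  zero : ∀ t, t ≤ 0 → Γ t = 0
  ae_eq : ∀ᵐ t, 0 < t → γ t = Γ t

lemma exists_isExtendedKernel {γ : ℝ → Matrix (Fin d) (Fin d) ℝ} (hγ : IsL1Pos γ) :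
    ∃ Γ, IsExtendedKernel γ Γ := by
  have hm : ∀ i j, StronglyMeasurable ((hγ i j).1.mk _) := fun i j =>
    (hγ i j).1.stronglyMeasurable_mk
  refine ⟨fun t => Matrix.of fun i j => indicator (Ioi 0) ((hγ i j).1.mk _) t, fun i j => ?_,
    fun i j => ?_, fun t ht => ?_, ?_⟩
  · exact ((hm i j).indicator measurableSet_Ioi).measurable
  · exact (integrable_indicator_iff measurableSet_Ioi).2 ((hγ i j).congr (hγ i j).1.ae_eq_mk)
  · ext i j
    simp [indicator, not_lt.2 ht]
  · have : ∀ᵐ t, ∀ i j, 0 < t → γ t i j = (hγ i j).1.mk _ t := by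
      rw [ae_all_iff]
      intro i
      rw [ae_all_iff]
      intro j
      exact (ae_restrict_iff' measurableSet_Ioi).1 (hγ i j).1.ae_eq_mk
    filter_upwards [this] with t ht h0
    ext i j
    simp [indicator, h0, ht i j h0]

variable {D : Matrix (Fin d) (Fin d) ℝ} {γ Γ r : ℝ → Matrix (Fin d) (Fin d) ℝ}

lemma IsExtendedKernel.ae_eq_sub (hΓ : IsExtendedKernel γ Γ) (t : ℝ) :
    ∀ᵐ s, s < t → γ (t - s) = Γ (t - s) := by
  filter_upwards [(quasiMeasurePreserving_sub_left_of_right_invariant volume t).ae hΓ.ae_eq]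
    with s hs hst
  exact hs (by linarith)

lemma integrable_extendZero (hr1 : IsL1Pos r) (i j : Fin d) :
    Integrable fun t => extendZero r t i j := by
  have h : (fun t => extendZero r t i j) = indicator (Ici 0) fun t => r t i j := by
    ext t
    by_cases ht : t ∈ Ici (0 : ℝ) <;> simp [extendZero, ht]
  rw [h, integrable_indicator_iff measurableSet_Ici, integrableOn_Ici_iff_integrableOn_Ioi]
  exact hr1 i j

/-- The derivative of the resolvent at a positive time, as a matrix. -/
noncomputable def resolventDeriv (D : Matrix (Fin d) (Fin d) ℝ)
    (γ r : ℝ → Matrix (Fin d) (Fin d) ℝ) (t : ℝ) : Matrix (Fin d) (Fin d) ℝ :=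
  Matrix.of fun i j => -(D * r t) i j - ∫ s in (0 : ℝ)..t, (γ (t - s) * r s) i j

lemma IsDifferentialResolvent.hasDerivAt (hr : IsDifferentialResolvent D γ r) {t : ℝ}
    (ht : 0 < t) : HasDerivAt (fun u => matOp (r u)) (matOp (resolventDeriv D γ r t)) t :=
  hasDerivAt_matOp fun i j => (hr.deriv t ht.le i j).hasDerivAt (Ici_mem_nhds ht)

lemma IsDifferentialResolvent.continuousOn (hr : IsDifferentialResolvent D γ r) :
    ContinuousOn (fun u => matOp (r u)) (Ici 0) :=
  continuousOn_matOp fun i j t ht => (hr.deriv t ht i j).continuousWithinAt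

lemma ae_resolventDeriv_eq (hΓ : IsExtendedKernel γ Γ) (hr1 : IsL1Pos r) :
    ∀ᵐ t, 0 < t → matOp (resolventDeriv D γ r t) =
      -(matOp D * matOp (extendZero r t) +
        conv (fun u => matOp (Γ u)) (fun u => matOp (extendZero r u)) t) := by
  have iΓ : Integrable fun u => matOp (Γ u) := integrable_matOp hΓ.integrable
  have iR : Integrable fun u => matOp (extendZero r u) :=
    integrable_matOp (integrable_extendZero hr1)
  filter_upwards [(IsL1AddLinf.of_integrable iR).ae_integrable_mul iΓ] with t ht h0
  refine op_ext fun i j => ?_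
  have h1 : entry i j (conv (fun u => matOp (Γ u)) (fun u => matOp (extendZero r u)) t) =
      ∫ s in (0 : ℝ)..t, (γ (t - s) * r s) i j := by
    rw [conv, entry_integral ht, intervalIntegral.integral_of_le h0.le,
      ← integral_indicator measurableSet_Ioc]
    refine integral_congr_ae ?_
    have hne : ∀ᵐ s : ℝ, s ≠ 0 ∧ s ≠ t := by
      refine Filter.Eventually.and ?_ ?_ <;> exact Measure.ae_ne volume _
    filter_upwards [hΓ.ae_eq_sub t, hne] with s hs hn
    rw [← matOp_mul, entry_matOp]
    rcases lt_or_gt_of_ne hn.1 with h | h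
    · rw [extendZero_of_neg r h, indicator_of_notMem (fun hh => absurd hh.1 (not_lt.2 h.le))]
      simp
    · rcases lt_or_gt_of_ne hn.2 with h' | h'
      · rw [extendZero_of_nonneg r h.le, indicator_of_mem (by exact ⟨h, h'.le⟩), hs h']
      · rw [hΓ.zero _ (by linarith), indicator_of_notMem (fun hh => absurd hh.2 (not_le.2 h'))]
        simp
  rw [entry_matOp, map_neg, map_add, h1, ← matOp_mul, entry_matOp, extendZero_of_nonneg r h0.le]
  simp only [resolventDeriv, Matrix.of_apply]
  ring

lemma IsDifferentialResolvent.isExtendedResolvent (hr : IsDifferentialResolvent D γ r)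
    (hΓ : IsExtendedKernel γ Γ) (hr1 : IsL1Pos r) :
    IsExtendedResolvent (matOp D) (fun t => matOp (Γ t)) (fun t => matOp (extendZero r t)) := by
  have iΓ : Integrable fun u => matOp (Γ u) := integrable_matOp hΓ.integrable
  have iR : Integrable fun u => matOp (extendZero r u) :=
    integrable_matOp (integrable_extendZero hr1)
  have zΓ : ∀ t, t < 0 → matOp (Γ t) = 0 := fun t ht => by rw [hΓ.zero t ht.le, matOp_zero]
  have zR : ∀ t, t < 0 → matOp (extendZero r t) = 0 := fun t ht => by
    rw [extendZero_of_neg r ht, matOp_zero]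
  refine ⟨iΓ, zΓ, iR, zR, fun t => ?_⟩
  have iN := integrable_left_density (D := matOp D) iΓ iR
  have zN : ∀ t, t < 0 → matOp D * matOp (extendZero r t) +
      conv (fun u => matOp (Γ u)) (fun u => matOp (extendZero r u)) t = 0 := fun t ht => by
    rw [zR t ht, conv_eq_zero_of_neg zΓ zR ht, mul_zero, add_zero]
  rcases lt_or_ge t 0 with ht | ht
  · rw [zR t ht, indicator_of_notMem (by simpa using ht),
      setIntegral_eq_zero_of_forall_eq_zero (t := Iic t)
        fun u hu => zN u (lt_of_le_of_lt hu ht), sub_zero]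
  · have hae : ∀ᵐ u ∂volume.restrict (Ioc 0 t), -(matOp D * matOp (extendZero r u) +
      conv (fun u => matOp (Γ u)) (fun u => matOp (extendZero r u)) u) =
        matOp (resolventDeriv D γ r u) := by
      rw [ae_restrict_iff' measurableSet_Ioc]
      filter_upwards [ae_resolventDeriv_eq (D := D) hΓ hr1] with u hu h0
      exact (hu h0.1).symm
    have hint : IntervalIntegrable (fun u => matOp (resolventDeriv D γ r u)) volume 0 t := by
      rw [intervalIntegrable_iff_integrableOn_Ioc_of_le ht]
      exact (iN.neg.integrableOn (s := Ioc 0 t)).congr hae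
    have hftc := intervalIntegral.integral_eq_sub_of_hasDerivAt_of_le ht
      (hr.continuousOn.mono Icc_subset_Ici_self) (fun u hu => hr.hasDerivAt hu.1) hint
    rw [setIntegral_Iic_eq_intervalIntegral zN ht, indicator_of_mem (by exact ht),
      extendZero_of_nonneg r ht]
    rw [intervalIntegral.integral_of_le ht, ← integral_congr_ae hae, integral_neg,
      ← intervalIntegral.integral_of_le ht, hr.initial, matOp_one] at hftc
    rw [sub_eq_add_neg, hftc]
    abel

end Extension

/-! ### The double integrals of the autocorrelation formulas -/

section DoubleIntegral

variable {A : Type*} [NormedRing A] [NormedAlgebra ℝ A] [CompleteSpace A]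

lemma integrable_mul_kernel_mul {a b K : ℝ → A} (ha : Integrable a) (hab : ∃ C, ∀ s, ‖a s‖ ≤ C)
    (hb : Integrable b) (hK : IsL1AddLinf K) (t : ℝ) :
    Integrable (fun p : ℝ × ℝ => a p.1 * K (t + p.2 - p.1) * b p.2)
      ((volume : Measure ℝ).prod volume) := by
  obtain ⟨C, hC⟩ := hab
  obtain ⟨K₁, K₂, h1, h2, ⟨C', hC'⟩, rfl⟩ := hK
  simp only [mul_add, add_mul]
  have haf : AEStronglyMeasurable (fun p : ℝ × ℝ => a p.1) ((volume : Measure ℝ).prod volume) :=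
    ha.1.comp_fst
  refine Integrable.add ?_ ?_
  · have := Integrable.convolution_integrand (ContinuousLinearMap.mul ℝ A).flip hb
      (h1.comp_sub_left t)
    refine (this.bdd_mul haf (ae_of_all _ fun p => hC _)).congr (ae_of_all _ fun p => ?_)
    simp only [ContinuousLinearMap.flip_apply, ContinuousLinearMap.mul_apply', mul_assoc]
    congr 3
    ring
  · have hq : Measure.QuasiMeasurePreserving (fun p : ℝ × ℝ => t + p.2 - p.1)
        ((volume : Measure ℝ).prod volume) volume := by
      have h3 := (quasiMeasurePreserving_sub_left_of_right_invariant (volume : Measure ℝ) t).comp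
        (quasiMeasurePreserving_sub_of_right_invariant (volume : Measure ℝ) (volume : Measure ℝ))
      convert h3 using 1
      ext p
      simp only [Function.comp_apply]
      ring
    have hn : Integrable (fun p : ℝ × ℝ => ‖a p.1‖ * C' * ‖b p.2‖)
        ((volume : Measure ℝ).prod volume) := (ha.norm.mul_const C').mul_prod hb.norm
    refine hn.mono' ((haf.mul (h2.comp_quasiMeasurePreserving hq)).mul hb.1.comp_snd)
      (ae_of_all _ fun p => ?_)
    refine (norm_mul_le _ _).trans (mul_le_mul_of_nonneg_right ?_ (norm_nonneg _))
    exact (norm_mul_le _ _).trans (mul_le_mul_of_nonneg_left (hC' _) (norm_nonneg _))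

lemma integrable_symmetrized {Γ : ℝ → A} (hΓ : Integrable Γ) (T : A →L[ℝ] A) (S : A) :
    Integrable fun u => Γ u * S + S * T (Γ (-u)) :=
  (hΓ.mul_const S).add ((T.integrable_comp hΓ.comp_neg).const_mul S)

lemma conv_eq_integral_mul_sub (f g : ℝ → A) (t : ℝ) : conv f g t = ∫ s, f s * g (t - s) := by
  rw [conv, ← integral_sub_left_eq_self _ volume t]
  simp

namespace IsExtendedResolvent

variable {D : A} {Γ R : ℝ → A} (h : IsExtendedResolvent D Γ R)
include h

lemma bounded_conv : ∃ C, ∀ t, ‖conv R Γ t‖ ≤ C := by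
  obtain ⟨C, hC⟩ := h.bounded
  refine ⟨C * ∫ s, ‖Γ s‖, fun t => ?_⟩
  rw [conv_eq_integral_mul_sub]
  calc ‖∫ s, R s * Γ (t - s)‖ ≤ ∫ s, C * ‖Γ (t - s)‖ :=
        norm_integral_le_of_norm_le ((h.kernel_integrable.comp_sub_left t).norm.const_mul C)
          (ae_of_all _ fun s => (norm_mul_le _ _).trans
            (mul_le_mul_of_nonneg_right (hC s) (norm_nonneg _)))
    _ = C * ∫ s, ‖Γ s‖ := by
        rw [integral_const_mul, integral_sub_left_eq_self (fun s => ‖Γ s‖) volume t]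

/-- The double integral of the symmetrized memory kernel, in terms of the convolution of the
resolvent with the memory kernel. -/
lemma doubleIntegral_kernel {T : A →L[ℝ] A} (hT : ∀ a b, T (a * b) = T b * T a) {S : A}
    {K : ℝ → A} (hK : K =ᵐ[volume] fun u => Γ u * S + S * T (Γ (-u))) (t : ℝ) :
    ∫ σ, ∫ τ, R σ * K (t + τ - σ) * T (R τ) =
      (∫ τ, conv R Γ (t + τ) * S * T (R τ)) + ∫ τ, R (t + τ) * S * T (conv R Γ τ) := by
  have iΓ := h.kernel_integrable
  have iR := h.integrable
  have iTR : Integrable fun τ => T (R τ) := T.integrable_comp iR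
  have i1 := integrable_mul_kernel_mul iR h.bounded iTR
    (IsL1AddLinf.of_integrable (iΓ.mul_const S)) t
  have i2 := integrable_mul_kernel_mul iR h.bounded iTR
    (IsL1AddLinf.of_integrable ((T.integrable_comp iΓ.comp_neg).const_mul S)) t
  have hcongr : ∀ σ, ∫ τ, R σ * K (t + τ - σ) * T (R τ) =
      ∫ τ, (R σ * (Γ (t + τ - σ) * S) * T (R τ) +
        R σ * (S * T (Γ (-(t + τ - σ)))) * T (R τ)) := by
    intro σ
    refine integral_congr_ae ?_
    have hq : Measure.QuasiMeasurePreserving (fun τ : ℝ => t + τ - σ) volume volume := by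
      have := (measurePreserving_add_right (volume : Measure ℝ) (t - σ)).quasiMeasurePreserving
      convert this using 1
      ext τ
      ring
    filter_upwards [hq.ae hK] with τ hτ
    rw [hτ]
    simp only [mul_add, add_mul]
  simp only [hcongr]
  have e1 : ∫ σ, ∫ τ, (R σ * (Γ (t + τ - σ) * S) * T (R τ) +
        R σ * (S * T (Γ (-(t + τ - σ)))) * T (R τ)) =
      (∫ σ, ∫ τ, R σ * (Γ (t + τ - σ) * S) * T (R τ)) +
        ∫ σ, ∫ τ, R σ * (S * T (Γ (-(t + τ - σ)))) * T (R τ) := integral_integral_add i1 i2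
  rw [e1]
  congr 1
  · rw [integral_integral_swap i1]
    refine integral_congr_ae (ae_of_all _ fun τ => ?_)
    have hi : Integrable fun σ => R σ * Γ (t + τ - σ) :=
      (iΓ.comp_sub_left (t + τ)).bdd_mul iR.1 (ae_of_all _ h.bounded.choose_spec)
    simp only
    rw [conv_eq_integral_mul_sub, mul_assoc, ← integral_mul_const_of_integrable hi]
    simp only [mul_assoc]
  · rw [← integral_add_left_eq_self _ t]
    refine integral_congr_ae (ae_of_all _ fun σ => ?_)
    have hi : Integrable fun τ => R τ * Γ (σ - τ) :=
      (iΓ.comp_sub_left σ).bdd_mul iR.1 (ae_of_all _ h.bounded.choose_spec)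
    simp only
    rw [conv_eq_integral_mul_sub, ← T.integral_comp_comm hi,
      ← integral_const_mul_of_integrable (T.integrable_comp hi)]
    refine integral_congr_ae (ae_of_all _ fun τ => ?_)
    simp only [hT, mul_assoc]
    congr 4
    ring_nf

lemma tendsto_zero {q : ℝ → A} (hq : ∀ τ, 0 < τ → HasDerivAt R (q τ) τ)
    (hqN : ∀ᵐ τ, 0 < τ → q τ = -(D * R τ + conv Γ R τ)) : Tendsto R atTop (𝓝 0) := by
  refine tendsto_zero_of_hasDerivAt_of_integrableOn_Ioi (a := 0) (fun x hx => hq x hx) ?_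
    h.integrable.integrableOn
  refine (h.integrable_density.neg.integrableOn (s := Ioi 0)).congr ?_
  rw [EventuallyEq, ae_restrict_iff' measurableSet_Ioi]
  filter_upwards [hqN] with τ hτ h0
  exact (hτ h0).symm

lemma continuousOn : ContinuousOn R (Ici 0) := by
  have : ContinuousOn (fun t => 1 - ∫ u in Iic t, (D * R u + conv Γ R u)) (Ici 0) :=
    (continuous_const.sub (continuous_integral_Iic h.integrable_density)).continuousOn
  refine this.congr fun t ht => ?_
  rw [h.eq t, indicator_of_mem ht]

lemma apply_zero : R 0 = 1 := by
  rw [h.eq 0, indicator_of_mem (by simp), sub_eq_self, integral_Iic_eq_integral_Iio]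
  exact setIntegral_eq_zero_of_forall_eq_zero fun u hu => by
    rw [h.zero u hu, conv_eq_zero_of_neg h.kernel_zero h.zero hu, mul_zero, add_zero]

/-- Integrating the derivative of `τ ↦ R(t + τ) S R(τ)*` over `(0, ∞)`, with the derivative of
`R` given by the resolvent equation in which `R` stands on the left. -/
lemma mul_eq_integrals {T : A →L[ℝ] A} (hT : ∀ a b, T (a * b) = T b * T a) (hT1 : T 1 = 1) {S : A}
    {K : ℝ → A} (hK : K =ᵐ[volume] fun u => Γ u * S + S * T (Γ (-u)))
    {q : ℝ → A} (hq : ∀ τ, 0 < τ → HasDerivAt R (q τ) τ)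
    (hqN : ∀ᵐ τ, 0 < τ → q τ = -(D * R τ + conv Γ R τ)) {t : ℝ} (ht : 0 ≤ t) :
    R t * S = (∫ τ, R (t + τ) * (D * S + S * T D) * T (R τ)) +
      ∫ σ, ∫ τ, R σ * K (t + τ - σ) * T (R τ) := by
  have iR := h.integrable
  have iTR : Integrable fun τ => T (R τ) := T.integrable_comp iR
  obtain ⟨C, hC⟩ := h.bounded
  obtain ⟨C', hC'⟩ := h.bounded_conv
  have iC := integrable_conv iR h.kernel_integrable
  have iCt : Integrable fun τ => conv R Γ (t + τ) := iC.comp_add_left t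
  have iRt : Integrable fun τ => R (t + τ) := iR.comp_add_left t
  have j1 : Integrable fun τ => R (t + τ) * D * S * T (R τ) :=
    iTR.bdd_mul (c := C * ‖D‖ * ‖S‖) ((iRt.1.mul_const D).mul_const S) (ae_of_all _ fun τ =>
      (norm_mul_le _ _).trans (mul_le_mul_of_nonneg_right ((norm_mul_le _ _).trans
        (mul_le_mul_of_nonneg_right (hC _) (norm_nonneg _))) (norm_nonneg _)))
  have j2 : Integrable fun τ => conv R Γ (t + τ) * S * T (R τ) :=
    iTR.bdd_mul (c := C' * ‖S‖) (iCt.1.mul_const S) (ae_of_all _ fun τ =>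
      (norm_mul_le _ _).trans (mul_le_mul_of_nonneg_right (hC' _) (norm_nonneg _)))
  have hRS : ∀ τ, ‖R (t + τ) * S‖ ≤ C * ‖S‖ := fun τ =>
      (norm_mul_le _ _).trans (mul_le_mul_of_nonneg_right (hC _) (norm_nonneg _))
  have j3 : Integrable fun τ => R (t + τ) * S * (T D * T (R τ)) :=
    (iTR.const_mul (T D)).bdd_mul (iRt.1.mul_const S) (ae_of_all _ hRS)
  have j4 : Integrable fun τ => R (t + τ) * S * T (conv R Γ τ) :=
    (T.integrable_comp iC).bdd_mul (iRt.1.mul_const S) (ae_of_all _ hRS)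
  -- the derivative of the product, for almost every positive time
  have hdae : ∀ᵐ τ ∂volume.restrict (Ioi 0),
      -((R (t + τ) * D * S * T (R τ) + conv R Γ (t + τ) * S * T (R τ)) +
        (R (t + τ) * S * (T D * T (R τ)) + R (t + τ) * S * T (conv R Γ τ))) =
      q (t + τ) * S * T (R τ) + R (t + τ) * S * T (q τ) := by
    rw [ae_restrict_iff' measurableSet_Ioi]
    filter_upwards [hqN, (measurePreserving_add_left (volume : Measure ℝ)
      t).quasiMeasurePreserving.ae hqN] with τ h1 h2 h0
    rw [h1 h0, h2 (add_pos_of_nonneg_of_pos ht h0), h.density_eq, h.density_eq]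
    simp only [map_neg, map_add, hT, mul_add, add_mul, neg_mul, mul_neg, neg_add]
  have j12 : Integrable fun τ => R (t + τ) * D * S * T (R τ) + conv R Γ (t + τ) * S * T (R τ) :=
    j1.add j2
  have j34 : Integrable fun τ =>
      R (t + τ) * S * (T D * T (R τ)) + R (t + τ) * S * T (conv R Γ τ) := j3.add j4
  have jsum := j12.add j34
  have hderiv : ∀ τ ∈ Ioi (0 : ℝ), HasDerivAt (fun τ => R (t + τ) * S * T (R τ))
      (q (t + τ) * S * T (R τ) + R (t + τ) * S * T (q τ)) τ := by
    intro τ hτ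
    have d1 : HasDerivAt (fun τ => R (t + τ)) (q (t + τ)) τ :=
      HasDerivAt.comp_const_add t τ (hq (t + τ) (add_pos_of_nonneg_of_pos ht hτ))
    have d2 : HasDerivAt (fun τ => T (R τ)) (T (q τ)) τ :=
      T.hasFDerivAt.comp_hasDerivAt τ (hq τ hτ)
    exact (d1.mul_const S).mul d2
  have hcont : ContinuousWithinAt (fun τ => R (t + τ) * S * T (R τ)) (Ici 0) 0 := by
    have c1 : ContinuousOn (fun τ => R (t + τ)) (Ici 0) :=
      h.continuousOn.comp (by fun_prop) fun τ hτ => add_nonneg ht hτ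
    exact ((c1.mul continuousOn_const).mul
      (T.continuous.comp_continuousOn h.continuousOn)) 0 self_mem_Ici
  have hlim : Tendsto (fun τ => R (t + τ) * S * T (R τ)) atTop (𝓝 0) := by
    have l1 := h.tendsto_zero hq hqN
    have l2 : Tendsto (fun τ => R (t + τ)) atTop (𝓝 0) :=
      l1.comp (tendsto_atTop_add_const_left _ t tendsto_id)
    have l3 : Tendsto (fun τ => T (R τ)) atTop (𝓝 0) := by
      simpa [Function.comp_def] using (T.continuous.tendsto 0).comp l1
    simpa using (l2.mul_const S).mul l3
  have hftc := integral_Ioi_of_hasDerivAt_of_tendsto hcont hderiv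
    ((jsum.neg.integrableOn (s := Ioi 0)).congr hdae) hlim
  rw [← integral_congr_ae hdae, integral_neg, zero_sub, neg_inj, add_zero, h.apply_zero, hT1,
    mul_one] at hftc
  have hz : ∀ τ, τ ∉ Ici (0 : ℝ) →
      (R (t + τ) * D * S * T (R τ) + conv R Γ (t + τ) * S * T (R τ)) +
        (R (t + τ) * S * (T D * T (R τ)) + R (t + τ) * S * T (conv R Γ τ)) = 0 := by
    intro τ hτ
    have hτ' : τ < 0 := by simpa using hτ
    rw [h.zero τ hτ', conv_eq_zero_of_neg h.zero h.kernel_zero hτ']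
    simp
  rw [← integral_Ici_eq_integral_Ioi, setIntegral_eq_integral_of_forall_compl_eq_zero hz,
    integral_add j12 j34, integral_add j1 j2, integral_add j3 j4] at hftc
  rw [h.doubleIntegral_kernel hT hK t, ← hftc]
  have e : (∫ τ, R (t + τ) * (D * S + S * T D) * T (R τ)) =
      (∫ τ, R (t + τ) * D * S * T (R τ)) + ∫ τ, R (t + τ) * S * (T D * T (R τ)) := by
    rw [← integral_add j1 j3]
    refine integral_congr_ae (ae_of_all _ fun τ => ?_)
    simp only [mul_add, add_mul, mul_assoc]
  rw [e]
  abel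

end IsExtendedResolvent
end DoubleIntegral

/-! ### The two terms of the autocorrelation formulas as operator integrals -/

section MatrixIntegrals

variable {d : ℕ} {D : Matrix (Fin d) (Fin d) ℝ} {γ Γ r : ℝ → Matrix (Fin d) (Fin d) ℝ}

/-- The operator-valued extension of a matrix-valued function on `[0, ∞)` by zero. -/
noncomputable def extOp (r : ℝ → Matrix (Fin d) (Fin d) ℝ) (t : ℝ) : Op d :=
  matOp (extendZero r t)

lemma extOp_of_nonneg (r : ℝ → Matrix (Fin d) (Fin d) ℝ) {t : ℝ} (ht : 0 ≤ t) :
    extOp r t = matOp (r t) := by rw [extOp, extendZero_of_nonneg r ht]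

lemma extOp_of_neg (r : ℝ → Matrix (Fin d) (Fin d) ℝ) {t : ℝ} (ht : t < 0) :
    extOp r t = 0 := by rw [extOp, extendZero_of_neg r ht, matOp_zero]

variable (hR : IsExtendedResolvent (matOp D) (fun t => matOp (Γ t)) (extOp r))
include hR

lemma integrable_single (M : Matrix (Fin d) (Fin d) ℝ) (t : ℝ) :
    Integrable fun τ => extOp r (t + τ) * matOp M * trOp (extOp r τ) := by
  obtain ⟨C, hC⟩ := hR.bounded
  refine (trOp.integrable_comp hR.integrable).bdd_mul (c := C * ‖matOp M‖)
    ((hR.integrable.comp_add_left t).1.mul_const _) (ae_of_all _ fun τ => ?_)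
  exact (norm_mul_le _ _).trans (mul_le_mul_of_nonneg_right (hC _) (norm_nonneg _))

lemma integrable_double {k : ℝ → Matrix (Fin d) (Fin d) ℝ} (hk : IsL1AddLinf fun u => matOp (k u))
    (t : ℝ) : Integrable (fun p : ℝ × ℝ =>
      extOp r p.1 * matOp (k (t + p.2 - p.1)) * trOp (extOp r p.2))
      ((volume : Measure ℝ).prod volume) :=
  integrable_mul_kernel_mul (K := fun u => matOp (k u)) hR.integrable hR.bounded
    (trOp.integrable_comp hR.integrable) hk t

omit hR in
lemma entry_single (M : Matrix (Fin d) (Fin d) ℝ) {t τ : ℝ} (ht : 0 ≤ t) (hτ : 0 ≤ τ)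
    (i j : Fin d) : entry i j (extOp r (t + τ) * matOp M * trOp (extOp r τ)) =
      (r (t + τ) * M * (r τ)ᵀ) i j := by
  rw [extOp_of_nonneg r hτ, extOp_of_nonneg r (add_nonneg ht hτ), trOp_matOp, ← matOp_mul,
    ← matOp_mul, entry_matOp]

omit hR in
lemma entry_double (M : Matrix (Fin d) (Fin d) ℝ) {σ τ : ℝ} (hσ : 0 ≤ σ) (hτ : 0 ≤ τ)
    (i j : Fin d) : entry i j (extOp r σ * matOp M * trOp (extOp r τ)) =
      (r σ * M * (r τ)ᵀ) i j := by
  rw [extOp_of_nonneg r hτ, extOp_of_nonneg r hσ, trOp_matOp, ← matOp_mul,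
    ← matOp_mul, entry_matOp]

lemma singleTermConverges (M : Matrix (Fin d) (Fin d) ℝ) {t : ℝ} (ht : 0 ≤ t) :
    SingleTermConverges r M t := by
  intro i j
  refine ((integrable_entry (integrable_single hR M t) i j).integrableOn (s := Ioi 0)).congr ?_
  filter_upwards [ae_restrict_mem measurableSet_Ioi] with τ hτ
  exact entry_single M ht (le_of_lt hτ) i j

lemma matOp_singleTerm (M : Matrix (Fin d) (Fin d) ℝ) {t : ℝ} (ht : 0 ≤ t) :
    matOp (singleTerm r M t) = ∫ τ, extOp r (t + τ) * matOp M * trOp (extOp r τ) := by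
  refine op_ext fun i j => ?_
  rw [entry_matOp, entry_integral (integrable_single hR M t)]
  have hz : ∀ τ, τ ∉ Ici (0 : ℝ) →
      entry i j (extOp r (t + τ) * matOp M * trOp (extOp r τ)) = 0 := fun τ hτ => by
    rw [extOp_of_neg r (t := τ) (by simpa using hτ), map_zero, mul_zero, map_zero]
  rw [← setIntegral_eq_integral_of_forall_compl_eq_zero hz, integral_Ici_eq_integral_Ioi]
  refine setIntegral_congr_fun measurableSet_Ioi fun τ hτ => ?_
  exact (entry_single M ht (le_of_lt hτ) i j).symm

lemma doubleTermConverges {k : ℝ → Matrix (Fin d) (Fin d) ℝ}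
    (hk : IsL1AddLinf fun u => matOp (k u)) (t : ℝ) : DoubleTermConverges r k t := by
  intro i j
  refine ((integrable_entry (integrable_double hR hk t) i j).integrableOn
    (s := Ioi 0 ×ˢ Ioi 0)).congr ?_
  filter_upwards [ae_restrict_mem (measurableSet_Ioi.prod measurableSet_Ioi)] with p hp
  exact entry_double _ (le_of_lt hp.1) (le_of_lt hp.2) i j

lemma matOp_doubleTerm {k : ℝ → Matrix (Fin d) (Fin d) ℝ}
    (hk : IsL1AddLinf fun u => matOp (k u)) (t : ℝ) :
    matOp (doubleTerm r k t) =
      ∫ σ, ∫ τ, extOp r σ * matOp (k (t + τ - σ)) * trOp (extOp r τ) := by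
  have hi := integrable_double hR hk t
  refine op_ext fun i j => ?_
  rw [entry_matOp, entry_integral hi.integral_prod_left]
  have hz : ∀ σ, σ ∉ Ici (0 : ℝ) →
      entry i j (∫ τ, extOp r σ * matOp (k (t + τ - σ)) * trOp (extOp r τ)) = 0 := fun σ hσ => by
    simp [extOp_of_neg r (t := σ) (by simpa using hσ)]
  rw [← setIntegral_eq_integral_of_forall_compl_eq_zero hz, integral_Ici_eq_integral_Ioi]
  refine setIntegral_congr_ae measurableSet_Ioi ?_
  filter_upwards [hi.prod_right_ae] with σ hσ h0
  have hz' : ∀ τ, τ ∉ Ici (0 : ℝ) →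
      entry i j (extOp r σ * matOp (k (t + τ - σ)) * trOp (extOp r τ)) = 0 := fun τ hτ => by
    rw [extOp_of_neg r (t := τ) (by simpa using hτ), map_zero, mul_zero, map_zero]
  rw [entry_integral hσ, ← setIntegral_eq_integral_of_forall_compl_eq_zero hz',
    integral_Ici_eq_integral_Ioi]
  refine setIntegral_congr_fun measurableSet_Ioi fun τ hτ => ?_
  exact (entry_double _ (le_of_lt h0) (le_of_lt hτ) i j).symm

lemma singleTerm_sub (M N : Matrix (Fin d) (Fin d) ℝ) {t : ℝ} (ht : 0 ≤ t) :
    singleTerm r (M - N) t = singleTerm r M t - singleTerm r N t := by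
  refine matOp_injective ?_
  rw [matOp_sub, matOp_singleTerm hR _ ht, matOp_singleTerm hR _ ht, matOp_singleTerm hR _ ht,
    ← integral_sub (integrable_single hR M t) (integrable_single hR N t)]
  simp only [matOp_sub, mul_sub, sub_mul]

lemma doubleTerm_sub {k l : ℝ → Matrix (Fin d) (Fin d) ℝ} (hk : IsL1AddLinf fun u => matOp (k u))
    (hl : IsL1AddLinf fun u => matOp (l u)) (hkl : IsL1AddLinf fun u => matOp (k u - l u)) (t : ℝ) :
    doubleTerm r (fun u => k u - l u) t = doubleTerm r k t - doubleTerm r l t := by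
  refine matOp_injective ?_
  rw [matOp_sub, matOp_doubleTerm hR hk, matOp_doubleTerm hR hl, matOp_doubleTerm hR hkl,
    ← integral_integral_sub (integrable_double hR hk t) (integrable_double hR hl t)]
  simp only [matOp_sub, mul_sub, sub_mul]

omit hR in
lemma gammaSigma_ae_eq (hΓ : IsExtendedKernel γ Γ) (S : Matrix (Fin d) (Fin d) ℝ) :
    (fun u => matOp (gammaSigma γ S u)) =ᵐ[volume]
      fun u => matOp (Γ u) * matOp S + matOp S * trOp (matOp (Γ (-u))) := by
  filter_upwards [hΓ.ae_eq, (Measure.measurePreserving_neg (volume : Measure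
    ℝ)).quasiMeasurePreserving.ae hΓ.ae_eq, Measure.ae_ne volume (0 : ℝ)] with u h1 h2 h3
  rcases lt_or_gt_of_ne h3 with hu | hu
  · rw [gammaSigma, if_neg (not_lt.2 hu.le), if_pos hu, h2 (by simpa using hu),
      hΓ.zero u hu.le]
    simp
  · rw [gammaSigma, if_pos hu, h1 hu, hΓ.zero (-u) (by linarith)]
    simp

omit hR in
lemma integrable_gammaSigma (hΓ : IsExtendedKernel γ Γ) (S : Matrix (Fin d) (Fin d) ℝ) :
    Integrable fun u => matOp (gammaSigma γ S u) := by
  have iΓ : Integrable fun u => matOp (Γ u) := integrable_matOp hΓ.integrable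
  exact (integrable_symmetrized iΓ trOp (matOp S)).congr (gammaSigma_ae_eq hΓ S).symm

/-- The term `r(t) Σ` as a sum of integrals over the resolvent. -/
lemma mul_eq_singleTerm_add_doubleTerm (hr : IsDifferentialResolvent D γ r)
    (hΓ : IsExtendedKernel γ Γ) (hr1 : IsL1Pos r) (S : Matrix (Fin d) (Fin d) ℝ) {t : ℝ}
    (ht : 0 ≤ t) :
    r t * S = singleTerm r (D * S + S * Dᵀ) t + doubleTerm r (gammaSigma γ S) t := by
  refine matOp_injective ?_
  rw [matOp_add, matOp_singleTerm hR _ ht,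
    matOp_doubleTerm hR (.of_integrable (integrable_gammaSigma hΓ S))]
  have hq : ∀ τ, 0 < τ → HasDerivAt (extOp r) (matOp (resolventDeriv D γ r τ)) τ := fun τ hτ =>
    (hr.hasDerivAt hτ).congr_of_eventuallyEq <| by
      filter_upwards [lt_mem_nhds hτ] with s hs using extOp_of_nonneg r (le_of_lt hs)
  have := hR.mul_eq_integrals (T := trOp) trOp_mul trOp_one (gammaSigma_ae_eq hΓ S) hq
    (ae_resolventDeriv_eq hΓ hr1) ht
  rw [extOp_of_nonneg r ht] at this
  rw [matOp_mul, this]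
  simp only [matOp_add, matOp_mul, trOp_matOp]

lemma single_add_double_eq (hr : IsDifferentialResolvent D γ r)
    (hΓ : IsExtendedKernel γ Γ) (hr1 : IsL1Pos r) (M S : Matrix (Fin d) (Fin d) ℝ)
    {k : ℝ → Matrix (Fin d) (Fin d) ℝ} (hk : IsL1AddLinf fun u => matOp (k u))
    (hkS : IsL1AddLinf fun u => matOp (k u - gammaSigma γ S u)) {t : ℝ} (ht : 0 ≤ t) :
    singleTerm r M t + doubleTerm r k t =
      r t * S + singleTerm r (M - D * S - S * Dᵀ) t +
        doubleTerm r (fun u => k u - gammaSigma γ S u) t := by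
  rw [sub_sub, singleTerm_sub hR _ _ ht,
    doubleTerm_sub hR hk (.of_integrable (integrable_gammaSigma hΓ S)) hkS,
    mul_eq_singleTerm_add_doubleTerm hR hr hΓ hr1 S ht]
  abel

end MatrixIntegrals

/-! ### The kernel of the colored noise -/

section Chi

variable {d : ℕ} {φ : ℝ → Matrix (Fin d) (Fin d) ℝ}

lemma IsL1AddLinf.neg {A : Type*} [NormedRing A] {y : ℝ → A} (hy : IsL1AddLinf y) :
    IsL1AddLinf fun t => -y t := by
  obtain ⟨y₁, y₂, h1, h2, ⟨C, hC⟩, rfl⟩ := hy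
  refine ⟨fun t => -y₁ t, fun t => -y₂ t, h1.neg, h2.neg, ⟨C, fun s => by simpa using hC s⟩, ?_⟩
  ext1 s
  exact neg_add _ _

lemma memLp_comp_sub_left {ψ : ℝ → ℝ} (hψ : MemLp ψ 2 volume) (t : ℝ) :
    MemLp (fun s => ψ (t - s)) 2 volume :=
  hψ.comp_measurePreserving (Measure.measurePreserving_sub_left volume t)

lemma memLp_comp_neg (hφ : IsL2 φ) (i j : Fin d) : MemLp (fun s => φ (-s) i j) 2 volume := by
  simpa using memLp_comp_sub_left (hφ i j) 0

lemma integrable_mul_reversal (hφ : IsL2 φ) (t : ℝ) (i k j : Fin d) :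
    Integrable fun s => φ (t - s) i k * φ (-s) j k :=
  (memLp_comp_sub_left (hφ i k) t).integrable_mul (memLp_comp_neg hφ j k)

lemma convReversal_apply (hφ : IsL2 φ) (t : ℝ) (i j : Fin d) :
    convReversal φ t i j = ∑ k, ∫ s, φ (t - s) i k * φ (-s) j k := by
  simp only [convReversal, Matrix.of_apply, Matrix.mul_apply, Matrix.transpose_apply]
  exact integral_finsetSum _ fun k _ => integrable_mul_reversal hφ t i k j

lemma isL1AddLinf_convReversal (hφ : IsL2 φ) : IsL1AddLinf fun u => matOp (convReversal φ u) := by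
  have hbd : ∀ i j, ∃ C, ∀ u, |convReversal φ u i j| ≤ C := by
    intro i j
    refine ⟨∑ k, ((∫ s, φ s i k ^ 2) + ∫ s, φ (-s) j k ^ 2), fun u => ?_⟩
    rw [convReversal_apply hφ]
    refine (Finset.abs_sum_le_sum_abs _ _).trans (Finset.sum_le_sum fun k _ => ?_)
    have i1 := (memLp_comp_sub_left (hφ i k) u).integrable_sq
    have i2 := (memLp_comp_neg hφ j k).integrable_sq
    rw [← integral_sub_left_eq_self (fun s => φ s i k ^ 2) volume u, ← integral_add i1 i2]
    refine abs_integral_le_integral_abs.trans (integral_mono_ae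
      (integrable_mul_reversal hφ u i k j).abs (i1.add i2) (ae_of_all _ fun s => ?_))
    rw [abs_le]
    constructor <;> nlinarith [sq_nonneg (φ (u - s) i k + φ (-s) j k),
      sq_nonneg (φ (u - s) i k - φ (-s) j k), sq_nonneg (φ (u - s) i k), sq_nonneg (φ (-s) j k)]
  have hm : ∀ i j, AEStronglyMeasurable (fun u => convReversal φ u i j) volume := by
    intro i j
    simp only [convReversal_apply hφ]
    refine Finset.aestronglyMeasurable_fun_sum _ fun k _ => ?_
    have h1 : AEStronglyMeasurable (fun p : ℝ × ℝ => φ (p.1 - p.2) i k)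
        ((volume : Measure ℝ).prod volume) :=
      (hφ i k).1.comp_quasiMeasurePreserving (quasiMeasurePreserving_sub_of_right_invariant _ _)
    exact (h1.mul (memLp_comp_neg hφ j k).1.comp_snd).integral_prod_right'
  exact .of_bounded (aestronglyMeasurable_matOp hm) (exists_norm_matOp_le hbd)

lemma isL1AddLinf_chi (hφ : IsL2 φ) (G : Matrix (Fin d) (Fin d) ℝ) (κ : ℝ) :
    IsL1AddLinf fun u => matOp (chi φ G κ u) := by
  have h3 : MemLp (fun u => matOp (κ • (φ u * Gᵀ + G * (φ (-u))ᵀ))) 2 volume := by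
    refine memLp_matOp fun i j => ?_
    simp only [Matrix.smul_apply, Matrix.add_apply, Matrix.mul_apply, Matrix.transpose_apply,
      smul_eq_mul]
    exact (((memLp_finsetSum _ fun k _ => (hφ i k).mul_const _).add
      (memLp_finsetSum _ fun k _ => (memLp_comp_neg hφ j k).const_mul _)).const_mul κ)
  have h4 := (IsL1AddLinf.of_memLp_two h3).add (isL1AddLinf_convReversal hφ)
  simpa only [chi, ← matOp_add] using h4

lemma isL1AddLinf_chi_sub {γ Γ : ℝ → Matrix (Fin d) (Fin d) ℝ} (hΓ : IsExtendedKernel γ Γ)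
    (hφ : IsL2 φ) (G S : Matrix (Fin d) (Fin d) ℝ) (κ : ℝ) :
    IsL1AddLinf fun u => matOp (chi φ G κ u - gammaSigma γ S u) := by
  have := (isL1AddLinf_chi hφ G κ).add (IsL1AddLinf.of_integrable (integrable_gammaSigma hΓ S)).neg
  simpa only [matOp_sub, sub_eq_add_neg (matOp (chi _ _ _ _))] using this

end Chi

/-! ### Measurable processes with bounded second moments -/

section L2Bounded

variable {Ω : Type*} [MeasurableSpace Ω] {P : Measure Ω}

/-- A jointly measurable real process whose second moments exist and are bounded. -/
structure IsL2Bounded (X : ℝ → Ω → ℝ) (P : Measure Ω) : Prop where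
  measurable : Measurable (Function.uncurry X)
  memLp : ∀ t, MemLp (X t) 2 P
  bound : ∃ C, ∀ t, ∫ ω, X t ω ^ 2 ∂P ≤ C

lemma integrable_mul_process [SFinite P] {Y : ℝ → Ω → ℝ} {a : ℝ → ℝ} (ha : Integrable a)
    (hY : AEStronglyMeasurable (Function.uncurry Y) ((volume : Measure ℝ).prod P))
    (hi : ∀ t, Integrable (Y t) P) {C : ℝ} (hC : ∀ t, ∫ ω, |Y t ω| ∂P ≤ C) :
    Integrable (fun p : ℝ × Ω => a p.1 * Y p.1 p.2) ((volume : Measure ℝ).prod P) := by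
  have hm : AEStronglyMeasurable (fun p : ℝ × Ω => a p.1 * Y p.1 p.2)
      ((volume : Measure ℝ).prod P) := ha.1.comp_fst.mul hY
  rw [integrable_prod_iff hm]
  refine ⟨ae_of_all _ fun t => (hi t).const_mul (a t), ?_⟩
  refine (ha.norm.mul_const C).mono' hm.norm.integral_prod_right' (ae_of_all _ fun t => ?_)
  rw [Real.norm_of_nonneg (integral_nonneg fun ω => norm_nonneg _)]
  simp only [norm_mul, Real.norm_eq_abs]
  rw [integral_const_mul]
  exact mul_le_mul_of_nonneg_left (hC t) (abs_nonneg _)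

/-- The Cauchy–Schwarz inequality with respect to the weight `|a|`. -/
lemma sq_integral_mul_le {X : Type*} [MeasurableSpace X] {μ : Measure X} {a f : X → ℝ}
    (ha : Integrable a μ) (haf : Integrable (fun s => a s * f s) μ)
    (haf2 : Integrable (fun s => |a s| * f s ^ 2) μ) :
    (∫ s, a s * f s ∂μ) ^ 2 ≤ (∫ s, |a s| ∂μ) * ∫ s, |a s| * f s ^ 2 ∂μ := by
  set m := ∫ s, |a s| * |f s| ∂μ with hm
  set n := ∫ s, |a s| ∂μ with hn
  have hn0 : 0 ≤ n := integral_nonneg fun s => abs_nonneg _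
  have iaf : Integrable (fun s => |a s| * |f s|) μ := by simpa only [abs_mul] using haf.abs
  have h1 : |∫ s, a s * f s ∂μ| ≤ m := by
    refine abs_integral_le_integral_abs.trans_eq ?_
    simp only [abs_mul, hm]
  -- expand the square of `|f| - c` for any constant `c`
  have h2 : ∀ c : ℝ, 0 ≤ (∫ s, |a s| * f s ^ 2 ∂μ) - 2 * c * m + c ^ 2 * n := by
    intro c
    have : ∫ s, |a s| * (|f s| - c) ^ 2 ∂μ =
        (∫ s, |a s| * f s ^ 2 ∂μ) - 2 * c * m + c ^ 2 * n := by
      have i1 : Integrable (fun s => 2 * c * (|a s| * |f s|)) μ := iaf.const_mul _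
      have i2 : Integrable (fun s => c ^ 2 * |a s|) μ := ha.abs.const_mul _
      have i3 : Integrable (fun s => |a s| * f s ^ 2 - 2 * c * (|a s| * |f s|)) μ := haf2.sub i1
      rw [hm, hn, ← integral_const_mul, ← integral_const_mul, ← integral_sub haf2 i1,
        ← integral_add i3 i2]
      refine integral_congr_ae (ae_of_all _ fun s => ?_)
      simp only
      rw [sub_sq, sq_abs]
      ring
    rw [← this]
    exact integral_nonneg fun s => mul_nonneg (abs_nonneg _) (sq_nonneg _)
  have h3 : m ^ 2 ≤ n * ∫ s, |a s| * f s ^ 2 ∂μ := by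
    rcases hn0.eq_or_lt with h0 | h0
    · have ha0 : (fun s => |a s|) =ᵐ[μ] 0 :=
        (integral_eq_zero_iff_of_nonneg (fun s => abs_nonneg _) ha.abs).1 h0.symm
      have hm0 : m = 0 := integral_eq_zero_of_ae <| by
        filter_upwards [ha0] with s hs
        have hs' : |a s| = 0 := hs
        simp [hs']
      rw [hm0, ← h0]
      simp
    · have := h2 (m / n)
      have e : (∫ s, |a s| * f s ^ 2 ∂μ) - 2 * (m / n) * m + (m / n) ^ 2 * n =
          ((n * ∫ s, |a s| * f s ^ 2 ∂μ) - m ^ 2) / n := by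
        field_simp
        ring
      rw [e] at this
      have h4 := (div_nonneg_iff.1 this).resolve_right (fun hh => absurd hh.2 (not_le.2 h0))
      linarith [h4.1]
  calc (∫ s, a s * f s ∂μ) ^ 2 = |∫ s, a s * f s ∂μ| ^ 2 := (sq_abs _).symm
    _ ≤ m ^ 2 := by gcongr
    _ ≤ _ := h3

namespace IsL2Bounded

lemma add {X Y : ℝ → Ω → ℝ} (hX : IsL2Bounded X P) (hY : IsL2Bounded Y P) :
    IsL2Bounded (fun t ω => X t ω + Y t ω) P := by
  obtain ⟨C, hC⟩ := hX.bound
  obtain ⟨C', hC'⟩ := hY.bound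
  refine ⟨hX.measurable.add hY.measurable, fun t => (hX.memLp t).add (hY.memLp t),
    2 * C + 2 * C', fun t => ?_⟩
  have i1 := (hX.memLp t).integrable_sq
  have i2 := (hY.memLp t).integrable_sq
  calc ∫ ω, (X t ω + Y t ω) ^ 2 ∂P ≤ ∫ ω, (2 * X t ω ^ 2 + 2 * Y t ω ^ 2) ∂P := by
        refine integral_mono ((hX.memLp t).add (hY.memLp t)).integrable_sq
          ((i1.const_mul 2).add (i2.const_mul 2)) fun ω => ?_
        nlinarith [sq_nonneg (X t ω - Y t ω)]
    _ = 2 * (∫ ω, X t ω ^ 2 ∂P) + 2 * ∫ ω, Y t ω ^ 2 ∂P := by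
        rw [integral_add (i1.const_mul 2) (i2.const_mul 2), integral_const_mul, integral_const_mul]
    _ ≤ 2 * C + 2 * C' := by linarith [hC t, hC' t]

lemma const_mul {X : ℝ → Ω → ℝ} (hX : IsL2Bounded X P) (c : ℝ) :
    IsL2Bounded (fun t ω => c * X t ω) P := by
  obtain ⟨C, hC⟩ := hX.bound
  refine ⟨hX.measurable.const_mul c, fun t => (hX.memLp t).const_mul c, c ^ 2 * C, fun t => ?_⟩
  simp only [mul_pow]
  rw [integral_const_mul]
  exact mul_le_mul_of_nonneg_left (hC t) (sq_nonneg c)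

lemma sum {ι : Type*} {s : Finset ι} {X : ι → ℝ → Ω → ℝ} (hX : ∀ i ∈ s, IsL2Bounded (X i) P) :
    IsL2Bounded (fun t ω => ∑ i ∈ s, X i t ω) P := by
  classical
  induction s using Finset.induction_on with
  | empty =>
    refine ⟨?_, fun t => ?_, 0, fun t => by simp⟩
    · simp [Function.uncurry_def]
    · simp
  | insert i s his ih =>
    simp only [Finset.sum_insert his]
    exact (hX i (Finset.mem_insert_self _ _)).add
      (ih fun j hj => hX j (Finset.mem_insert_of_mem hj))

variable [IsProbabilityMeasure P] {X : ℝ → Ω → ℝ} (hX : IsL2Bounded X P)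
include hX

lemma integrable_kernel_mul {a : ℝ → ℝ} (ha : Integrable a) {η : Ω → ℝ} (hη : MemLp η 2 P) :
    Integrable (fun p : ℝ × Ω => a p.1 * (X p.1 p.2 * η p.2)) ((volume : Measure ℝ).prod P) := by
  obtain ⟨C, hC⟩ := hX.bound
  refine integrable_mul_process (Y := fun t ω => X t ω * η ω) (C := C + ∫ ω, η ω ^ 2 ∂P) ha
    (hX.measurable.aestronglyMeasurable.mul hη.1.comp_snd)
    (fun t => (hX.memLp t).integrable_mul hη) fun t => ?_
  have i1 := (hX.memLp t).integrable_sq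
  have i2 := hη.integrable_sq
  calc ∫ ω, |X t ω * η ω| ∂P ≤ ∫ ω, (X t ω ^ 2 + η ω ^ 2) ∂P := by
        refine integral_mono ((hX.memLp t).integrable_mul hη).abs (i1.add i2) fun ω => ?_
        rw [abs_le]
        constructor <;> nlinarith [sq_nonneg (X t ω + η ω), sq_nonneg (X t ω - η ω)]
    _ ≤ C + ∫ ω, η ω ^ 2 ∂P := by
        rw [integral_add i1 i2]
        linarith [hC t]

lemma integrable_kernel {a : ℝ → ℝ} (ha : Integrable a) :
    Integrable (fun p : ℝ × Ω => a p.1 * X p.1 p.2) ((volume : Measure ℝ).prod P) := by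
  simpa using hX.integrable_kernel_mul ha (memLp_const (1 : ℝ))

lemma integrable_kernel_sq {a : ℝ → ℝ} (ha : Integrable a) :
    Integrable (fun p : ℝ × Ω => a p.1 * X p.1 p.2 ^ 2) ((volume : Measure ℝ).prod P) := by
  obtain ⟨C, hC⟩ := hX.bound
  refine integrable_mul_process (Y := fun t ω => X t ω ^ 2) (C := C) ha
    (hX.measurable.pow_const 2).aestronglyMeasurable (fun t => (hX.memLp t).integrable_sq)
    fun t => ?_
  simpa using hC t

lemma ae_integrable {a : ℝ → ℝ} (ha : Integrable a) :
    ∀ᵐ ω ∂P, Integrable fun s => a s * X s ω :=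
  (hX.integrable_kernel ha).prod_left_ae

lemma integral_mul_eq {a : ℝ → ℝ} (ha : Integrable a) {η : Ω → ℝ} (hη : MemLp η 2 P) :
    ∫ ω, (∫ s, a s * X s ω) * η ω ∂P = ∫ s, a s * ∫ ω, X s ω * η ω ∂P := by
  simp only [← integral_const_mul, ← integral_mul_const, mul_assoc]
  exact (integral_integral_swap (hX.integrable_kernel_mul ha hη)).symm

lemma integral_sq_le_and_memLp {a : ℝ → ℝ} (ha : Integrable a) {C : ℝ}
    (hC : ∀ t, ∫ ω, X t ω ^ 2 ∂P ≤ C) :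
    MemLp (fun ω => ∫ s, a s * X s ω) 2 P ∧
      ∫ ω, (∫ s, a s * X s ω) ^ 2 ∂P ≤ (∫ s, |a s|) ^ 2 * C := by
  have i1 := hX.integrable_kernel_sq ha.abs
  have hle : ∀ᵐ ω ∂P, (∫ s, a s * X s ω) ^ 2 ≤ (∫ s : ℝ, |a s|) * ∫ s : ℝ, |a s| * X s ω ^ 2 := by
    filter_upwards [hX.ae_integrable ha, i1.prod_left_ae] with ω h1 h2
    exact sq_integral_mul_le ha h1 h2
  have hm : AEStronglyMeasurable (fun ω => ∫ s, a s * X s ω) P :=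
    ((hX.integrable_kernel ha).integral_prod_right).1
  have i2 : Integrable (fun ω => (∫ s : ℝ, |a s|) * ∫ s : ℝ, |a s| * X s ω ^ 2) P :=
    i1.integral_prod_right.const_mul _
  have i3 : Integrable (fun ω => (∫ s, a s * X s ω) ^ 2) P :=
    i2.mono' (hm.pow 2) (by
      filter_upwards [hle] with ω hω
      rwa [Real.norm_of_nonneg (sq_nonneg _)])
  refine ⟨(memLp_two_iff_integrable_sq hm).2 i3, ?_⟩
  calc ∫ ω, (∫ s, a s * X s ω) ^ 2 ∂P ≤ ∫ ω, ((∫ s : ℝ, |a s|) * ∫ s : ℝ, |a s| * X s ω ^ 2) ∂P :=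
        integral_mono_ae i3 i2 hle
    _ = (∫ s : ℝ, |a s|) * ∫ s : ℝ, |a s| * ∫ ω, X s ω ^ 2 ∂P := by
        rw [integral_const_mul, ← integral_integral_swap (f := fun s ω => |a s| * X s ω ^ 2) i1]
        simp only [integral_const_mul]
    _ ≤ (∫ s, |a s|) * ((∫ s, |a s|) * C) := by
        refine mul_le_mul_of_nonneg_left ?_ (integral_nonneg fun s => abs_nonneg _)
        rw [← integral_mul_const]
        refine integral_mono ?_ (ha.abs.mul_const C) fun s =>
          mul_le_mul_of_nonneg_left (hC s) (abs_nonneg _)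
        simpa only [integral_const_mul] using i1.integral_prod_left
    _ = _ := by ring

/-- The class of measurable processes with bounded second moments is stable under convolution
with a deterministic integrable kernel. -/
lemma conv {a : ℝ → ℝ} (ham : Measurable a) (ha : Integrable a) :
    IsL2Bounded (fun t ω => ∫ s, a (t - s) * X s ω) P := by
  obtain ⟨C, hC⟩ := hX.bound
  have h := fun t => hX.integral_sq_le_and_memLp (ha.comp_sub_left t) hC
  refine ⟨?_, fun t => (h t).1, (∫ s, |a s|) ^ 2 * C, fun t => ?_⟩
  · have : Measurable fun p : (ℝ × Ω) × ℝ => a (p.1.1 - p.2) * X p.2 p.1.2 :=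
      (ham.comp (by fun_prop)).mul (hX.measurable.comp
        (by fun_prop : Measurable fun p : (ℝ × Ω) × ℝ => (p.2, p.1.2)))
    exact this.stronglyMeasurable.integral_prod_right'.measurable
  · refine (h t).2.trans_eq ?_
    rw [integral_sub_left_eq_self (fun s => |a s|) volume t]

lemma ae_intervalIntegrable :
    ∀ᵐ ω ∂P, ∀ t₁ t₂, IntervalIntegrable (fun t => X t ω) volume t₁ t₂ := by
  have : ∀ᵐ ω ∂P, ∀ n : ℕ, Integrable
      fun s => indicator (Icc (-(n : ℝ)) n) (fun _ => (1 : ℝ)) s * X s ω := by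
    rw [ae_all_iff]
    exact fun n => hX.ae_integrable ((integrable_indicator_iff measurableSet_Icc).2
      (integrableOn_const measure_Icc_lt_top.ne))
  filter_upwards [this] with ω hω t₁ t₂
  obtain ⟨n, hn⟩ := exists_nat_ge (max |t₁| |t₂|)
  have h1 : IntegrableOn (fun s => X s ω) (Icc (-(n : ℝ)) n) := by
    rw [← integrable_indicator_iff measurableSet_Icc]
    refine (hω n).congr (ae_of_all _ fun s => ?_)
    by_cases hs : s ∈ Icc (-(n : ℝ)) n <;> simp [hs]
  have a1 := abs_le.1 ((le_max_left |t₁| |t₂|).trans hn)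
  have a2 := abs_le.1 ((le_max_right |t₁| |t₂|).trans hn)
  refine ((h1.mono_set ?_).intervalIntegrable)
  exact uIcc_subset_Icc ⟨a1.1, a1.2⟩ ⟨a2.1, a2.2⟩

lemma integral_intervalIntegral_mul {t₁ t₂ : ℝ} (h12 : t₁ ≤ t₂) {η : Ω → ℝ} (hη : MemLp η 2 P) :
    ∫ ω, (∫ t in t₁..t₂, X t ω) * η ω ∂P = ∫ t in Ioc t₁ t₂, ∫ ω, X t ω * η ω ∂P := by
  have ha : Integrable (indicator (Ioc t₁ t₂) fun _ => (1 : ℝ)) :=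
    (integrable_indicator_iff measurableSet_Ioc).2 (integrableOn_const measure_Ioc_lt_top.ne)
  have h := hX.integral_mul_eq ha hη
  have e : ∀ f : ℝ → ℝ, ∫ s, indicator (Ioc t₁ t₂) (fun _ => (1 : ℝ)) s * f s =
      ∫ s in Ioc t₁ t₂, f s := by
    intro f
    rw [← integral_indicator measurableSet_Ioc]
    refine integral_congr_ae (ae_of_all _ fun s => ?_)
    by_cases hs : s ∈ Ioc t₁ t₂ <;> simp [hs]
  simpa only [e, intervalIntegral.integral_of_le h12] using h

lemma memLp_intervalIntegral {t₁ t₂ : ℝ} (h12 : t₁ ≤ t₂) :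
    MemLp (fun ω => ∫ t in t₁..t₂, X t ω) 2 P := by
  have ha : Integrable (indicator (Ioc t₁ t₂) fun _ => (1 : ℝ)) :=
    (integrable_indicator_iff measurableSet_Ioc).2 (integrableOn_const measure_Ioc_lt_top.ne)
  obtain ⟨C, hC⟩ := hX.bound
  have h := (hX.integral_sq_le_and_memLp ha hC).1
  have e : ∀ f : ℝ → ℝ, ∫ s, indicator (Ioc t₁ t₂) (fun _ => (1 : ℝ)) s * f s =
      ∫ s in Ioc t₁ t₂, f s := by
    intro f
    rw [← integral_indicator measurableSet_Ioc]
    refine integral_congr_ae (ae_of_all _ fun s => ?_)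
    by_cases hs : s ∈ Ioc t₁ t₂ <;> simp [hs]
  simpa only [e, intervalIntegral.integral_of_le h12] using h

end IsL2Bounded
end L2Bounded

/-! ### Measurable versions of mean square continuous processes -/

section Modification

variable {Ω : Type*} [MeasurableSpace Ω] {P : Measure Ω}

/-- If the `L²` distances to the limit are summable, convergence holds almost surely. -/
lemma ae_tendsto_of_tsum_eLpNorm_sub [IsProbabilityMeasure P] {f : ℕ → Ω → ℝ} {g : Ω → ℝ}
    (hf : ∀ n, AEStronglyMeasurable (f n) P) (hg : AEStronglyMeasurable g P)
    (h : ∑' n, eLpNorm (fun ω => f n ω - g ω) 2 P ≠ ∞) :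
    ∀ᵐ ω ∂P, Tendsto (fun n => f n ω) atTop (𝓝 (g ω)) := by
  have hm : ∀ n, AEStronglyMeasurable (fun ω => f n ω - g ω) P := fun n => (hf n).sub hg
  have h1 : ∫⁻ ω, ∑' n, ‖f n ω - g ω‖ₑ ∂P ≠ ∞ := by
    rw [lintegral_tsum fun n => (hm n).enorm]
    refine ne_top_of_le_ne_top h (ENNReal.tsum_le_tsum fun n => ?_)
    rw [← eLpNorm_one_eq_lintegral_enorm]
    exact eLpNorm_le_eLpNorm_of_exponent_le (by norm_num) (hm n)
  filter_upwards [ae_lt_top' (AEMeasurable.tsum fun n => (hm n).enorm) h1] with ω hω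
  have : Tendsto (fun n => ‖f n ω - g ω‖ₑ) atTop (𝓝 0) :=
    ENNReal.tendsto_atTop_zero_of_tsum_ne_top hω.ne
  rw [tendsto_iff_edist_tendsto_0]
  simpa only [edist_eq_enorm_sub] using this

/-- A mean square continuous process has a jointly measurable version. -/
lemma exists_measurable_modification [IsProbabilityMeasure P] {z : ℝ → Lp ℝ 2 P}
    (hz : Continuous z) :
    ∃ Z : ℝ → Ω → ℝ, Measurable (Function.uncurry Z) ∧ ∀ t, Z t =ᵐ[P] z t := by
  classical
  let q : ℕ → ℝ := TopologicalSpace.denseSeq ℝ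
  -- the first point of the dense sequence at which `z` is `2⁻ⁿ`-close to `z t`
  have hex : ∀ (n : ℕ) (t : ℝ), ∃ k, dist (z t) (z (q k)) < (1 / 2) ^ n := by
    intro n t
    have ho : IsOpen {s | dist (z t) (z s) < (1 / 2) ^ n} :=
      isOpen_lt (continuous_const.dist hz) continuous_const
    obtain ⟨k, hk⟩ := (TopologicalSpace.denseRange_denseSeq ℝ).exists_mem_open ho
      ⟨t, by simp⟩
    exact ⟨k, hk⟩
  let k : ℕ → ℝ → ℕ := fun n t => Nat.find (hex n t)
  have hk : ∀ n, Measurable (k n) := fun n => measurable_find (hex n) fun m =>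
    (isOpen_lt (hz.dist continuous_const) continuous_const).measurableSet
  let Zn : ℕ → ℝ → Ω → ℝ := fun n t => z (q (k n t))
  have hZn : ∀ n, Measurable (Function.uncurry (Zn n)) := by
    intro n
    have : Measurable fun p : ℕ × Ω => (z (q p.1) : Ω → ℝ) p.2 :=
      measurable_from_prod_countable_right fun m => (Lp.stronglyMeasurable (z (q m))).measurable
    exact this.comp (((hk n).comp measurable_fst).prodMk measurable_snd)
  refine ⟨fun t ω => limUnder atTop fun n => Zn n t ω, ?_, fun t => ?_⟩
  · exact (StronglyMeasurable.limUnder fun n => (hZn n).stronglyMeasurable).measurable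
  · have h : ∑' n, eLpNorm (fun ω => Zn n t ω - z t ω) 2 P ≠ ∞ := by
      have hle : ∀ n, eLpNorm (fun ω => Zn n t ω - z t ω) 2 P ≤ (1 / 2 : ℝ≥0∞) ^ n := by
        intro n
        have e : eLpNorm (fun ω => Zn n t ω - z t ω) 2 P = edist (z (q (k n t))) (z t) :=
          (Lp.edist_def _ _).symm
        rw [e, edist_comm, edist_dist]
        refine (ENNReal.ofReal_le_ofReal (Nat.find_spec (hex n t)).le).trans_eq ?_
        rw [ENNReal.ofReal_pow (by norm_num)]
        congr 1
        rw [ENNReal.ofReal_div_of_pos (by norm_num)]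
        simp
      refine ne_top_of_le_ne_top ?_ (ENNReal.tsum_le_tsum hle)
      rw [ENNReal.tsum_geometric]
      simp
    filter_upwards [ae_tendsto_of_tsum_eLpNorm_sub
      (fun n => (Lp.stronglyMeasurable _).aestronglyMeasurable)
      (Lp.stronglyMeasurable (z t)).aestronglyMeasurable h] with ω hω
    exact hω.limUnder_eq

/-- Translation is continuous in `L²(ℝ)`. -/
lemma continuous_toLp_comp_sub_left {ψ : ℝ → ℝ} (hψ : MemLp ψ 2 volume) :
    Continuous fun t : ℝ => (memLp_comp_sub_left hψ t).toLp (fun s => ψ (t - s)) := by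
  have hg : Continuous fun t : ℝ => (⟨fun s => t - s, by fun_prop⟩ : C(ℝ, ℝ)) :=
    ContinuousMap.continuous_of_continuous_uncurry _ (by
      simp only [Function.uncurry_def]
      exact continuous_fst.sub continuous_snd)
  exact (continuous_const (y := hψ.toLp ψ)).compMeasurePreservingLp hg
    (fun t => Measure.measurePreserving_sub_left volume t) (by norm_num)

end Modification

/-! ### Isometries prescribed on a total family -/

section Hilbert

variable {T E F : Type*} [NormedAddCommGroup E] [InnerProductSpace ℝ E]
  [NormedAddCommGroup F] [InnerProductSpace ℝ F] [CompleteSpace F]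

/-- Two families with the same Gram matrix, the first one being total, are related by a linear
isometry. -/
lemma exists_continuousLinearMap_of_gram {e : T → E} {f : T → F}
    (hd : (Submodule.span ℝ (range e)).topologicalClosure = ⊤)
    (hg : ∀ s t, ⟪f s, f t⟫_ℝ = ⟪e s, e t⟫_ℝ) :
    ∃ L : E →L[ℝ] F, ∀ t, L (e t) = f t := by
  let le := Finsupp.linearCombination ℝ e
  let lf := Finsupp.linearCombination ℝ f
  have hn : ∀ x, ‖lf x‖ ≤ 1 * ‖le x‖ := by
    intro x
    have h : ⟪lf x, lf x⟫_ℝ = ⟪le x, le x⟫_ℝ := by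
      simp only [le, lf, Finsupp.linearCombination_apply, Finsupp.sum, sum_inner, inner_sum,
        inner_smul_left, inner_smul_right, hg]
    rw [one_mul, ← sq_le_sq₀ (norm_nonneg _) (norm_nonneg _), ← real_inner_self_eq_norm_sq,
      ← real_inner_self_eq_norm_sq, h]
  have hdr : DenseRange le := by
    rw [DenseRange, ← LinearMap.coe_range, Finsupp.range_linearCombination]
    exact Submodule.dense_iff_topologicalClosure_eq_top.2 hd
  refine ⟨lf.extendOfNorm le, fun t => ?_⟩
  have := LinearMap.extendOfNorm_eq (f := lf) hdr ⟨1, hn⟩ (Finsupp.single t 1)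
  simpa [le, lf] using this

lemma continuousLinearMap_inner_eq {e : T → E} {f g : T → F} {c : ℝ} {L M : E →L[ℝ] F}
    (hd : (Submodule.span ℝ (range e)).topologicalClosure = ⊤)
    (hL : ∀ t, L (e t) = f t) (hM : ∀ t, M (e t) = g t)
    (hg : ∀ s t, ⟪f s, g t⟫_ℝ = c * ⟪e s, e t⟫_ℝ) (x y : E) :
    ⟪L x, M y⟫_ℝ = c * ⟪x, y⟫_ℝ := by
  have hdense : Dense (Submodule.span ℝ (range e) : Set E) :=
    Submodule.dense_iff_topologicalClosure_eq_top.2 hd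
  have h1 : ∀ s, ∀ y, ⟪L (e s), M y⟫_ℝ = c * ⟪e s, y⟫_ℝ := by
    intro s
    have : (innerSL ℝ (L (e s))).comp M = c • innerSL ℝ (e s) := by
      refine ContinuousLinearMap.ext_on hdense ?_
      rintro _ ⟨t, rfl⟩
      simp [hL, hM, hg]
    intro y
    simpa using congrArg (fun A => A y) this
  have : (innerSL ℝ (M y)).comp L = c • innerSL ℝ y := by
    refine ContinuousLinearMap.ext_on hdense ?_
    rintro _ ⟨t, rfl⟩
    simp only [ContinuousLinearMap.comp_apply, innerSL_apply_apply, smul_apply,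
      smul_eq_mul]
    rw [real_inner_comm, h1 t y, real_inner_comm]
  have := congrArg (fun A => A x) this
  simp only [ContinuousLinearMap.comp_apply, innerSL_apply_apply, smul_apply,
      smul_eq_mul] at this
  rw [real_inner_comm, this, real_inner_comm]

end Hilbert

/-! ### Step functions in `L²(ℝ)` -/

section Steps

/-- The indicator function of `(a, b]` as an element of `L²(ℝ)`. -/
noncomputable def indIoc (a b : ℝ) : Lp ℝ 2 (volume : Measure ℝ) :=
  indicatorConstLp 2 (measurableSet_Ioc (a := a) (b := b)) measure_Ioc_lt_top.ne 1

/-- The signed indicator function of the interval between `0` and `t`, i.e. the function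
representing the increment from `0` to `t`. -/
noncomputable def signedInd (t : ℝ) : Lp ℝ 2 (volume : Measure ℝ) := indIoc 0 t - indIoc t 0

lemma indIoc_coe (a b : ℝ) : indIoc a b =ᵐ[volume] (Ioc a b).indicator fun _ => (1 : ℝ) :=
  indicatorConstLp_coeFn

lemma signedInd_zero : signedInd 0 = 0 := sub_self _

lemma signedInd_sub {s t : ℝ} (h : s ≤ t) : signedInd t - signedInd s = indIoc s t := by
  apply Lp.ext
  have h1 := Lp.coeFn_sub (signedInd t) (signedInd s)
  have h2 := Lp.coeFn_sub (indIoc 0 t) (indIoc t 0)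
  have h3 := Lp.coeFn_sub (indIoc 0 s) (indIoc s 0)
  filter_upwards [h1, h2, h3, indIoc_coe 0 t, indIoc_coe t 0, indIoc_coe 0 s, indIoc_coe s 0,
    indIoc_coe s t] with x h1 h2 h3 a1 a2 a3 a4 a5
  simp only [signedInd, Pi.sub_apply] at h1 h2 h3 ⊢
  rw [h1, h2, h3, a1, a2, a3, a4, a5]
  rcases le_or_gt x 0 with c1 | c1 <;> rcases le_or_gt x s with c2 | c2 <;>
    rcases le_or_gt x t with c3 | c3 <;>
    first
    | exact absurd (c2.trans h) (not_le.2 c3)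
    | simp [c1, c2, c3, not_le.2, not_lt.2]

lemma inner_indIoc (a b : ℝ) (g : Lp ℝ 2 (volume : Measure ℝ)) :
    ⟪indIoc a b, g⟫_ℝ = ∫ s in Ioc a b, g s := by
  rw [indIoc, L2.inner_indicatorConstLp_one]

lemma norm_sq_signedInd_sub {s t : ℝ} (h : s ≤ t) : ‖signedInd t - signedInd s‖ ^ 2 = t - s := by
  rw [signedInd_sub h, ← real_inner_self_eq_norm_sq, inner_indIoc,
    setIntegral_congr_ae (g := fun _ => (1 : ℝ)) measurableSet_Ioc]
  · simp [h]
  · filter_upwards [indIoc_coe s t] with x hx hm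
    rw [hx, indicator_of_mem hm]

lemma span_signedInd_dense :
    (Submodule.span ℝ (range signedInd)).topologicalClosure = ⊤ := by
  rw [Submodule.topologicalClosure_eq_top_iff, Submodule.eq_bot_iff]
  intro g hg
  have h0 : ∀ a b, a ≤ b → ∫ s in Ioc a b, g s = 0 := by
    intro a b hab
    rw [← inner_indIoc, ← signedInd_sub hab]
    exact hg _ (sub_mem (Submodule.subset_span ⟨b, rfl⟩) (Submodule.subset_span ⟨a, rfl⟩))
  have hl : LocallyIntegrable (g : ℝ → ℝ) volume :=
    (Lp.memLp g).locallyIntegrable (by norm_num)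
  have := ae_eq_zero_of_forall_integral_Ioc hl h0
  exact (Lp.eq_zero_iff_ae_eq_zero).2 this

end Steps

/-! ### Gaussian Hilbert spaces -/

section GaussianSpace

variable {Ω : Type*} [MeasurableSpace Ω] {P : Measure Ω} [IsProbabilityMeasure P]

lemma integral_abs_le_norm (x : Lp ℝ 2 P) : ∫ ω, |x ω| ∂P ≤ ‖x‖ := by
  have h : eLpNorm x 1 P ≤ eLpNorm x 2 P :=
    eLpNorm_le_eLpNorm_of_exponent_le (by norm_num) (Lp.aestronglyMeasurable x)
  have h2 := ENNReal.toReal_mono (Lp.eLpNorm_ne_top x) h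
  rw [← Lp.norm_def] at h2
  refine le_trans (le_of_eq ?_) h2
  rw [eLpNorm_one_eq_lintegral_enorm,
    ← integral_norm_eq_lintegral_enorm (Lp.aestronglyMeasurable x)]
  rfl

lemma continuous_integral_cexp (u : ℝ) :
    Continuous fun x : Lp ℝ 2 P => ∫ ω, Complex.exp (u * x ω * Complex.I) ∂P := by
  have hi : ∀ x : Lp ℝ 2 P, Integrable (fun ω => Complex.exp (u * x ω * Complex.I)) P := by
    intro x
    have hm : AEStronglyMeasurable (fun ω => Complex.exp (u * x ω * Complex.I)) P := by
      have := (Lp.stronglyMeasurable x).measurable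
      exact Measurable.aestronglyMeasurable (by fun_prop)
    refine (integrable_const (1 : ℝ)).mono' hm (ae_of_all _ fun ω => le_of_eq ?_)
    rw [← Complex.ofReal_mul, Complex.norm_exp_ofReal_mul_I]
  refine (LipschitzWith.of_dist_le_mul (K := ‖u‖₊) fun x y => ?_).continuous
  have h1 : ∀ a b : ℝ, ‖Complex.exp (u * a * Complex.I) - Complex.exp (u * b * Complex.I)‖ ≤
      |u| * |a - b| := by
    intro a b
    have e : Complex.exp (u * a * Complex.I) - Complex.exp (u * b * Complex.I) =
        Complex.exp (u * b * Complex.I) *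
          (Complex.exp (Complex.I * ((u * (a - b) : ℝ) : ℂ)) - 1) := by
      rw [mul_sub, mul_one, ← Complex.exp_add]
      congr 2
      push_cast
      ring
    rw [e, norm_mul, ← Complex.ofReal_mul, Complex.norm_exp_ofReal_mul_I, one_mul, ← abs_mul]
    exact Real.norm_exp_I_mul_ofReal_sub_one_le
  have hxy : Integrable (fun ω => |(x - y : Lp ℝ 2 P) ω|) P :=
    ((Lp.memLp (x - y)).integrable (by norm_num)).abs
  rw [dist_eq_norm, dist_eq_norm, ← integral_sub (hi x) (hi y), coe_nnnorm, Real.norm_eq_abs]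
  calc ‖∫ ω, (Complex.exp (u * x ω * Complex.I) - Complex.exp (u * y ω * Complex.I)) ∂P‖
      ≤ ∫ ω, |u| * |(x - y : Lp ℝ 2 P) ω| ∂P := by
        refine norm_integral_le_of_norm_le (hxy.const_mul _) ?_
        filter_upwards [Lp.coeFn_sub x y] with ω hω
        rw [hω]
        exact h1 _ _
    _ ≤ |u| * ‖x - y‖ := by
        rw [integral_const_mul]
        exact mul_le_mul_of_nonneg_left (integral_abs_le_norm _) (abs_nonneg _)

lemma map_eq_gaussianReal_iff (x : Lp ℝ 2 P) :
    P.map x = gaussianReal 0 (‖x‖₊ ^ 2) ↔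
      ∀ u : ℝ, ∫ ω, Complex.exp (u * x ω * Complex.I) ∂P =
        Complex.exp (-(‖x‖ : ℂ) ^ 2 * u ^ 2 / 2) := by
  have hx : AEMeasurable x P := (Lp.stronglyMeasurable x).measurable.aemeasurable
  have : IsProbabilityMeasure (P.map x) := Measure.isProbabilityMeasure_map hx
  have e : ∀ u : ℝ, charFun (P.map x) u = ∫ ω, Complex.exp (u * x ω * Complex.I) ∂P := by
    intro u
    rw [charFun_apply_real, integral_map hx]
    exact Measurable.aestronglyMeasurable (by fun_prop)
  have e' : ∀ u : ℝ, charFun (gaussianReal 0 (‖x‖₊ ^ 2)) u =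
      Complex.exp (-(‖x‖ : ℂ) ^ 2 * u ^ 2 / 2) := by
    intro u
    rw [charFun_gaussianReal]
    congr 1
    push_cast
    ring
  constructor
  · intro h u
    rw [← e, h, e']
  · intro h
    refine Measure.ext_of_charFun (funext fun u => ?_)
    rw [e, e', h]

/-- A limit in `L²` of centered Gaussian random variables is a centered Gaussian variable. -/
lemma map_eq_gaussianReal_of_mem_closure {S : Submodule ℝ (Lp ℝ 2 P)}
    (hS : ∀ x ∈ S, P.map x = gaussianReal 0 (‖x‖₊ ^ 2)) {x : Lp ℝ 2 P}
    (hx : x ∈ S.topologicalClosure) : P.map x = gaussianReal 0 (‖x‖₊ ^ 2) := by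
  have hcl : IsClosed {x : Lp ℝ 2 P | ∀ u : ℝ, ∫ ω, Complex.exp (u * x ω * Complex.I) ∂P =
        Complex.exp (-(‖x‖ : ℂ) ^ 2 * u ^ 2 / 2)} := by
    simp only [ofPred_forall]
    refine isClosed_iInter fun u => isClosed_eq (continuous_integral_cexp u) ?_
    fun_prop
  rw [map_eq_gaussianReal_iff]
  exact hcl.closure_subset_iff.2 (fun y hy => (map_eq_gaussianReal_iff y).1 (hS y hy)) hx

lemma map_toLp {X : Ω → ℝ} (hX : MemLp X 2 P) : P.map (hX.toLp X) = P.map X :=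
  Measure.map_congr hX.coeFn_toLp

lemma norm_toLp_sq {X : Ω → ℝ} (hX : MemLp X 2 P) : ‖hX.toLp X‖ ^ 2 = ∫ ω, X ω ^ 2 ∂P := by
  rw [← real_inner_self_eq_norm_sq, L2.inner_def]
  refine integral_congr_ae ?_
  filter_upwards [hX.coeFn_toLp] with ω hω
  rw [hω, real_inner_self_eq_norm_sq, Real.norm_eq_abs, sq_abs]

lemma inner_toLp {α : Type*} [MeasurableSpace α] {μ : Measure α} {X Y : α → ℝ}
    (hX : MemLp X 2 μ) (hY : MemLp Y 2 μ) :
    ⟪hX.toLp X, hY.toLp Y⟫_ℝ = ∫ ω, X ω * Y ω ∂μ := by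
  rw [L2.inner_def]
  refine integral_congr_ae ?_
  filter_upwards [hX.coeFn_toLp, hY.coeFn_toLp] with ω h1 h2
  rw [h1, h2]
  simp [mul_comm]

/-- A centered Gaussian variable in `L²` has variance the square of its norm. -/
lemma map_eq_gaussianReal_of_hasGaussianLaw {x : Lp ℝ 2 P} (h : HasGaussianLaw x P)
    (h0 : ∫ ω, x ω ∂P = 0) : P.map x = gaussianReal 0 (‖x‖₊ ^ 2) := by
  rw [h.map_eq_gaussianReal, h0]
  congr 1
  rw [variance_of_integral_eq_zero h.aemeasurable h0]
  have : ∫ ω, x ω ^ 2 ∂P = ‖x‖ ^ 2 := by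
    rw [← norm_toLp_sq (Lp.memLp x), Lp.toLp_coeFn]
  simp only [this]
  rw [Real.toNNReal_pow (norm_nonneg _), norm_toNNReal]

/-- The closed span in `L²` of a centered Gaussian process consists of Gaussian variables. -/
lemma map_eq_gaussianReal_of_mem_closure_span {T : Type*} {X : T → Ω → ℝ}
    (hX : IsGaussianProcess X P) (h0 : ∀ t, ∫ ω, X t ω ∂P = 0) {f : T → Lp ℝ 2 P}
    (hf : ∀ t, f t =ᵐ[P] X t) {x : Lp ℝ 2 P}
    (hx : x ∈ (Submodule.span ℝ (range f)).topologicalClosure) :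
    P.map x = gaussianReal 0 (‖x‖₊ ^ 2) := by
  refine map_eq_gaussianReal_of_mem_closure (fun y hy => ?_) hx
  obtain ⟨c, rfl⟩ := Finsupp.mem_span_range_iff_exists_finsupp.1 hy
  have hi : ∀ t, Integrable (X t) P := fun t => (hX.hasGaussianLaw_eval t).integrable
  have e : ((c.sum fun t a => a • f t : Lp ℝ 2 P) : Ω → ℝ) =ᵐ[P]
      fun ω => ∑ t ∈ c.support, c t • X t ω := by
    rw [Finsupp.sum]
    have h1 := Lp.coeFn_finsetSum c.support fun t => c t • f t
    have h2 : ∀ᵐ ω ∂P, ∀ t ∈ c.support, (c t • f t : Lp ℝ 2 P) ω = c t • X t ω := by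
      rw [eventually_all_finset]
      intro t _
      filter_upwards [Lp.coeFn_smul (c t) (f t), hf t] with ω a1 a2
      rw [a1, Pi.smul_apply, a2]
    filter_upwards [h1, h2] with ω a1 a2
    rw [a1, Finset.sum_apply]
    exact Finset.sum_congr rfl a2
  refine map_eq_gaussianReal_of_hasGaussianLaw ?_ ?_
  · exact ((hX.smul c).hasGaussianLaw_fun_sum (I := c.support)).congr e.symm
  · rw [integral_congr_ae e]
    simp only [smul_eq_mul]
    rw [integral_finsetSum _ fun t _ => (hi t).const_mul (c t)]
    simp [integral_const_mul, h0]

end GaussianSpace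

/-! ### Brownian motion as a Gaussian process -/

section Brownian

variable {d : ℕ} {Ω : Type*} [MeasurableSpace Ω] {P : Measure Ω} [IsProbabilityMeasure P]
  {W W' : ℝ → Ω → Fin d → ℝ}

lemma integral_eval_pi_gaussianReal (v : NNReal) (j : Fin d) :
    ∫ x, x j ∂(Measure.pi fun _ : Fin d => gaussianReal 0 v) = 0 := by
  rw [integral_comp_eval (μ := fun _ : Fin d => gaussianReal 0 v) (f := fun x : ℝ => x)
    (Measurable.aestronglyMeasurable (by fun_prop))]
  exact integral_id_gaussianReal

namespace IsTwoSidedBrownian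

lemma hasGaussianLaw_sub (hW : IsTwoSidedBrownian W P) {s t : ℝ} (h : s ≤ t) :
    HasGaussianLaw (fun ω => W t ω - W s ω) P := by
  have hm : iIndepFun (fun (j : Fin d) (x : Fin d → ℝ) => x j)
      (Measure.pi fun _ : Fin d => gaussianReal 0 (t - s).toNNReal) :=
    iIndepFun_pi (X := fun _ x => x) fun _ => aemeasurable_id'
  have hg : HasGaussianLaw (fun (x : Fin d → ℝ) (j : Fin d) => x j)
      (Measure.pi fun _ : Fin d => gaussianReal 0 (t - s).toNNReal) := by
    refine hm.hasGaussianLaw fun j => ⟨?_⟩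
    rw [(measurePreserving_eval (fun _ : Fin d => gaussianReal 0 (t - s).toNNReal) j).map_eq]
    infer_instance
  refine ⟨?_⟩
  rw [hW.law_increment s t h]
  have := hg.isGaussian_map
  rwa [show (fun (x : Fin d → ℝ) (j : Fin d) => x j) = id from rfl, Measure.map_id] at this

lemma ae_eq_sub_zero (hW : IsTwoSidedBrownian W P) (t : ℝ) :
    (fun ω => W t ω - W 0 ω) =ᵐ[P] W t := by
  filter_upwards [hW.zero] with ω hω
  simp [hω]

/-- Integrals over an increment are integrals over independent centered Gaussian coordinates. -/
lemma integral_increment (hW : IsTwoSidedBrownian W P) {s t : ℝ} (h : s ≤ t)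
    {g : (Fin d → ℝ) → ℝ} (hg : Measurable g) :
    ∫ ω, g (W t ω - W s ω) ∂P =
      ∫ x, g x ∂(Measure.pi fun _ : Fin d => gaussianReal 0 (t - s).toNNReal) := by
  rw [← hW.law_increment s t h, integral_map]
  · exact ((hW.measurable t).sub (hW.measurable s)).aemeasurable
  · exact hg.aestronglyMeasurable

lemma integral_increment_apply (hW : IsTwoSidedBrownian W P) {s t : ℝ} (h : s ≤ t) (j : Fin d) :
    ∫ ω, (W t ω j - W s ω j) ∂P = 0 := by
  have := hW.integral_increment h (measurable_pi_apply j)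
  simp only [Pi.sub_apply] at this
  rw [this, integral_eval_pi_gaussianReal]

lemma integral_increment_mul (hW : IsTwoSidedBrownian W P) {s t : ℝ} (h : s ≤ t) (j k : Fin d) :
    ∫ ω, (W t ω j - W s ω j) * (W t ω k - W s ω k) ∂P =
      (if j = k then 1 else 0) * (t - s) := by
  have := hW.integral_increment h (g := fun x => x j * x k) (by fun_prop)
  simp only [Pi.sub_apply] at this
  rw [this]
  split_ifs with hjk
  · subst hjk
    rw [integral_comp_eval (μ := fun _ : Fin d => gaussianReal 0 (t - s).toNNReal)
      (f := fun x : ℝ => x * x) (Measurable.aestronglyMeasurable (by fun_prop))]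
    have hv := variance_of_integral_eq_zero (μ := gaussianReal 0 (t - s).toNNReal)
      (X := fun x => x) aemeasurable_id' integral_id_gaussianReal
    rw [variance_fun_id_gaussianReal] at hv
    simp only [← pow_two, one_mul]
    rw [← hv, Real.coe_toNNReal _ (sub_nonneg.2 h)]
  · have hm : iIndepFun (fun (j : Fin d) (x : Fin d → ℝ) => x j)
        (Measure.pi fun _ : Fin d => gaussianReal 0 (t - s).toNNReal) :=
      iIndepFun_pi (X := fun _ x => x) fun _ => aemeasurable_id'
    have := (hm.indepFun hjk).integral_mul_eq_mul_integral
      (measurable_pi_apply j).aestronglyMeasurable (measurable_pi_apply k).aestronglyMeasurable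
    simp only [Pi.mul_apply] at this
    rw [this, integral_eval_pi_gaussianReal, zero_mul, zero_mul]

lemma isGaussianProcess (hW : IsTwoSidedBrownian W P) : IsGaussianProcess W P := by
  -- on each half line `[m, ∞)` the process `W - W m` is Gaussian
  have h1 : ∀ m : ℝ, IsGaussianProcess (fun (t : Ici m) ω => W t ω - W m ω) P := by
    intro m
    refine HasIndepIncrements.isGaussianProcess (fun t => hW.hasGaussianLaw_sub t.2) ?_ ?_
    · exact ae_of_all _ fun ω => sub_self _
    · intro n t ht
      have := hW.indep_increments n (fun i => (t i : ℝ)) fun i j hij => ht hij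
      simpa only [sub_sub_sub_cancel_right] using this
  constructor
  intro I
  classical
  -- all times in `I`, as well as `0`, lie to the right of `m`
  obtain ⟨m, hm⟩ : ∃ m : ℝ, ∀ t ∈ insert 0 I, m ≤ t := (insert 0 I).bddBelow
  have h2 : IsGaussianProcess (fun (t : I) ω => W t ω) P := by
    refine IsGaussianProcess.congr (X := fun (t : I) ω => W t ω - W 0 ω) ?_
      fun t => hW.ae_eq_sub_zero t
    refine IsGaussianProcess.of_isGaussianProcess (h1 m) fun t => ?_
    let a : Ici m := ⟨t, hm _ (Finset.mem_insert_of_mem t.2)⟩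
    let b : Ici m := ⟨0, hm _ (Finset.mem_insert_self _ _)⟩
    refine ⟨{a, b}, ContinuousLinearMap.proj ⟨a, by simp⟩ - ContinuousLinearMap.proj ⟨b, by simp⟩,
      fun ω => ?_⟩
    simp [a, b, Finset.restrict]
  have h3 := h2.hasGaussianLaw Finset.univ
  exact h3.map_fun
    { toFun := fun x (t : I) => x ⟨t, Finset.mem_univ t⟩
      map_add' := fun _ _ => rfl
      map_smul' := fun _ _ => rfl }

lemma memLp (hW : IsTwoSidedBrownian W P) (t : ℝ) (j : Fin d) : MemLp (fun ω => W t ω j) 2 P :=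
  ((hW.isGaussianProcess.hasGaussianLaw_eval t).map_fun
    (ContinuousLinearMap.proj (R := ℝ) (φ := fun _ : Fin d => ℝ) j)).memLp_two

lemma memLp_sub (hW : IsTwoSidedBrownian W P) (s t : ℝ) (j : Fin d) :
    MemLp (fun ω => W t ω j - W s ω j) 2 P := (hW.memLp t j).sub (hW.memLp s j)

lemma integral_apply (hW : IsTwoSidedBrownian W P) (t : ℝ) (j : Fin d) : ∫ ω, W t ω j ∂P = 0 := by
  have hz : ∫ ω, W 0 ω j ∂P = 0 := integral_eq_zero_of_ae <| by
    filter_upwards [hW.zero] with ω hω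
    simp [hω]
  have hi : ∀ t, Integrable (fun ω => W t ω j) P := fun t => (hW.memLp t j).integrable (by norm_num)
  rcases le_total 0 t with h | h
  · have := hW.integral_increment_apply h j
    rw [integral_sub (hi _) (hi _), hz] at this
    linarith
  · have := hW.integral_increment_apply h j
    rw [integral_sub (hi _) (hi _), hz] at this
    linarith

/-- The coordinates of the Brownian motion in `L²(P)`. -/
noncomputable def toL2 (hW : IsTwoSidedBrownian W P) (j : Fin d) (t : ℝ) : Lp ℝ 2 P :=
  (hW.memLp t j).toLp

lemma toL2_coe (hW : IsTwoSidedBrownian W P) (j : Fin d) (t : ℝ) :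
    hW.toL2 j t =ᵐ[P] fun ω => W t ω j := (hW.memLp t j).coeFn_toLp

lemma toL2_zero (hW : IsTwoSidedBrownian W P) (j : Fin d) : hW.toL2 j 0 = 0 := by
  apply Lp.ext
  filter_upwards [hW.toL2_coe j 0, hW.zero, Lp.coeFn_zero ℝ 2 P] with ω h1 h2 h3
  rw [h1, h2, h3]
  rfl

lemma toL2_sub (hW : IsTwoSidedBrownian W P) (j : Fin d) (s t : ℝ) :
    hW.toL2 j t - hW.toL2 j s = (hW.memLp_sub s t j).toLp := rfl

lemma inner_toL2_sub_sub (hW : IsTwoSidedBrownian W P) {a b c : ℝ} (hab : a ≤ b) (hbc : b ≤ c)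
    (j k : Fin d) : ⟪hW.toL2 j b - hW.toL2 j a, hW.toL2 k c - hW.toL2 k b⟫_ℝ = 0 := by
  rw [toL2_sub, toL2_sub, inner_toLp]
  have hi : IndepFun (fun ω => W b ω j - W a ω j) (fun ω => W c ω k - W b ω k) P :=
    (hW.indep_increments.indepFun_sub_sub hab hbc).comp (measurable_pi_apply j)
      (measurable_pi_apply k)
  have := hi.integral_mul_eq_mul_integral (hW.memLp_sub a b j).1 (hW.memLp_sub b c k).1
  simp only [Pi.mul_apply] at this
  rw [this, hW.integral_increment_apply hab, zero_mul]

end IsTwoSidedBrownian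

/-- Orthogonal increments determine the Gram matrix of two curves vanishing at `0`. -/
lemma inner_eq_of_orthogonal_increments {F : Type*} [NormedAddCommGroup F] [InnerProductSpace ℝ F]
    {x y : ℝ → F} {c : ℝ} (hx0 : x 0 = 0) (hy0 : y 0 = 0)
    (h1 : ∀ a b, a ≤ b → ⟪x b - x a, y b - y a⟫_ℝ = c * (b - a))
    (h2 : ∀ a b b', a ≤ b → b ≤ b' → ⟪x b - x a, y b' - y b⟫_ℝ = 0)
    (h3 : ∀ a b b', a ≤ b → b ≤ b' → ⟪x b' - x b, y b - y a⟫_ℝ = 0) (s t : ℝ) :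
    ⟪x s, y t⟫_ℝ = c * ((|s| + |t| - |t - s|) / 2) := by
  rcases le_total 0 s with hs | hs <;> rcases le_total 0 t with ht | ht
  · rcases le_total s t with hst | hst
    · have e1 := h1 0 s hs
      have e2 := h2 0 s t hs hst
      simp only [hx0, hy0, sub_zero, inner_sub_right] at e1 e2
      rw [abs_of_nonneg hs, abs_of_nonneg ht, abs_of_nonneg (sub_nonneg.2 hst)]
      linarith
    · have e1 := h1 0 t ht
      have e2 := h3 0 t s ht hst
      simp only [hx0, hy0, sub_zero, inner_sub_left] at e1 e2
      rw [abs_of_nonneg hs, abs_of_nonneg ht, abs_of_nonpos (sub_nonpos.2 hst)]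
      linarith
  · have e2 := h3 t 0 s ht hs
    simp only [hx0, hy0, sub_zero, zero_sub, inner_neg_right] at e2
    rw [abs_of_nonneg hs, abs_of_nonpos ht, abs_of_nonpos (by linarith)]
    linarith
  · have e2 := h2 s 0 t hs ht
    simp only [hx0, hy0, sub_zero, zero_sub, inner_neg_left] at e2
    rw [abs_of_nonpos hs, abs_of_nonneg ht, abs_of_nonneg (by linarith)]
    linarith
  · rcases le_total s t with hst | hst
    · have e1 := h1 t 0 ht
      have e2 := h3 s t 0 hst ht
      have e3 := h2 s t 0 hst ht
      simp only [hx0, hy0, zero_sub, inner_neg_right, inner_neg_left, inner_sub_left, neg_neg]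
        at e1 e2 e3
      rw [abs_of_nonpos hs, abs_of_nonpos ht, abs_of_nonneg (sub_nonneg.2 hst)]
      linarith
    · have e1 := h1 s 0 hs
      have e2 := h3 t s 0 hst hs
      simp only [hx0, hy0, zero_sub, inner_neg_right, inner_neg_left, inner_sub_right, neg_neg]
        at e1 e2
      rw [abs_of_nonpos hs, abs_of_nonpos ht, abs_of_nonpos (sub_nonpos.2 hst)]
      linarith

lemma inner_signedInd (s t : ℝ) :
    ⟪signedInd s, signedInd t⟫_ℝ = (|s| + |t| - |t - s|) / 2 := by
  have h : ∀ a b, ‖signedInd b - signedInd a‖ ^ 2 = |b - a| := by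
    intro a b
    rcases le_total a b with hab | hab
    · rw [norm_sq_signedInd_sub hab, abs_of_nonneg (sub_nonneg.2 hab)]
    · rw [norm_sub_rev, norm_sq_signedInd_sub hab, abs_of_nonpos (sub_nonpos.2 hab), neg_sub]
  have hs := h 0 s
  have ht := h 0 t
  have hst := h s t
  rw [signedInd_zero, sub_zero, sub_zero] at hs ht
  rw [norm_sub_sq_real, hs, ht, real_inner_comm] at hst
  linarith

lemma IsTwoSidedBrownian.inner_toL2 (hW : IsTwoSidedBrownian W P) (j k : Fin d) (s t : ℝ) :
    ⟪hW.toL2 j s, hW.toL2 k t⟫_ℝ = (if j = k then 1 else 0) * ⟪signedInd s, signedInd t⟫_ℝ := by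
  rw [inner_signedInd]
  refine inner_eq_of_orthogonal_increments (hW.toL2_zero j) (hW.toL2_zero k) (fun a b hab => ?_)
    (fun a b c hab hbc => hW.inner_toL2_sub_sub hab hbc j k)
    (fun a b c hab hbc => ?_) s t
  · rw [hW.toL2_sub, hW.toL2_sub, inner_toLp, hW.integral_increment_mul hab]
  · rw [real_inner_comm]
    exact hW.inner_toL2_sub_sub hab hbc k j

end Brownian

/-! ### The Wiener integral as an isometry -/

section Wiener

variable {d : ℕ} {Ω : Type*} [MeasurableSpace Ω] {P : Measure Ω} [IsProbabilityMeasure P]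
  {W W' : ℝ → Ω → Fin d → ℝ}

namespace IsTwoSidedBrownian

lemma exists_wienerMap (hW : IsTwoSidedBrownian W P) (j : Fin d) :
    ∃ L : Lp ℝ 2 (volume : Measure ℝ) →L[ℝ] Lp ℝ 2 P, ∀ t, L (signedInd t) = hW.toL2 j t :=
  exists_continuousLinearMap_of_gram span_signedInd_dense fun s t => by
    rw [hW.inner_toL2, if_pos rfl, one_mul]

/-- The Wiener integral of a scalar function with respect to the `j`-th coordinate of the
Brownian motion, as a map from `L²(ℝ)` to `L²(P)`. -/
noncomputable def wienerMap (hW : IsTwoSidedBrownian W P) (j : Fin d) :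
    Lp ℝ 2 (volume : Measure ℝ) →L[ℝ] Lp ℝ 2 P := (hW.exists_wienerMap j).choose

lemma wienerMap_signedInd (hW : IsTwoSidedBrownian W P) (j : Fin d) (t : ℝ) :
    hW.wienerMap j (signedInd t) = hW.toL2 j t := (hW.exists_wienerMap j).choose_spec t

lemma wienerMap_indIoc (hW : IsTwoSidedBrownian W P) (j : Fin d) {s t : ℝ} (h : s ≤ t) :
    hW.wienerMap j (indIoc s t) = hW.toL2 j t - hW.toL2 j s := by
  rw [← signedInd_sub h, map_sub, wienerMap_signedInd, wienerMap_signedInd]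

lemma inner_wienerMap (hW : IsTwoSidedBrownian W P) (j k : Fin d)
    (x y : Lp ℝ 2 (volume : Measure ℝ)) :
    ⟪hW.wienerMap j x, hW.wienerMap k y⟫_ℝ = (if j = k then 1 else 0) * ⟪x, y⟫_ℝ :=
  continuousLinearMap_inner_eq span_signedInd_dense (hW.wienerMap_signedInd j)
    (hW.wienerMap_signedInd k) (hW.inner_toL2 j k) x y

end IsTwoSidedBrownian

/-- The two Brownian motions coincide (`κ = 1`) or are independent (`κ = 0`). -/
def IsCoupled (W W' : ℝ → Ω → Fin d → ℝ) (P : Measure Ω) (κ : ℝ) : Prop :=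
  (κ = 1 ∧ ∀ t, W' t =ᵐ[P] W t) ∨ (κ = 0 ∧ IndepFun (fun ω t => W t ω) (fun ω t => W' t ω) P)

namespace IsCoupled

variable {κ : ℝ} (hκ : IsCoupled W W' P κ) (hW : IsTwoSidedBrownian W P)
  (hW' : IsTwoSidedBrownian W' P)

include hκ in
lemma inner_toL2 (j k : Fin d) (s t : ℝ) :
    ⟪hW.toL2 j s, hW'.toL2 k t⟫_ℝ =
      κ * (if j = k then 1 else 0) * ⟪signedInd s, signedInd t⟫_ℝ := by
  rcases hκ with ⟨rfl, h⟩ | ⟨rfl, h⟩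
  · have : hW'.toL2 k t = hW.toL2 k t := by
      apply Lp.ext
      filter_upwards [hW'.toL2_coe k t, hW.toL2_coe k t, h t] with ω h1 h2 h3
      rw [h1, h2, h3]
    rw [this, hW.inner_toL2, one_mul]
  · rw [zero_mul, zero_mul, IsTwoSidedBrownian.toL2, IsTwoSidedBrownian.toL2, inner_toLp]
    have hi : IndepFun (fun ω => W s ω j) (fun ω => W' t ω k) P :=
      h.comp (φ := fun x : ℝ → Fin d → ℝ => x s j) (ψ := fun x : ℝ → Fin d → ℝ => x t k)
        (by fun_prop) (by fun_prop)
    have := hi.integral_mul_eq_mul_integral (hW.memLp s j).1 (hW'.memLp t k).1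
    simp only [Pi.mul_apply] at this
    rw [this, hW.integral_apply, zero_mul]

include hκ in
lemma inner_wienerMap (j k : Fin d) (x y : Lp ℝ 2 (volume : Measure ℝ)) :
    ⟪hW.wienerMap j x, hW'.wienerMap k y⟫_ℝ = κ * (if j = k then 1 else 0) * ⟪x, y⟫_ℝ :=
  continuousLinearMap_inner_eq span_signedInd_dense (hW.wienerMap_signedInd j)
    (hW'.wienerMap_signedInd k) (hκ.inner_toL2 hW hW' j k) x y

include hκ hW hW' in
/-- The pair of Brownian motions is a Gaussian process. -/
lemma isGaussianProcess_prod : IsGaussianProcess (fun t ω => (W t ω, W' t ω)) P := by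
  rcases hκ with ⟨-, h⟩ | ⟨-, h⟩
  · refine IsGaussianProcess.congr (X := fun t ω => (W t ω, W t ω)) ?_ fun t => ?_
    · exact hW.isGaussianProcess.comp_left fun _ =>
        (ContinuousLinearMap.id ℝ (Fin d → ℝ)).prod (ContinuousLinearMap.id ℝ (Fin d → ℝ))
    · filter_upwards [h t] with ω hω
      rw [hω]
  · constructor
    intro I
    have h1 : IndepFun (fun ω => I.restrict (W · ω)) (fun ω => I.restrict (W' · ω)) P :=
      h.comp (φ := fun x : ℝ → Fin d → ℝ => I.restrict x)
        (ψ := fun x : ℝ → Fin d → ℝ => I.restrict x)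
        (Finset.measurable_restrict I) (Finset.measurable_restrict I)
    have h2 := h1.hasGaussianLaw (hW.isGaussianProcess.hasGaussianLaw I)
      (hW'.isGaussianProcess.hasGaussianLaw I)
    exact h2.map_fun
      (F := I → (Fin d → ℝ) × (Fin d → ℝ))
      (ContinuousLinearMap.pi fun t =>
        ((ContinuousLinearMap.proj t).comp (ContinuousLinearMap.fst ℝ _ _)).prod
        ((ContinuousLinearMap.proj t).comp (ContinuousLinearMap.snd ℝ _ _)))

end IsCoupled

/-- All coordinates of both Brownian motions, as one family of random variables. -/
def noise (W W' : ℝ → Ω → Fin d → ℝ) : (Fin d × ℝ) ⊕ (Fin d × ℝ) → Ω → ℝ :=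
  Sum.elim (fun p ω => W p.2 ω p.1) (fun p ω => W' p.2 ω p.1)

section NoiseSpace

variable (hW : IsTwoSidedBrownian W P) (hW' : IsTwoSidedBrownian W' P)

/-- The closed subspace of `L²(P)` spanned by the two Brownian motions. -/
noncomputable def noiseSpace : Submodule ℝ (Lp ℝ 2 P) :=
  (Submodule.span ℝ (range (Sum.elim (fun p : Fin d × ℝ => hW.toL2 p.1 p.2)
    (fun p : Fin d × ℝ => hW'.toL2 p.1 p.2)))).topologicalClosure

lemma wienerMap_mem_noiseSpace_left (j : Fin d) (x : Lp ℝ 2 (volume : Measure ℝ)) :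
    hW.wienerMap j x ∈ noiseSpace hW hW' := by
  have h : (Submodule.span ℝ (range signedInd)).topologicalClosure ≤
      (noiseSpace hW hW').comap (hW.wienerMap j).toLinearMap := by
    refine Submodule.topologicalClosure_minimal _ (Submodule.span_le.2 ?_) ?_
    · rintro _ ⟨t, rfl⟩
      simp only [SetLike.mem_coe, Submodule.mem_comap, ContinuousLinearMap.coe_coe,
        hW.wienerMap_signedInd]
      exact Submodule.le_topologicalClosure _ (Submodule.subset_span ⟨Sum.inl (j, t), rfl⟩)
    · exact (Submodule.isClosed_topologicalClosure _).preimage (hW.wienerMap j).continuous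
  rw [span_signedInd_dense] at h
  exact h (Submodule.mem_top (x := x))

lemma wienerMap_mem_noiseSpace_right (j : Fin d) (x : Lp ℝ 2 (volume : Measure ℝ)) :
    hW'.wienerMap j x ∈ noiseSpace hW hW' := by
  have h : (Submodule.span ℝ (range signedInd)).topologicalClosure ≤
      (noiseSpace hW hW').comap (hW'.wienerMap j).toLinearMap := by
    refine Submodule.topologicalClosure_minimal _ (Submodule.span_le.2 ?_) ?_
    · rintro _ ⟨t, rfl⟩
      simp only [SetLike.mem_coe, Submodule.mem_comap, ContinuousLinearMap.coe_coe,
        hW'.wienerMap_signedInd]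
      exact Submodule.le_topologicalClosure _ (Submodule.subset_span ⟨Sum.inr (j, t), rfl⟩)
    · exact (Submodule.isClosed_topologicalClosure _).preimage (hW'.wienerMap j).continuous
  rw [span_signedInd_dense] at h
  exact h (Submodule.mem_top (x := x))

lemma map_eq_gaussianReal_of_mem_noiseSpace {κ : ℝ} (hκ : IsCoupled W W' P κ) {x : Lp ℝ 2 P}
    (hx : x ∈ noiseSpace hW hW') : P.map x = gaussianReal 0 (‖x‖₊ ^ 2) := by
  have hg : IsGaussianProcess (noise W W') P := by
    refine IsGaussianProcess.of_isGaussianProcess (hκ.isGaussianProcess_prod hW hW') fun p => ?_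
    rcases p with ⟨j, t⟩ | ⟨j, t⟩
    · refine ⟨{t}, (ContinuousLinearMap.proj (R := ℝ) (φ := fun _ : Fin d => ℝ) j).comp
        ((ContinuousLinearMap.fst ℝ _ _).comp (ContinuousLinearMap.proj ⟨t, by simp⟩)),
        fun ω => ?_⟩
      simp [noise, Finset.restrict]
    · refine ⟨{t}, (ContinuousLinearMap.proj (R := ℝ) (φ := fun _ : Fin d => ℝ) j).comp
        ((ContinuousLinearMap.snd ℝ _ _).comp (ContinuousLinearMap.proj ⟨t, by simp⟩)),
        fun ω => ?_⟩
      simp [noise, Finset.restrict]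
  refine map_eq_gaussianReal_of_mem_closure_span hg ?_ ?_ hx
  · rintro (p | p)
    · exact hW.integral_apply _ _
    · exact hW'.integral_apply _ _
  · rintro (p | p)
    · exact hW.toL2_coe _ _
    · exact hW'.toL2_coe _ _

end NoiseSpace

/-! ### Identification of Wiener integrals -/

/-- An entry of a step function as an element of `L²(ℝ)`. -/
noncomputable def StepFunction.toL2 (S : StepFunction d) (i j : Fin d) :
    Lp ℝ 2 (volume : Measure ℝ) :=
  ∑ k, S.value k i j • indIoc (S.left k) (S.right k)

lemma StepFunction.toL2_coe (S : StepFunction d) (i j : Fin d) :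
    S.toL2 i j =ᵐ[volume] fun s => S.toFun s i j := by
  have h1 := Lp.coeFn_finsetSum Finset.univ
    fun k => S.value k i j • indIoc (S.left k) (S.right k)
  have h2 : ∀ᵐ s : ℝ, ∀ k, (S.value k i j • indIoc (S.left k) (S.right k) : Lp ℝ 2 _) s =
      (Ioc (S.left k) (S.right k)).indicator (fun _ => S.value k) s i j := by
    rw [ae_all_iff]
    intro k
    filter_upwards [Lp.coeFn_smul (S.value k i j) (indIoc (S.left k) (S.right k)),
      indIoc_coe (S.left k) (S.right k)] with s a1 a2
    rw [a1, Pi.smul_apply, a2]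
    by_cases hs : s ∈ Ioc (S.left k) (S.right k) <;> simp [hs]
  filter_upwards [h1, h2] with s a1 a2
  rw [StepFunction.toL2, a1, Finset.sum_apply, StepFunction.toFun, Matrix.sum_apply]
  exact Finset.sum_congr rfl fun k _ => a2 k

lemma StepFunction.wienerMap_toL2 (hW : IsTwoSidedBrownian W P) (S : StepFunction d) (i : Fin d) :
    (∑ j, hW.wienerMap j (S.toL2 i j) : Lp ℝ 2 P) =ᵐ[P] fun ω => S.integral W ω i := by
  have e : (∑ j, hW.wienerMap j (S.toL2 i j) : Lp ℝ 2 P) =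
      ∑ p : Fin d × Fin S.size, S.value p.2 i p.1 •
        (hW.toL2 p.1 (S.right p.2) - hW.toL2 p.1 (S.left p.2)) := by
    rw [Fintype.sum_prod_type]
    refine Finset.sum_congr rfl fun j _ => ?_
    simp only [StepFunction.toL2, map_sum, map_smul,
      fun k => hW.wienerMap_indIoc j (S.left_le_right k)]
  rw [e]
  have h1 := Lp.coeFn_finsetSum Finset.univ fun p : Fin d × Fin S.size => S.value p.2 i p.1 •
    (hW.toL2 p.1 (S.right p.2) - hW.toL2 p.1 (S.left p.2))
  have h2 : ∀ᵐ ω ∂P, ∀ p : Fin d × Fin S.size, (S.value p.2 i p.1 •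
      (hW.toL2 p.1 (S.right p.2) - hW.toL2 p.1 (S.left p.2)) : Lp ℝ 2 P) ω =
      S.value p.2 i p.1 * (W (S.right p.2) ω p.1 - W (S.left p.2) ω p.1) := by
    rw [ae_all_iff]
    intro p
    filter_upwards [Lp.coeFn_smul (S.value p.2 i p.1)
      (hW.toL2 p.1 (S.right p.2) - hW.toL2 p.1 (S.left p.2)),
      Lp.coeFn_sub (hW.toL2 p.1 (S.right p.2)) (hW.toL2 p.1 (S.left p.2)),
      hW.toL2_coe p.1 (S.right p.2), hW.toL2_coe p.1 (S.left p.2)] with ω a1 a2 a3 a4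
    rw [a1, Pi.smul_apply, a2, Pi.sub_apply, a3, a4, smul_eq_mul]
  filter_upwards [h1, h2] with ω a1 a2
  rw [a1, Finset.sum_apply, StepFunction.integral, Finset.sum_apply, Fintype.sum_prod_type_right]
  refine Finset.sum_congr rfl fun k _ => ?_
  simp only [Matrix.mulVec, dotProduct, Pi.sub_apply]
  exact Finset.sum_congr rfl fun j _ => a2 (j, k)

lemma tendsto_toLp_of_tendsto_eLpNorm {α : Type*} [MeasurableSpace α] {μ : Measure α}
    {x : ℕ → Lp ℝ 2 μ} {f : ℕ → α → ℝ} {g : α → ℝ} (hg : MemLp g 2 μ)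
    (hx : ∀ n, x n =ᵐ[μ] f n)
    (h : Tendsto (fun n => eLpNorm (fun a => f n a - g a) 2 μ) atTop (𝓝 0)) :
    Tendsto x atTop (𝓝 (hg.toLp g)) := by
  rw [tendsto_iff_edist_tendsto_0]
  refine h.congr fun n => ?_
  rw [Lp.edist_def]
  refine eLpNorm_congr_ae ?_
  filter_upwards [hx n, hg.coeFn_toLp] with a h1 h2
  simp [h1, h2]

/-- The Wiener integral of a matrix-valued function is the sum of its scalar Wiener integrals. -/
lemma IsWienerIntegral.toLp_eq (hW : IsTwoSidedBrownian W P)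
    {Φ : ℝ → Matrix (Fin d) (Fin d) ℝ} {X : Ω → Fin d → ℝ} (h : IsWienerIntegral W P Φ X)
    (i : Fin d) :
    (h.2.1 i).toLp (fun ω => X ω i) =
      ∑ j, hW.wienerMap j ((h.1 i j).toLp (fun s => Φ s i j)) := by
  obtain ⟨hΦ, hX, S, h1, h2⟩ := h
  have e1 : Tendsto (fun n => ∑ j, hW.wienerMap j ((S n).toL2 i j)) atTop
      (𝓝 (∑ j, hW.wienerMap j ((hΦ i j).toLp (fun s => Φ s i j)))) :=
    tendsto_finsetSum _ fun j _ => ((hW.wienerMap j).continuous.tendsto _).comp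
      (tendsto_toLp_of_tendsto_eLpNorm (hΦ i j) (fun n => (S n).toL2_coe i j) (h1 i j))
  have e2 : Tendsto (fun n => ∑ j, hW.wienerMap j ((S n).toL2 i j)) atTop
      (𝓝 ((hX i).toLp (fun ω => X ω i))) :=
    tendsto_toLp_of_tendsto_eLpNorm (hX i) (fun n => (S n).wienerMap_toL2 hW i) (h2 i)
  exact tendsto_nhds_unique e2 e1

end Wiener

/-! ### Correlations of vector processes -/

section Correlations

variable {d : ℕ} {Ω : Type*} [MeasurableSpace Ω] {P : Measure Ω} [IsProbabilityMeasure P]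

/-- The matrix `𝔼 (X ξᵀ)`, as an operator. -/
noncomputable def corr (P : Measure Ω) (X ξ : Ω → Fin d → ℝ) : Op d :=
  matOp (Matrix.of fun i j => ∫ ω, X ω i * ξ ω j ∂P)

@[simp] lemma entry_corr (X ξ : Ω → Fin d → ℝ) (i j : Fin d) :
    entry i j (corr P X ξ) = ∫ ω, X ω i * ξ ω j ∂P := by
  rw [corr, entry_matOp, Matrix.of_apply]

lemma matOp_correlation (V : ℝ → Ω → Fin d → ℝ) (s t : ℝ) :
    matOp (correlation V P s t) = corr P (V s) (V t) := rfl

lemma trOp_corr (X ξ : Ω → Fin d → ℝ) : trOp (corr P X ξ) = corr P ξ X :=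
  op_ext fun i j => by simp [mul_comm]

lemma corr_congr {X X' ξ ξ' : Ω → Fin d → ℝ} (h : X =ᵐ[P] X') (h' : ξ =ᵐ[P] ξ') :
    corr P X ξ = corr P X' ξ' :=
  op_ext fun i j => by
    rw [entry_corr, entry_corr]
    refine integral_congr_ae ?_
    filter_upwards [h, h'] with ω h1 h2
    rw [h1, h2]

/-- A random vector with square integrable coordinates. -/
def IsL2Vec (X : Ω → Fin d → ℝ) (P : Measure Ω) : Prop := ∀ i, MemLp (fun ω => X ω i) 2 P

lemma IsL2Vec.add {X Y : Ω → Fin d → ℝ} (hX : IsL2Vec X P) (hY : IsL2Vec Y P) :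
    IsL2Vec (fun ω => X ω + Y ω) P := fun i => (hX i).add (hY i)

lemma IsL2Vec.sub {X Y : Ω → Fin d → ℝ} (hX : IsL2Vec X P) (hY : IsL2Vec Y P) :
    IsL2Vec (fun ω => X ω - Y ω) P := fun i => (hX i).sub (hY i)

lemma IsL2Vec.mulVec {X : Ω → Fin d → ℝ} (hX : IsL2Vec X P) (M : Matrix (Fin d) (Fin d) ℝ) :
    IsL2Vec (fun ω => M *ᵥ X ω) P := fun i => by
  simp only [Matrix.mulVec, dotProduct]
  exact memLp_finsetSum _ fun j _ => (hX j).const_mul (M i j)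

lemma corr_add_left {X Y ξ : Ω → Fin d → ℝ} (hX : IsL2Vec X P) (hY : IsL2Vec Y P)
    (hξ : IsL2Vec ξ P) : corr P (fun ω => X ω + Y ω) ξ = corr P X ξ + corr P Y ξ :=
  op_ext fun i j => by
    simp only [entry_corr, map_add, Pi.add_apply, add_mul]
    exact integral_add ((hX i).integrable_mul (hξ j)) ((hY i).integrable_mul (hξ j))

lemma corr_sub_left {X Y ξ : Ω → Fin d → ℝ} (hX : IsL2Vec X P) (hY : IsL2Vec Y P)
    (hξ : IsL2Vec ξ P) : corr P (fun ω => X ω - Y ω) ξ = corr P X ξ - corr P Y ξ :=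
  op_ext fun i j => by
    simp only [entry_corr, map_sub, Pi.sub_apply, sub_mul]
    exact integral_sub ((hX i).integrable_mul (hξ j)) ((hY i).integrable_mul (hξ j))

lemma corr_add_right {X Y ξ : Ω → Fin d → ℝ} (hX : IsL2Vec X P) (hY : IsL2Vec Y P)
    (hξ : IsL2Vec ξ P) : corr P ξ (fun ω => X ω + Y ω) = corr P ξ X + corr P ξ Y := by
  rw [← trOp_corr, corr_add_left hX hY hξ, map_add, trOp_corr, trOp_corr]

lemma corr_neg_left (X ξ : Ω → Fin d → ℝ) : corr P (fun ω => -X ω) ξ = -corr P X ξ :=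
  op_ext fun i j => by simp [integral_neg]

lemma corr_mulVec_left {X ξ : Ω → Fin d → ℝ} (hX : IsL2Vec X P) (hξ : IsL2Vec ξ P)
    (M : Matrix (Fin d) (Fin d) ℝ) : corr P (fun ω => M *ᵥ X ω) ξ = matOp M * corr P X ξ :=
  op_ext fun i j => by
    simp only [entry_corr, entry_mul, entry_matOp, Matrix.mulVec, dotProduct, Finset.sum_mul,
      mul_assoc]
    have hi : ∀ k, Integrable (fun ω => M i k * (X ω k * ξ ω j)) P := fun k =>
      ((hX k).integrable_mul (hξ j)).const_mul (M i k)
    rw [integral_finsetSum _ fun k _ => hi k]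
    simp only [integral_const_mul]

lemma ae_eq_zero_of_corr_self {X : Ω → Fin d → ℝ} (hX : IsL2Vec X P) (h : corr P X X = 0) :
    X =ᵐ[P] 0 := by
  have h1 : ∀ i, ∀ᵐ ω ∂P, X ω i = 0 := by
    intro i
    have h2 := congrArg (entry i i) h
    rw [entry_corr, map_zero, integral_eq_zero_iff_of_nonneg (fun ω => mul_self_nonneg _)
      ((hX i).integrable_mul (hX i))] at h2
    filter_upwards [h2] with ω hω
    exact mul_self_eq_zero.1 hω
  filter_upwards [ae_all_iff.2 h1] with ω hω
  ext i
  exact hω i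

/-! ### Measurable vector processes bounded in mean square -/

/-- A vector process whose coordinates are jointly measurable with bounded second moments. -/
def IsBoundedProcess (X : ℝ → Ω → Fin d → ℝ) (P : Measure Ω) : Prop :=
  ∀ i, IsL2Bounded (fun t ω => X t ω i) P

/-- The pathwise convolution of a process with a matrix-valued kernel. -/
noncomputable def kernelConv (A : ℝ → Matrix (Fin d) (Fin d) ℝ) (X : ℝ → Ω → Fin d → ℝ) (t : ℝ)
    (ω : Ω) : Fin d → ℝ := fun i => ∑ j, ∫ s, A (t - s) i j * X s ω j

namespace IsBoundedProcess

variable {X Y : ℝ → Ω → Fin d → ℝ}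

lemma isL2Vec (hX : IsBoundedProcess X P) (t : ℝ) : IsL2Vec (X t) P := fun i => (hX i).memLp t

lemma measurable (hX : IsBoundedProcess X P) : Measurable (Function.uncurry X) :=
  measurable_pi_iff.2 fun i => (hX i).measurable

lemma add (hX : IsBoundedProcess X P) (hY : IsBoundedProcess Y P) :
    IsBoundedProcess (fun t ω => X t ω + Y t ω) P := fun i => (hX i).add (hY i)

lemma neg (hX : IsBoundedProcess X P) : IsBoundedProcess (fun t ω => -X t ω) P := fun i => by
  simpa using (hX i).const_mul (-1)

lemma sub (hX : IsBoundedProcess X P) (hY : IsBoundedProcess Y P) :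
    IsBoundedProcess (fun t ω => X t ω - Y t ω) P := by
  simpa only [sub_eq_add_neg] using hX.add hY.neg

lemma mulVec (hX : IsBoundedProcess X P) (M : Matrix (Fin d) (Fin d) ℝ) :
    IsBoundedProcess (fun t ω => M *ᵥ X t ω) P := fun i => by
  simp only [Matrix.mulVec, dotProduct]
  exact IsL2Bounded.sum fun j _ => (hX j).const_mul (M i j)

lemma kernelConv (hX : IsBoundedProcess X P) {A : ℝ → Matrix (Fin d) (Fin d) ℝ}
    (hA : ∀ i j, Measurable fun t => A t i j) (hA1 : ∀ i j, Integrable fun t => A t i j) :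
    IsBoundedProcess (kernelConv A X) P := fun i =>
  IsL2Bounded.sum fun j _ => (hX j).conv (hA i j) (hA1 i j)

lemma aestronglyMeasurable_corr (hX : IsBoundedProcess X P) {ξ : Ω → Fin d → ℝ}
    (hξ : IsL2Vec ξ P) : AEStronglyMeasurable (fun t => corr P (X t) ξ) volume :=
  aestronglyMeasurable_matOp fun i j => by
    have : AEStronglyMeasurable (fun p : ℝ × Ω => X p.1 p.2 i * ξ p.2 j)
        ((volume : Measure ℝ).prod P) :=
      (hX i).measurable.aestronglyMeasurable.mul (hξ j).1.comp_snd
    exact this.integral_prod_right'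

lemma bounded_corr (hX : IsBoundedProcess X P) {ξ : Ω → Fin d → ℝ} (hξ : IsL2Vec ξ P) :
    ∃ C, ∀ t, ‖corr P (X t) ξ‖ ≤ C := by
  have h1 : ∀ i j, ∃ C, ∀ t, |∫ ω, X t ω i * ξ ω j ∂P| ≤ C := by
    intro i j
    obtain ⟨C, hC⟩ := (hX i).bound
    refine ⟨C + ∫ ω, ξ ω j ^ 2 ∂P, fun t => ?_⟩
    have i1 := ((hX i).memLp t).integrable_sq
    have i2 := (hξ j).integrable_sq
    refine abs_integral_le_integral_abs.trans ?_
    calc ∫ ω, |X t ω i * ξ ω j| ∂P ≤ ∫ ω, (X t ω i ^ 2 + ξ ω j ^ 2) ∂P := by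
          refine integral_mono (((hX i).memLp t).integrable_mul (hξ j)).abs (i1.add i2) fun ω => ?_
          rw [abs_le]
          constructor <;> nlinarith [sq_nonneg (X t ω i + ξ ω j), sq_nonneg (X t ω i - ξ ω j)]
      _ ≤ _ := by
          rw [integral_add i1 i2]
          linarith [hC t]
  exact exists_norm_matOp_le h1

lemma corr_kernelConv (hX : IsBoundedProcess X P) {A : ℝ → Matrix (Fin d) (Fin d) ℝ}
    (hA1 : ∀ i j, Integrable fun t => A t i j) {ξ : Ω → Fin d → ℝ} (hξ : IsL2Vec ξ P) (t : ℝ) :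
    corr P (GLE.kernelConv A X t) ξ = conv (fun t => matOp (A t)) (fun s => corr P (X s) ξ) t := by
  obtain ⟨C, hC⟩ := hX.bounded_corr hξ
  have hi := integrable_mul_of_bounded (integrable_matOp hA1) (hX.aestronglyMeasurable_corr hξ) hC t
  refine op_ext fun i l => ?_
  rw [conv, entry_integral hi, entry_corr]
  simp only [entry_mul, entry_matOp, entry_corr, GLE.kernelConv, Finset.sum_mul]
  have ha : ∀ j, Integrable fun s => A (t - s) i j := fun j => (hA1 i j).comp_sub_left t
  have h1 : ∀ j, Integrable (fun ω => (∫ s, A (t - s) i j * X s ω j) * ξ ω l) P := by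
    intro j
    obtain ⟨C, hC⟩ := (hX j).bound
    exact ((hX j).integral_sq_le_and_memLp (ha j) hC).1.integrable_mul (hξ l)
  have h2 : ∀ j, Integrable fun s => A (t - s) i j * ∫ ω, X s ω j * ξ ω l ∂P := by
    intro j
    have := ((hX j).integrable_kernel_mul (ha j) (hξ l)).integral_prod_left
    simpa only [integral_const_mul] using this
  rw [integral_finsetSum _ fun j _ => h1 j, integral_finsetSum _ fun j _ => h2 j]
  exact Finset.sum_congr rfl fun j _ => (hX j).integral_mul_eq (ha j) (hξ l)

lemma corr_intervalIntegral (hX : IsBoundedProcess X P) {ξ : Ω → Fin d → ℝ} (hξ : IsL2Vec ξ P)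
    {t₁ t₂ : ℝ} (h12 : t₁ ≤ t₂) :
    corr P (fun ω i => ∫ t in t₁..t₂, X t ω i) ξ = ∫ t in Ioc t₁ t₂, corr P (X t) ξ := by
  obtain ⟨C, hC⟩ := hX.bounded_corr hξ
  have hi : IntegrableOn (fun t => corr P (X t) ξ) (Ioc t₁ t₂) :=
    Measure.integrableOn_of_bounded measure_Ioc_lt_top.ne (hX.aestronglyMeasurable_corr hξ)
      (ae_of_all _ hC)
  refine op_ext fun i l => ?_
  rw [entry_integral hi, entry_corr]
  simp only [entry_corr]
  exact (hX i).integral_intervalIntegral_mul h12 (hξ l)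

lemma isL2Vec_intervalIntegral (hX : IsBoundedProcess X P) {t₁ t₂ : ℝ} (h12 : t₁ ≤ t₂) :
    IsL2Vec (fun ω i => ∫ t in t₁..t₂, X t ω i) P := fun i => (hX i).memLp_intervalIntegral h12

end IsBoundedProcess

end Correlations

/-! ### The Langevin equation with a measurable memory kernel -/

section Langevin

variable {d : ℕ} {Ω : Type*} [MeasurableSpace Ω] {P : Measure Ω} [IsProbabilityMeasure P]
  {D G : Matrix (Fin d) (Fin d) ℝ} {γ Γ : ℝ → Matrix (Fin d) (Fin d) ℝ}
  {F₀ W V V' : ℝ → Ω → Fin d → ℝ}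

/-- The drift, with the memory integral extended to the whole line and taken coordinatewise. -/
noncomputable def driftProcess (D : Matrix (Fin d) (Fin d) ℝ) (Γ : ℝ → Matrix (Fin d) (Fin d) ℝ)
    (F₀ V : ℝ → Ω → Fin d → ℝ) (t : ℝ) (ω : Ω) : Fin d → ℝ :=
  -(D *ᵥ V t ω) - kernelConv Γ V t ω + F₀ t ω

lemma IsL2Bounded.ae_ae_integrable {X : ℝ → Ω → ℝ} (hX : IsL2Bounded X P) {a : ℝ → ℝ}
    (ha : Measurable a) (ha1 : Integrable a) :
    ∀ᵐ ω ∂P, ∀ᵐ t : ℝ, Integrable fun s => a (t - s) * X s ω := by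
  have hf : Measurable fun q : (ℝ × Ω) × ℝ => a (q.1.1 - q.2) * X q.2 q.1.2 :=
    (ha.comp (by fun_prop)).mul (hX.measurable.comp
      (by fun_prop : Measurable fun q : (ℝ × Ω) × ℝ => (q.2, q.1.2)))
  have hf' : StronglyMeasurable (Function.uncurry fun (p : ℝ × Ω) s => a (p.1 - s) * X s p.2) :=
    hf.stronglyMeasurable
  have hms := _root_.measurableSet_integrable (μ := (volume : Measure ℝ)) hf'
  have h := Measure.ae_ae_comm (μ := (volume : Measure ℝ)) (ν := P)
    (p := fun t ω => Integrable fun s => a (t - s) * X s ω) hms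
  exact h.1 (ae_of_all _ fun t => hX.ae_integrable (ha1.comp_sub_left t))

lemma IsBoundedProcess.of_isMeanSquareBounded (hm : Measurable (Function.uncurry V))
    (hV : IsMeanSquareBounded V P) : IsBoundedProcess V P := by
  obtain ⟨h1, C, hC⟩ := hV
  refine fun i => ⟨(measurable_pi_apply i).comp hm, fun t => h1 t i, C, fun t => ?_⟩
  refine le_trans ?_ (hC t)
  refine integral_mono (h1 t i).integrable_sq
    (integrable_finsetSum _ fun j _ => (h1 t j).integrable_sq) fun ω => ?_
  exact Finset.single_le_sum (f := fun j => V t ω j ^ 2) (fun j _ => sq_nonneg _)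
    (Finset.mem_univ i)

lemma IsBoundedProcess.isMeanSquareBounded (hV : IsBoundedProcess V P) :
    IsMeanSquareBounded V P := by
  refine ⟨fun t i => (hV i).memLp t, ?_⟩
  choose C hC using fun i => (hV i).bound
  refine ⟨∑ i, C i, fun t => ?_⟩
  rw [integral_finsetSum _ fun i _ => ((hV i).memLp t).integrable_sq]
  exact Finset.sum_le_sum fun i _ => hC i t

lemma IsBoundedProcess.ae_ae_integrable (hV : IsBoundedProcess V P)
    {A : ℝ → Matrix (Fin d) (Fin d) ℝ} (hA : ∀ i j, Measurable fun t => A t i j)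
    (hA1 : ∀ i j, Integrable fun t => A t i j) :
    ∀ᵐ ω ∂P, ∀ᵐ t : ℝ, ∀ i j, Integrable fun s => A (t - s) i j * V s ω j := by
  filter_upwards [ae_all_iff.2 fun i => ae_all_iff.2 fun j =>
    (hV j).ae_ae_integrable (hA i j) (hA1 i j)] with ω hω
  rw [ae_all_iff]
  intro i
  rw [ae_all_iff]
  exact fun j => hω i j

/-- The memory integral of a path, in terms of the measurable version of the kernel. -/
lemma IsExtendedKernel.memory (hΓ : IsExtendedKernel γ Γ) {x : ℝ → Fin d → ℝ} {t : ℝ}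
    (hx : ∀ i j, Integrable fun s => Γ (t - s) i j * x s j) :
    IntegrableOn (fun s => γ (t - s) *ᵥ x s) (Iio t) ∧
      ∫ s in Iio t, γ (t - s) *ᵥ x s = fun i => ∑ j, ∫ s, Γ (t - s) i j * x s j := by
  have hi : Integrable fun s => Γ (t - s) *ᵥ x s :=
    .of_eval fun i => by
      simp only [Matrix.mulVec, dotProduct]
      exact integrable_finsetSum _ fun j _ => hx i j
  have he : ∀ᵐ s ∂volume.restrict (Iio t), Γ (t - s) *ᵥ x s = γ (t - s) *ᵥ x s := by
    rw [ae_restrict_iff' measurableSet_Iio]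
    filter_upwards [hΓ.ae_eq_sub t] with s hs hst
    rw [hs hst]
  refine ⟨hi.integrableOn.congr he, ?_⟩
  have hz : ∀ s, s ∉ Iio t → Γ (t - s) *ᵥ x s = 0 := fun s hs => by
    rw [hΓ.zero _ (by simpa using hs), Matrix.zero_mulVec]
  rw [← integral_congr_ae he, setIntegral_eq_integral_of_forall_compl_eq_zero hz]
  ext i
  rw [eval_integral fun i => hi.eval i]
  simp only [Matrix.mulVec, dotProduct]
  rw [integral_finsetSum _ fun j _ => hx i j]

lemma IsExtendedKernel.ae_memory (hΓ : IsExtendedKernel γ Γ) (hV : IsBoundedProcess V P) :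
    ∀ᵐ ω ∂P, ∀ᵐ t : ℝ, IntegrableOn (fun s => γ (t - s) *ᵥ V s ω) (Iio t) ∧
      drift D γ F₀ V ω t = driftProcess D Γ F₀ V t ω := by
  filter_upwards [hV.ae_ae_integrable hΓ.measurable hΓ.integrable] with ω hω
  filter_upwards [hω] with t ht
  obtain ⟨h1, h2⟩ := hΓ.memory ht
  refine ⟨h1, ?_⟩
  rw [drift, h2]
  rfl

lemma isBoundedProcess_driftProcess (hΓ : IsExtendedKernel γ Γ) (hV : IsBoundedProcess V P)
    (hF : IsBoundedProcess F₀ P) : IsBoundedProcess (driftProcess D Γ F₀ V) P :=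
  ((hV.mulVec D).neg.sub (hV.kernelConv hΓ.measurable hΓ.integrable)).add hF

lemma corr_driftProcess (hΓ : IsExtendedKernel γ Γ) (hV : IsBoundedProcess V P)
    (hF : IsBoundedProcess F₀ P) {ξ : Ω → Fin d → ℝ} (hξ : IsL2Vec ξ P) (t : ℝ) :
    corr P (driftProcess D Γ F₀ V t) ξ = corr P (F₀ t) ξ -
      (matOp D * corr P (V t) ξ + conv (fun t => matOp (Γ t)) (fun s => corr P (V s) ξ) t) := by
  have hK := hV.kernelConv hΓ.measurable hΓ.integrable
  have h1 : corr P (driftProcess D Γ F₀ V t) ξ =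
      corr P (fun ω => (-(D *ᵥ V t ω) - kernelConv Γ V t ω)) ξ + corr P (F₀ t) ξ :=
    corr_add_left (((hV.mulVec D).neg.sub hK).isL2Vec t) (hF.isL2Vec t) hξ
  have h2 : corr P (fun ω => (-(D *ᵥ V t ω) - kernelConv Γ V t ω)) ξ =
      corr P (fun ω => -(D *ᵥ V t ω)) ξ - corr P (kernelConv Γ V t) ξ :=
    corr_sub_left ((hV.mulVec D).neg.isL2Vec t) (hK.isL2Vec t) hξ
  rw [h1, h2, corr_neg_left, corr_mulVec_left (hV.isL2Vec t) hξ,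
    hV.corr_kernelConv hΓ.integrable hξ]
  abel

lemma IsBoundedProcess.ae_intervalIntegrable (hV : IsBoundedProcess V P) :
    ∀ᵐ ω ∂P, ∀ t₁ t₂, IntervalIntegrable (fun t => V t ω) volume t₁ t₂ := by
  filter_upwards [ae_all_iff.2 fun i => (hV i).ae_intervalIntegrable] with ω hω t₁ t₂
  rw [intervalIntegrable_iff]
  exact .of_eval fun i => intervalIntegrable_iff.1 (hω i t₁ t₂)

lemma intervalIntegral_eval {f : ℝ → Fin d → ℝ} {a b : ℝ} (hf : IntervalIntegrable f volume a b)
    (i : Fin d) : (∫ t in a..b, f t) i = ∫ t in a..b, f t i :=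
  ((ContinuousLinearMap.proj (R := ℝ) (φ := fun _ : Fin d => ℝ) i).intervalIntegral_comp_comm
    hf).symm

/-- Almost surely, the drift is locally integrable, and its integrals are those of the drift
process, coordinatewise. -/
lemma ae_drift (hΓ : IsExtendedKernel γ Γ) (hV : IsBoundedProcess V P)
    (hF : IsBoundedProcess F₀ P) :
    ∀ᵐ ω ∂P, ∀ t₁ t₂, IntervalIntegrable (drift D γ F₀ V ω) volume t₁ t₂ ∧
      ∫ t in t₁..t₂, drift D γ F₀ V ω t =
        fun i => ∫ t in t₁..t₂, driftProcess D Γ F₀ V t ω i := by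
  filter_upwards [hΓ.ae_memory (D := D) (F₀ := F₀) hV,
    (isBoundedProcess_driftProcess (D := D) hΓ hV hF).ae_intervalIntegrable] with ω h1 h2 t₁ t₂
  have h3 : (fun t => driftProcess D Γ F₀ V t ω) =ᵐ[volume] drift D γ F₀ V ω := by
    filter_upwards [h1] with t ht
    exact ht.2.symm
  refine ⟨(h2 t₁ t₂).congr_ae (ae_restrict_of_ae h3), ?_⟩
  rw [intervalIntegral.integral_congr_ae_restrict (ae_restrict_of_ae h3.symm)]
  ext i
  exact intervalIntegral_eval (h2 t₁ t₂) i

/-- Two solutions that are bounded in mean square coincide: tested against a square integrable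
random vector, their difference is a bounded solution of the homogeneous equation. -/
lemma ae_eq_of_equation {R : ℝ → Op d}
    (hR : IsExtendedResolvent (matOp D) (fun t => matOp (Γ t)) R)
    (hΓ : IsExtendedKernel γ Γ) (hV : IsBoundedProcess V P) (hV' : IsBoundedProcess V' P)
    (hF : IsBoundedProcess F₀ P)
    (h : ∀ t₁ t₂, t₁ ≤ t₂ → ∀ᵐ ω ∂P, IntegratedEquation D G γ F₀ W V t₁ t₂ ω)
    (h' : ∀ t₁ t₂, t₁ ≤ t₂ → ∀ᵐ ω ∂P, IntegratedEquation D G γ F₀ W V' t₁ t₂ ω) (t : ℝ) :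
    V' t =ᵐ[P] V t := by
  have hd := isBoundedProcess_driftProcess (D := D) hΓ hV hF
  have hd' := isBoundedProcess_driftProcess (D := D) hΓ hV' hF
  have hY := hV'.sub hV
  have key : ∀ ξ, IsL2Vec ξ P → ∀ t, corr P (fun ω => V' t ω - V t ω) ξ = 0 := by
    intro ξ hξ
    obtain ⟨C, hC⟩ := hY.bounded_corr hξ
    refine hR.eq_zero_of_bounded (hY.aestronglyMeasurable_corr hξ) hC fun t₁ t₂ h12 => ?_
    have hint := hd'.sub hd
    have e1 : (fun ω => (V' t₂ ω - V t₂ ω) - (V' t₁ ω - V t₁ ω)) =ᵐ[P]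
        fun ω i => ∫ t in t₁..t₂,
          (driftProcess D Γ F₀ V' t ω - driftProcess D Γ F₀ V t ω) i := by
      filter_upwards [h t₁ t₂ h12, h' t₁ t₂ h12, ae_drift (D := D) hΓ hV hF,
        ae_drift (D := D) hΓ hV' hF, hd.ae_intervalIntegrable, hd'.ae_intervalIntegrable]
        with ω a a' b b' c c'
      rw [IntegratedEquation, (b t₁ t₂).2] at a
      rw [IntegratedEquation, (b' t₁ t₂).2] at a'
      have e : V' t₂ ω - V t₂ ω - (V' t₁ ω - V t₁ ω) =
          (V' t₂ ω - V' t₁ ω) - (V t₂ ω - V t₁ ω) := by abel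
      rw [e, a, a', add_sub_add_right_eq_sub]
      ext i
      rw [Pi.sub_apply, ← intervalIntegral_eval (c t₁ t₂), ← intervalIntegral_eval (c' t₁ t₂),
        ← intervalIntegral_eval ((c' t₁ t₂).sub (c t₁ t₂)),
        intervalIntegral.integral_sub (c' t₁ t₂) (c t₁ t₂), Pi.sub_apply]
    rw [← corr_sub_left (hY.isL2Vec t₂) (hY.isL2Vec t₁) hξ, corr_congr e1 (ae_eq_refl ξ),
      hint.corr_intervalIntegral hξ h12, ← integral_neg]
    refine integral_congr_ae (ae_of_all _ fun t => ?_)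
    beta_reduce
    rw [corr_sub_left (hd'.isL2Vec t) (hd.isL2Vec t) hξ, corr_driftProcess hΓ hV hF hξ,
      corr_driftProcess hΓ hV' hF hξ, corr_sub_left (hV'.isL2Vec t) (hV.isL2Vec t) hξ]
    have e3 : conv (fun t => matOp (Γ t)) (fun s => corr P (fun ω => V' s ω - V s ω) ξ) t =
        conv (fun t => matOp (Γ t)) (fun s => corr P (V' s) ξ) t -
          conv (fun t => matOp (Γ t)) (fun s => corr P (V s) ξ) t := by
      obtain ⟨C₁, hC₁⟩ := hV.bounded_corr hξ
      obtain ⟨C₂, hC₂⟩ := hV'.bounded_corr hξ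
      have iΓ := integrable_matOp hΓ.integrable
      simp only [conv]
      rw [← integral_sub
        (integrable_mul_of_bounded iΓ (hV'.aestronglyMeasurable_corr hξ) hC₂ t)
        (integrable_mul_of_bounded iΓ (hV.aestronglyMeasurable_corr hξ) hC₁ t)]
      refine integral_congr_ae (ae_of_all _ fun s => ?_)
      beta_reduce
      rw [corr_sub_left (hV'.isL2Vec s) (hV.isL2Vec s) hξ, mul_sub]
    rw [e3, mul_sub]
    abel
  filter_upwards [ae_eq_zero_of_corr_self (hY.isL2Vec t) (key _ (hY.isL2Vec t) t)] with ω hω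
  exact sub_eq_zero.1 hω

end Langevin

/-! ### Random vectors represented by Wiener integrals -/

section Representation

variable {d : ℕ} {Ω : Type*} [MeasurableSpace Ω] {P : Measure Ω} [IsProbabilityMeasure P]
  {W W' : ℝ → Ω → Fin d → ℝ}

/-- The random vector `X` is the Wiener integral of the square integrable matrix-valued function
`Ψ`, in terms of the isometries `wienerMap`. -/
structure IsRepresented (hW : IsTwoSidedBrownian W P) (Ψ : ℝ → Matrix (Fin d) (Fin d) ℝ)
    (X : Ω → Fin d → ℝ) : Prop where
  isL2Vec : IsL2Vec X P
  isL2 : IsL2 Ψ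
  eq : ∀ i, (isL2Vec i).toLp (fun ω => X ω i) =
    ∑ j, hW.wienerMap j ((isL2 i j).toLp (fun s => Ψ s i j))

lemma IsWienerIntegral.isRepresented (hW : IsTwoSidedBrownian W P)
    {Φ : ℝ → Matrix (Fin d) (Fin d) ℝ} {X : Ω → Fin d → ℝ} (h : IsWienerIntegral W P Φ X) :
    IsRepresented hW Φ X := ⟨h.2.1, h.1, h.toLp_eq hW⟩

lemma integrable_mul_trOp {Ψ Ψ' : ℝ → Matrix (Fin d) (Fin d) ℝ} (h : IsL2 Ψ) (h' : IsL2 Ψ') :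
    Integrable fun u => matOp (Ψ u) * trOp (matOp (Ψ' u)) :=
  integrable_op fun i l => by
    simp only [entry_mul, entry_trOp, entry_matOp]
    exact integrable_finsetSum _ fun j _ => (h i j).integrable_mul (h' l j)

/-- The common part of the two isometry relations below. -/
lemma corr_eq_of_inner (hW : IsTwoSidedBrownian W P) (hW' : IsTwoSidedBrownian W' P) {c : ℝ}
    (hc : ∀ j k x y, ⟪hW.wienerMap j x, hW'.wienerMap k y⟫_ℝ =
      c * (if j = k then 1 else 0) * ⟪x, y⟫_ℝ)
    {Ψ Ψ' : ℝ → Matrix (Fin d) (Fin d) ℝ} {X Y : Ω → Fin d → ℝ}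
    (hX : IsRepresented hW Ψ X) (hY : IsRepresented hW' Ψ' Y) :
    corr P X Y = c • ∫ u, matOp (Ψ u) * trOp (matOp (Ψ' u)) := by
  refine op_ext fun i l => ?_
  rw [map_smul, entry_integral (integrable_mul_trOp hX.isL2 hY.isL2), entry_corr,
    ← inner_toLp (hX.isL2Vec i) (hY.isL2Vec l), hX.eq, hY.eq, sum_inner]
  simp only [entry_mul, entry_trOp, entry_matOp]
  have hi : ∀ j, Integrable fun u => Ψ u i j * Ψ' u l j := fun j =>
    (hX.isL2 i j).integrable_mul (hY.isL2 l j)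
  rw [integral_finsetSum _ fun j _ => hi j, Finset.smul_sum]
  refine Finset.sum_congr rfl fun j _ => ?_
  rw [inner_sum]
  simp only [hc, inner_toLp]
  simp

lemma IsRepresented.corr_eq {hW : IsTwoSidedBrownian W P}
    {Ψ Ψ' : ℝ → Matrix (Fin d) (Fin d) ℝ} {X Y : Ω → Fin d → ℝ}
    (hX : IsRepresented hW Ψ X) (hY : IsRepresented hW Ψ' Y) :
    corr P X Y = ∫ u, matOp (Ψ u) * trOp (matOp (Ψ' u)) := by
  rw [corr_eq_of_inner hW hW (c := 1)
    (fun j k x y => by rw [hW.inner_wienerMap, one_mul]) hX hY, one_smul]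

lemma IsRepresented.corr_eq_cross {κ : ℝ} (hκ : IsCoupled W W' P κ) {hW : IsTwoSidedBrownian W P}
    {hW' : IsTwoSidedBrownian W' P} {Ψ Ψ' : ℝ → Matrix (Fin d) (Fin d) ℝ} {X Y : Ω → Fin d → ℝ}
    (hX : IsRepresented hW Ψ X) (hY : IsRepresented hW' Ψ' Y) :
    corr P X Y = κ • ∫ u, matOp (Ψ u) * trOp (matOp (Ψ' u)) :=
  corr_eq_of_inner hW hW' (hκ.inner_wienerMap hW hW') hX hY

/-- A measurable process of moving average form is bounded in mean square. -/
lemma isBoundedProcess_of_isRepresented {hW : IsTwoSidedBrownian W P}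
    {ψ : ℝ → Matrix (Fin d) (Fin d) ℝ} {X : ℝ → Ω → Fin d → ℝ}
    (hm : ∀ i, Measurable (Function.uncurry fun t ω => X t ω i))
    (h : ∀ t, IsRepresented hW (fun u => ψ (t - u)) (X t)) : IsBoundedProcess X P := by
  refine fun i => ⟨hm i, fun t => (h t).isL2Vec i, ∑ j, ∫ u, ψ u i j * ψ u i j, fun t => ?_⟩
  have h1 := congrArg (entry i i) ((h t).corr_eq (h t))
  rw [entry_corr, entry_integral (integrable_mul_trOp (h t).isL2 (h t).isL2)] at h1
  simp only [entry_mul, entry_trOp, entry_matOp] at h1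
  have hi : ∀ j, Integrable fun u => ψ (t - u) i j * ψ (t - u) i j := fun j =>
    ((h t).isL2 i j).integrable_mul ((h t).isL2 i j)
  rw [integral_finsetSum _ fun j _ => hi j] at h1
  simp only [pow_two, h1]
  exact le_of_eq (Finset.sum_congr rfl fun j _ =>
    integral_sub_left_eq_self (fun u => ψ u i j * ψ u i j) volume t)

/-- For square integrable `ψ` there is a measurable process `t ↦ ∫ ψ(t - u) dW(u)`. -/
lemma exists_isRepresented (hW : IsTwoSidedBrownian W P) {ψ : ℝ → Matrix (Fin d) (Fin d) ℝ}
    (hψ : IsL2 ψ) : ∃ Z : ℝ → Ω → Fin d → ℝ,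
      (∀ i, Measurable (Function.uncurry fun t ω => Z t ω i)) ∧
      ∀ t, IsRepresented hW (fun u => ψ (t - u)) (Z t) := by
  have hl : ∀ t, IsL2 fun u => ψ (t - u) := fun t i j => memLp_comp_sub_left (hψ i j) t
  have hc : ∀ i, Continuous fun t =>
      ∑ j, hW.wienerMap j ((hl t i j).toLp fun s => ψ (t - s) i j) := fun i =>
    continuous_finsetSum _ fun j _ =>
      (hW.wienerMap j).continuous.comp (continuous_toLp_comp_sub_left (hψ i j))
  choose Z hZm hZ using fun i => exists_measurable_modification (hc i)
  have hZ2 : ∀ t i, MemLp (Z i t) 2 P := fun t i => (memLp_congr_ae (hZ i t)).2 (Lp.memLp _)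
  refine ⟨fun t ω i => Z i t ω, hZm, fun t => ⟨fun i => hZ2 t i, hl t, fun i => ?_⟩⟩
  apply Lp.ext
  filter_upwards [(hZ2 t i).coeFn_toLp, hZ i t] with ω h1 h2
  rw [h1, h2]

/-! ### White noise tested against a square integrable random vector -/

/-- The matrix-valued function `u ↦ 𝔼 (Ẇ(u) ξᵀ)`, given by the adjoint of the Wiener integral. -/
noncomputable def whiteDensity (hW : IsTwoSidedBrownian W P) {ξ : Ω → Fin d → ℝ}
    (hξ : IsL2Vec ξ P) (u : ℝ) : Matrix (Fin d) (Fin d) ℝ :=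
  Matrix.of fun k l => (hW.wienerMap k).adjoint ((hξ l).toLp fun ω => ξ ω l) u

lemma isL2_whiteDensity (hW : IsTwoSidedBrownian W P) {ξ : Ω → Fin d → ℝ} (hξ : IsL2Vec ξ P) :
    IsL2 (whiteDensity hW hξ) := fun _ _ => Lp.memLp _

lemma integrable_mul_whiteDensity (hW : IsTwoSidedBrownian W P) {ξ : Ω → Fin d → ℝ}
    (hξ : IsL2Vec ξ P) {Ψ : ℝ → Matrix (Fin d) (Fin d) ℝ} (h : IsL2 Ψ) :
    Integrable fun u => matOp (Ψ u) * matOp (whiteDensity hW hξ u) :=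
  integrable_op fun i l => by
    simp only [entry_mul, entry_matOp]
    exact integrable_finsetSum _ fun j _ => (h i j).integrable_mul (isL2_whiteDensity hW hξ j l)

lemma IsRepresented.corr_eq_whiteDensity {hW : IsTwoSidedBrownian W P}
    {Ψ : ℝ → Matrix (Fin d) (Fin d) ℝ} {X ξ : Ω → Fin d → ℝ}
    (hX : IsRepresented hW Ψ X) (hξ : IsL2Vec ξ P) :
    corr P X ξ = ∫ u, matOp (Ψ u) * matOp (whiteDensity hW hξ u) := by
  refine op_ext fun i l => ?_
  rw [entry_integral (integrable_mul_whiteDensity hW hξ hX.isL2), entry_corr,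
    ← inner_toLp (hX.isL2Vec i) (hξ l), hX.eq, sum_inner]
  simp only [entry_mul, entry_matOp]
  have hi : ∀ j, Integrable fun u => Ψ u i j * whiteDensity hW hξ u j l := fun j =>
    (hX.isL2 i j).integrable_mul (isL2_whiteDensity hW hξ j l)
  rw [integral_finsetSum _ fun j _ => hi j]
  refine Finset.sum_congr rfl fun j _ => ?_
  rw [← ContinuousLinearMap.adjoint_inner_right, L2.inner_def]
  refine integral_congr_ae ?_
  filter_upwards [(hX.isL2 i j).coeFn_toLp] with s h1
  rw [h1]
  simp [whiteDensity, mul_comm]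

lemma isRepresented_increment (hW : IsTwoSidedBrownian W P) {t₁ t₂ : ℝ} (h12 : t₁ ≤ t₂) :
    IsRepresented hW (indicator (Ioc t₁ t₂) fun _ => 1) (fun ω => W t₂ ω - W t₁ ω) := by
  have hL : IsL2 (indicator (Ioc t₁ t₂) fun _ => (1 : Matrix (Fin d) (Fin d) ℝ)) := by
    intro i j
    have e : (fun s => indicator (Ioc t₁ t₂) (fun _ => (1 : Matrix (Fin d) (Fin d) ℝ)) s i j) =
        indicator (Ioc t₁ t₂) fun _ => (1 : Matrix (Fin d) (Fin d) ℝ) i j := by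
      funext s
      by_cases hs : s ∈ Ioc t₁ t₂ <;> simp [hs]
    rw [e]
    exact memLp_indicator_const 2 measurableSet_Ioc _ (Or.inr measure_Ioc_lt_top.ne)
  refine ⟨fun i => hW.memLp_sub t₁ t₂ i, hL, fun i => ?_⟩
  have e1 : ∀ j, (hL i j).toLp _ = (if j = i then (1 : ℝ) else 0) • indIoc t₁ t₂ := by
    intro j
    apply Lp.ext
    filter_upwards [(hL i j).coeFn_toLp, Lp.coeFn_smul (if j = i then (1 : ℝ) else 0)
      (indIoc t₁ t₂), indIoc_coe t₁ t₂] with s h1 h2 h3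
    rw [h1, h2, Pi.smul_apply, h3]
    by_cases hs : s ∈ Ioc t₁ t₂ <;> simp [hs, Matrix.one_apply, eq_comm]
  simp only [e1, map_smul]
  simp only [ite_smul, one_smul, zero_smul, Finset.sum_ite_eq', Finset.mem_univ, if_true]
  rw [hW.wienerMap_indIoc i h12, hW.toL2_sub]
  rfl

lemma corr_increment (hW : IsTwoSidedBrownian W P) {ξ : Ω → Fin d → ℝ} (hξ : IsL2Vec ξ P)
    {t₁ t₂ : ℝ} (h12 : t₁ ≤ t₂) :
    corr P (fun ω => W t₂ ω - W t₁ ω) ξ = ∫ u in Ioc t₁ t₂, matOp (whiteDensity hW hξ u) := by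
  rw [(isRepresented_increment hW h12).corr_eq_whiteDensity hξ,
    ← integral_indicator measurableSet_Ioc]
  refine integral_congr_ae (ae_of_all _ fun u => ?_)
  by_cases hu : u ∈ Ioc t₁ t₂ <;> simp [hu]

end Representation

/-! ### The solution as a convolution of the resolvent with the noise -/

section Solution

variable {d : ℕ} {Ω : Type*} [MeasurableSpace Ω] {P : Measure Ω} [IsProbabilityMeasure P]
  {D G : Matrix (Fin d) (Fin d) ℝ} {γ Γ r φ : ℝ → Matrix (Fin d) (Fin d) ℝ}
  {F₀ W W' Z : ℝ → Ω → Fin d → ℝ}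

lemma IsDifferentialResolvent.measurable_extendZero (hr : IsDifferentialResolvent D γ r)
    (i j : Fin d) : Measurable fun t => extendZero r t i j := by
  classical
  have h : (fun t => extendZero r t i j) = (Ici (0 : ℝ)).piecewise (fun t => r t i j) 0 := by
    ext t
    by_cases ht : t ∈ Ici (0 : ℝ) <;> simp [extendZero, ht]
  rw [h]
  refine ContinuousOn.measurable_piecewise ?_ continuousOn_const measurableSet_Ici
  exact fun t ht => (hr.deriv t ht i j).continuousWithinAt

lemma isL2_extendZero (hR : IsExtendedResolvent (matOp D) (fun t => matOp (Γ t)) (extOp r)) :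
    IsL2 (extendZero r) := by
  intro i j
  have hi : Integrable fun t => extendZero r t i j := by
    simpa only [extOp, entry_matOp] using integrable_entry hR.integrable i j
  obtain ⟨C, hC⟩ := hR.bounded
  refine (memLp_two_iff_integrable_sq hi.1).2 ?_
  simp only [pow_two]
  refine hi.bdd_mul (c := ‖entry (d := d) i j‖ * C) hi.1 (ae_of_all _ fun t => ?_)
  have := (entry i j).le_opNorm (extOp r t)
  rw [extOp, entry_matOp] at this
  exact this.trans (mul_le_mul_of_nonneg_left (hC t) (norm_nonneg _))

lemma IsL2.mul_const {ψ : ℝ → Matrix (Fin d) (Fin d) ℝ} (h : IsL2 ψ)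
    (M : Matrix (Fin d) (Fin d) ℝ) : IsL2 fun u => ψ u * M := fun i j => by
  simp only [Matrix.mul_apply]
  exact memLp_finsetSum _ fun k _ => (h i k).mul_const (M k j)

/-- The convolution of the resolvent with both parts of the noise. The white noise part `Z` is a
measurable version of `t ↦ ∫ r(t - u) G dW(u)`. -/
noncomputable def resolventProcess (r : ℝ → Matrix (Fin d) (Fin d) ℝ)
    (F₀ Z : ℝ → Ω → Fin d → ℝ) (t : ℝ) (ω : Ω) : Fin d → ℝ :=
  Z t ω + kernelConv (extendZero r) F₀ t ω

section

variable (hR : IsExtendedResolvent (matOp D) (fun t => matOp (Γ t)) (extOp r))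
  (hr : IsDifferentialResolvent D γ r) (hF : IsBoundedProcess F₀ P)
  (hZb : IsBoundedProcess Z P) {hW : IsTwoSidedBrownian W P}
  (hZ : ∀ t, IsRepresented hW (fun u => extendZero r (t - u) * G) (Z t))
include hR

lemma integrable_entry_extendZero (i j : Fin d) : Integrable fun t => extendZero r t i j := by
  simpa only [extOp, entry_matOp] using integrable_entry hR.integrable i j

include hr hF

lemma isBoundedProcess_kernelConv_extendZero :
    IsBoundedProcess (kernelConv (extendZero r) F₀) P :=
  hF.kernelConv hr.measurable_extendZero (integrable_entry_extendZero hR)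

include hZb

lemma isBoundedProcess_resolventProcess : IsBoundedProcess (resolventProcess r F₀ Z) P :=
  hZb.add (isBoundedProcess_kernelConv_extendZero hR hr hF)

/-- The noise tested against a square integrable random vector. -/
noncomputable def noiseDensity (P : Measure Ω) [IsProbabilityMeasure P]
    {W : ℝ → Ω → Fin d → ℝ} (hW : IsTwoSidedBrownian W P)
    (G : Matrix (Fin d) (Fin d) ℝ) (F₀ : ℝ → Ω → Fin d → ℝ) {ξ : Ω → Fin d → ℝ} (hξ : IsL2Vec ξ P)
    (s : ℝ) : Op d :=
  matOp G * matOp (whiteDensity hW hξ s) + corr P (F₀ s) ξ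

omit hR hr hZb in
lemma isL1AddLinf_noiseDensity (hW : IsTwoSidedBrownian W P) {ξ : Ω → Fin d → ℝ}
    (hξ : IsL2Vec ξ P) : IsL1AddLinf (noiseDensity P hW G F₀ hξ) := by
  have h1 : MemLp (fun s => matOp (G * whiteDensity hW hξ s)) 2 volume :=
    memLp_matOp fun i j => by
      simp only [Matrix.mul_apply]
      exact memLp_finsetSum _ fun k _ => (isL2_whiteDensity hW hξ k j).const_mul (G i k)
  simp only [matOp_mul] at h1
  exact (IsL1AddLinf.of_memLp_two h1).add
    (IsL1AddLinf.of_bounded (hF.aestronglyMeasurable_corr hξ) (hF.bounded_corr hξ))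

include hZ

lemma corr_resolventProcess {ξ : Ω → Fin d → ℝ} (hξ : IsL2Vec ξ P) (t : ℝ) :
    corr P (resolventProcess r F₀ Z t) ξ = conv (extOp r) (noiseDensity P hW G F₀ hξ) t := by
  have hU := isBoundedProcess_kernelConv_extendZero hR hr hF
  have e : corr P (resolventProcess r F₀ Z t) ξ =
      corr P (Z t) ξ + corr P (kernelConv (extendZero r) F₀ t) ξ :=
    corr_add_left (hZb.isL2Vec t) (hU.isL2Vec t) hξ
  have h2 : Integrable fun s => extOp r (t - s) * corr P (F₀ s) ξ := by
    obtain ⟨C, hC⟩ := hF.bounded_corr hξ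
    exact integrable_mul_of_bounded hR.integrable (hF.aestronglyMeasurable_corr hξ) hC t
  have h1 : Integrable fun s => extOp r (t - s) * (matOp G * matOp (whiteDensity hW hξ s)) := by
    have := integrable_mul_whiteDensity hW hξ (hZ t).isL2
    simpa only [matOp_mul, mul_assoc, extOp] using this
  rw [e, (hZ t).corr_eq_whiteDensity hξ, hF.corr_kernelConv (integrable_entry_extendZero hR) hξ]
  simp only [conv, noiseDensity, mul_add]
  rw [integral_add h1 h2]
  simp only [extOp, matOp_mul, mul_assoc]

lemma resolventProcess_equation (hΓ : IsExtendedKernel γ Γ) {t₁ t₂ : ℝ} (h12 : t₁ ≤ t₂) :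
    ∀ᵐ ω ∂P, resolventProcess r F₀ Z t₂ ω - resolventProcess r F₀ Z t₁ ω =
      (fun i => ∫ t in t₁..t₂, driftProcess D Γ F₀ (resolventProcess r F₀ Z) t ω i) +
        G *ᵥ (W t₂ ω - W t₁ ω) := by
  set V := resolventProcess r F₀ Z with hVdef
  have hV : IsBoundedProcess V P := isBoundedProcess_resolventProcess hR hr hF hZb
  have hd := isBoundedProcess_driftProcess (D := D) hΓ hV hF
  have hI := hd.isL2Vec_intervalIntegral h12
  have hΔ : IsL2Vec (fun ω => W t₂ ω - W t₁ ω) P := fun i => hW.memLp_sub t₁ t₂ i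
  have hGΔ := hΔ.mulVec G
  have hΔV := (hV.isL2Vec t₂).sub (hV.isL2Vec t₁)
  have hX := hΔV.sub (hI.add hGΔ)
  have key : ∀ ξ, IsL2Vec ξ P → corr P (fun ω => (V t₂ ω - V t₁ ω) -
      ((fun i => ∫ t in t₁..t₂, driftProcess D Γ F₀ V t ω i) + G *ᵥ (W t₂ ω - W t₁ ω))) ξ = 0 := by
    intro ξ hξ
    rw [corr_sub_left hΔV (hI.add hGΔ) hξ, corr_sub_left (hV.isL2Vec t₂) (hV.isL2Vec t₁) hξ,
      corr_add_left hI hGΔ hξ, corr_mulVec_left hΔ hξ, corr_increment hW hξ h12,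
      hd.corr_intervalIntegral hξ h12]
    have hv : (fun s => corr P (V s) ξ) = conv (extOp r) (noiseDensity P hW G F₀ hξ) :=
      funext fun s => corr_resolventProcess hR hr hF hZb hZ hξ s
    have hsol := hR.conv_solves (isL1AddLinf_noiseDensity (G := G) hF hW hξ) h12
    rw [← hv] at hsol
    rw [hsol]
    have iF : IntegrableOn (fun t => corr P (driftProcess D Γ F₀ V t) ξ) (Ioc t₁ t₂) := by
      obtain ⟨C, hC⟩ := hd.bounded_corr hξ
      exact Measure.integrableOn_of_bounded measure_Ioc_lt_top.ne
        (hd.aestronglyMeasurable_corr hξ) (ae_of_all _ hC)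
    have iw : IntegrableOn (fun t => matOp G * matOp (whiteDensity hW hξ t)) (Ioc t₁ t₂) := by
      have h0 : IntegrableOn (fun t => matOp (whiteDensity hW hξ t)) (Ioc t₁ t₂) :=
        integrable_matOp fun i j => ((isL2_whiteDensity hW hξ i j).locallyIntegrable
          (by norm_num)).integrableOn_isCompact isCompact_Icc |>.mono_set Ioc_subset_Icc_self
      exact h0.const_mul _
    rw [← integral_const_mul_of_integrable, ← integral_add iF iw, sub_eq_zero]
    · refine integral_congr_ae (ae_of_all _ fun t => ?_)
      simp only [noiseDensity, corr_driftProcess hΓ hV hF hξ]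
      abel
    · exact integrable_matOp fun i j => ((isL2_whiteDensity hW hξ i j).locallyIntegrable
          (by norm_num)).integrableOn_isCompact isCompact_Icc |>.mono_set Ioc_subset_Icc_self
  filter_upwards [ae_eq_zero_of_corr_self hX (key _ hX)] with ω hω
  exact sub_eq_zero.1 hω

end

end Solution

/-! ### A version satisfying the equation simultaneously for all times -/

section Version

variable {d : ℕ} {Ω : Type*} [MeasurableSpace Ω] {P : Measure Ω} [IsProbabilityMeasure P]
  {D G : Matrix (Fin d) (Fin d) ℝ} {γ Γ : ℝ → Matrix (Fin d) (Fin d) ℝ}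
  {F₀ W V : ℝ → Ω → Fin d → ℝ}

lemma IsTwoSidedBrownian.exists_measurable_version (hW : IsTwoSidedBrownian W P) :
    ∃ B : ℝ → Ω → Fin d → ℝ, Measurable (Function.uncurry B) ∧ ∀ᵐ ω ∂P, ∀ t, B t ω = W t ω := by
  classical
  obtain ⟨N, hN, hNm, hN0⟩ := exists_measurable_superset_of_null (ae_iff.1 hW.continuous_paths)
  have hc : ∀ ω, ω ∉ N → Continuous fun t => W t ω := fun ω hω => by
    by_contra h
    exact hω (hN h)
  refine ⟨fun t => indicator Nᶜ (W t), ?_, ?_⟩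
  · refine measurable_uncurry_of_continuous_of_measurable (fun ω => ?_)
      fun t => (hW.measurable t).indicator hNm.compl
    by_cases hω : ω ∈ N
    · simpa [hω] using continuous_const
    · simpa [hω] using hc ω hω
  · filter_upwards [measure_eq_zero_iff_ae_notMem.1 hN0] with ω hω t
    exact indicator_of_mem (by exact hω) _

lemma measurable_intervalIntegral {X : ℝ → Ω → ℝ} (hX : Measurable (Function.uncurry X)) (a : ℝ) :
    Measurable (Function.uncurry fun t ω => ∫ s in a..t, X s ω) := by
  have hX' : Measurable fun q : (ℝ × Ω) × ℝ => X q.2 q.1.2 :=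
    hX.comp (by fun_prop : Measurable fun q : (ℝ × Ω) × ℝ => (q.2, q.1.2))
  have h1 : Measurable fun p : ℝ × Ω => ∫ s in Ioc a p.1, X s p.2 := by
    have hs : MeasurableSet ({q : (ℝ × Ω) × ℝ | a < q.2} ∩ {q : (ℝ × Ω) × ℝ | q.2 ≤ q.1.1}) :=
      (measurableSet_lt (by fun_prop) (by fun_prop)).inter
        (measurableSet_le (by fun_prop) (by fun_prop))
    simp only [← integral_indicator measurableSet_Ioc]
    exact ((hX'.indicator hs).stronglyMeasurable.integral_prod_right'
      (ν := (volume : Measure ℝ))).measurable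
  have h2 : Measurable fun p : ℝ × Ω => ∫ s in Ioc p.1 a, X s p.2 := by
    have hs : MeasurableSet ({q : (ℝ × Ω) × ℝ | q.1.1 < q.2} ∩ {q : (ℝ × Ω) × ℝ | q.2 ≤ a}) :=
      (measurableSet_lt (by fun_prop) (by fun_prop)).inter
        (measurableSet_le (by fun_prop) (by fun_prop))
    simp only [← integral_indicator measurableSet_Ioc]
    exact ((hX'.indicator hs).stronglyMeasurable.integral_prod_right'
      (ν := (volume : Measure ℝ))).measurable
  exact h1.sub h2

/-- A bounded process satisfying the integrated equation for each pair of times has a version that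
is a strong solution and satisfies the equation for all pairs of times simultaneously: it is
obtained by integrating the drift along the paths. -/
lemma exists_version (hΓ : IsExtendedKernel γ Γ) (hV : IsBoundedProcess V P)
    (hF : IsBoundedProcess F₀ P) (hW : IsTwoSidedBrownian W P)
    (heq : ∀ t₁ t₂, t₁ ≤ t₂ → ∀ᵐ ω ∂P, V t₂ ω - V t₁ ω =
      (fun i => ∫ t in t₁..t₂, driftProcess D Γ F₀ V t ω i) + G *ᵥ (W t₂ ω - W t₁ ω)) :
    ∃ U : ℝ → Ω → Fin d → ℝ, (∀ t, U t =ᵐ[P] V t) ∧ IsBoundedProcess U P ∧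
      IsStrongSolution D G γ F₀ W P U ∧
      ∀ᵐ ω ∂P, ∀ t₁ t₂, t₁ ≤ t₂ → IntegratedEquation D G γ F₀ W U t₁ t₂ ω := by
  obtain ⟨B, hBm, hB⟩ := hW.exists_measurable_version
  have hd := isBoundedProcess_driftProcess (D := D) hΓ hV hF
  let U : ℝ → Ω → Fin d → ℝ := fun t ω =>
    V 0 ω + (fun i => ∫ s in (0 : ℝ)..t, driftProcess D Γ F₀ V s ω i) + G *ᵥ (B t ω - B 0 ω)
  have hUm : Measurable (Function.uncurry U) := by
    have m1 : Measurable fun p : ℝ × Ω => V 0 p.2 :=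
      hV.measurable.comp (by fun_prop : Measurable fun p : ℝ × Ω => ((0 : ℝ), p.2))
    have m2 : Measurable fun p : ℝ × Ω => fun i =>
        ∫ s in (0 : ℝ)..p.1, driftProcess D Γ F₀ V s p.2 i :=
      measurable_pi_iff.2 fun i => measurable_intervalIntegral (hd i).measurable 0
    have m3 : Measurable fun p : ℝ × Ω => G *ᵥ (B p.1 p.2 - B 0 p.2) := by
      have : Measurable fun p : ℝ × Ω => B p.1 p.2 - B 0 p.2 :=
        hBm.sub (hBm.comp (by fun_prop : Measurable fun p : ℝ × Ω => ((0 : ℝ), p.2)))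
      simp only [← matOp_apply]
      exact (matOp G).continuous.measurable.comp this
    exact (m1.add m2).add m3
  have hUV : ∀ t, U t =ᵐ[P] V t := by
    intro t
    rcases le_total 0 t with ht | ht
    · filter_upwards [heq 0 t ht, hB] with ω h1 h2
      simp only [U, h2]
      rw [add_assoc, ← h1]
      abel
    · filter_upwards [heq t 0 ht, hB] with ω h1 h2
      have e : (fun i => ∫ s in (0 : ℝ)..t, driftProcess D Γ F₀ V s ω i) =
          -fun i => ∫ s in t..(0 : ℝ), driftProcess D Γ F₀ V s ω i := by
        funext i
        exact intervalIntegral.integral_symm _ _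
      simp only [U, h2]
      rw [e, ← neg_sub (W 0 ω), Matrix.mulVec_neg, add_assoc, ← neg_add, ← h1]
      abel
  have hUb : IsBoundedProcess U P := by
    refine fun i => ⟨(measurable_pi_apply i).comp hUm, fun t => ?_, ?_⟩
    · refine (memLp_congr_ae ?_).1 ((hV i).memLp t)
      filter_upwards [hUV t] with ω hω
      rw [hω]
    · obtain ⟨C, hC⟩ := (hV i).bound
      refine ⟨C, fun t => le_trans (le_of_eq (integral_congr_ae ?_)) (hC t)⟩
      filter_upwards [hUV t] with ω hω
      rw [hω]
  -- along almost every path both versions agree at almost all times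
  have hpath : ∀ᵐ ω ∂P, ∀ᵐ t : ℝ, U t ω = V t ω :=
    (Measure.ae_ae_comm (μ := (volume : Measure ℝ)) (ν := P) (p := fun t ω => U t ω = V t ω)
      (measurableSet_eq_fun hUm hV.measurable)).1 (ae_of_all _ hUV)
  have hdrift : ∀ᵐ ω ∂P, ∀ t₁ t₂, (fun i => ∫ t in t₁..t₂, driftProcess D Γ F₀ V t ω i) =
      fun i => ∫ t in t₁..t₂, driftProcess D Γ F₀ U t ω i := by
    filter_upwards [hpath] with ω hω t₁ t₂
    funext i
    refine intervalIntegral.integral_congr_ae ?_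
    filter_upwards [hω] with t ht _
    have : kernelConv Γ V t ω = kernelConv Γ U t ω := by
      funext i
      refine Finset.sum_congr rfl fun j _ => integral_congr_ae ?_
      filter_upwards [hω] with s hs
      rw [hs]
    rw [driftProcess, driftProcess, this, ht]
  have hall : ∀ᵐ ω ∂P, ∀ t₁ t₂, t₁ ≤ t₂ → IntegratedEquation D G γ F₀ W U t₁ t₂ ω := by
    filter_upwards [hdrift, hB, hd.ae_intervalIntegrable, ae_drift (D := D) hΓ hUb hF]
      with ω h1 h2 h3 h4 t₁ t₂ _
    rw [IntegratedEquation, (h4 t₁ t₂).2, ← h1]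
    have e : (fun i => ∫ t in t₁..t₂, driftProcess D Γ F₀ V t ω i) =
        (fun i => ∫ t in (0 : ℝ)..t₂, driftProcess D Γ F₀ V t ω i) -
          fun i => ∫ t in (0 : ℝ)..t₁, driftProcess D Γ F₀ V t ω i := by
      funext i
      simp only [Pi.sub_apply, ← intervalIntegral_eval (h3 _ _)]
      rw [← intervalIntegral.integral_interval_sub_left (h3 0 t₂) (h3 0 t₁), Pi.sub_apply]
    simp only [U, h2]
    rw [e]
    simp only [Matrix.mulVec_sub]
    abel
  refine ⟨U, hUV, hUb, ⟨hUm, ?_, ?_, ?_⟩, hall⟩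
  · filter_upwards [hΓ.ae_memory (D := D) (F₀ := F₀) hUb] with ω hω
    filter_upwards [hω] with t ht using ht.1
  · filter_upwards [ae_drift (D := D) hΓ hUb hF] with ω hω t₁ t₂ using (hω t₁ t₂).1
  · intro t₁ t₂ h12
    filter_upwards [hall] with ω hω using hω t₁ t₂ h12

end Version

/-! ### Gaussian laws and stationarity -/

section GaussianVectors

variable {d : ℕ} {Ω : Type*} [MeasurableSpace Ω] {P : Measure Ω} [IsProbabilityMeasure P]

/-- The coordinates of the random vector `X` belong to the subspace `S` of `L²(P)`. -/
structure HasCoordsIn (S : Submodule ℝ (Lp ℝ 2 P)) (X : Ω → Fin d → ℝ) : Prop where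
  isL2Vec : IsL2Vec X P
  mem : ∀ i, (isL2Vec i).toLp (fun ω => X ω i) ∈ S

lemma HasCoordsIn.add {S : Submodule ℝ (Lp ℝ 2 P)} {X Y : Ω → Fin d → ℝ} (hX : HasCoordsIn S X)
    (hY : HasCoordsIn S Y) : HasCoordsIn S fun ω => X ω + Y ω :=
  ⟨hX.isL2Vec.add hY.isL2Vec, fun i => S.add_mem (hX.mem i) (hY.mem i)⟩

lemma HasCoordsIn.congr {S : Submodule ℝ (Lp ℝ 2 P)} {X Y : Ω → Fin d → ℝ} (hX : HasCoordsIn S X)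
    (h : X =ᵐ[P] Y) : HasCoordsIn S Y := by
  have h' : ∀ i, (fun ω => X ω i) =ᵐ[P] fun ω => Y ω i := fun i => by
    filter_upwards [h] with ω hω
    rw [hω]
  refine ⟨fun i => (memLp_congr_ae (h' i)).1 (hX.isL2Vec i), fun i => ?_⟩
  rw [← MemLp.toLp_congr (hX.isL2Vec i) _ (h' i)]
  exact hX.mem i

/-- The subspace `S` consists of centered Gaussian variables. -/
def IsGaussianSubspace (S : Submodule ℝ (Lp ℝ 2 P)) : Prop :=
  ∀ x ∈ S, P.map x = gaussianReal 0 (‖x‖₊ ^ 2)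

variable {S : Submodule ℝ (Lp ℝ 2 P)}

lemma HasCoordsIn.integral_eq_zero (hS : IsGaussianSubspace S) {X : Ω → Fin d → ℝ}
    (hX : HasCoordsIn S X) (i : Fin d) : ∫ ω, X ω i ∂P = 0 := by
  have h := hS _ (hX.mem i)
  rw [map_toLp] at h
  have : ∫ x, x ∂(P.map fun ω => X ω i) = ∫ ω, X ω i ∂P :=
    integral_map (hX.isL2Vec i).1.aemeasurable (Measurable.aestronglyMeasurable (by fun_prop))
  rw [← this, h]
  exact integral_id_gaussianReal

/-- A linear functional of a finite family of random vectors with coordinates in a Gaussian space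
is a centered Gaussian variable, whose variance is determined by the correlations. -/
lemma map_dual_eq_gaussianReal (hS : IsGaussianSubspace S) {ι : Type*} [Fintype ι]
    {X : ι → Ω → Fin d → ℝ} (hX : ∀ a, HasCoordsIn S (X a)) (L : StrongDual ℝ (ι → Fin d → ℝ)) :
    ∃ c : ι → Fin d → ℝ, (∀ x, L x = ∑ a, ∑ i, c a i * x a i) ∧
      P.map (fun ω => L fun a => X a ω) = gaussianReal 0 (Real.toNNReal
        (∑ a, ∑ b, ∑ i, ∑ j, c a i * c b j * entry i j (corr P (X a) (X b)))) := by
  classical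
  let c : ι → Fin d → ℝ := fun a i => L (Pi.single a (Pi.single i 1))
  have hL : ∀ x, L x = ∑ a, ∑ i, c a i * x a i := by
    intro x
    have e : x = ∑ a, ∑ i, x a i • (Pi.single a (Pi.single i 1) : ι → Fin d → ℝ) := by
      funext b j
      simp only [Finset.sum_apply, Pi.smul_apply, smul_eq_mul]
      rw [Finset.sum_eq_single b, Finset.sum_eq_single j]
      · simp
      · intro i _ hij
        simp [hij.symm]
      · simp
      · intro a _ hab
        simp [hab.symm]
      · simp
    conv_lhs => rw [e]
    simp only [map_sum, map_smul, smul_eq_mul, c, mul_comm]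
  refine ⟨c, hL, ?_⟩
  let x : Lp ℝ 2 P := ∑ a, ∑ i, c a i • ((hX a).isL2Vec i).toLp (fun ω => X a ω i)
  have hx : x ∈ S := S.sum_mem fun a _ => S.sum_mem fun i _ => S.smul_mem _ ((hX a).mem i)
  have hxe : x =ᵐ[P] fun ω => L fun a => X a ω := by
    have h1 := Lp.coeFn_finsetSum Finset.univ fun a =>
      ∑ i, c a i • ((hX a).isL2Vec i).toLp (fun ω => X a ω i)
    have h2 := fun a => Lp.coeFn_finsetSum Finset.univ fun i =>
      c a i • ((hX a).isL2Vec i).toLp (fun ω => X a ω i)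
    have h3 := fun a i => Lp.coeFn_smul (c a i) (((hX a).isL2Vec i).toLp (fun ω => X a ω i))
    have h4 := fun a i => ((hX a).isL2Vec i).coeFn_toLp
    filter_upwards [h1, ae_all_iff.2 h2, ae_all_iff.2 fun a => ae_all_iff.2 (h3 a),
      ae_all_iff.2 fun a => ae_all_iff.2 (h4 a)] with ω a1 a2 a3 a4
    rw [a1, hL, Finset.sum_apply]
    refine Finset.sum_congr rfl fun a _ => ?_
    rw [a2, Finset.sum_apply]
    refine Finset.sum_congr rfl fun i _ => ?_
    rw [a3, Pi.smul_apply, a4, smul_eq_mul]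
  rw [← Measure.map_congr hxe, hS x hx]
  congr 1
  have hn : ‖x‖ ^ 2 = ∑ a, ∑ b, ∑ i, ∑ j, c a i * c b j * entry i j (corr P (X a) (X b)) := by
    rw [← real_inner_self_eq_norm_sq]
    conv_lhs => simp only [x, sum_inner]
    refine Finset.sum_congr rfl fun a _ => ?_
    conv_rhs => rw [Finset.sum_comm]
    refine Finset.sum_congr rfl fun i _ => ?_
    simp only [inner_sum]
    refine Finset.sum_congr rfl fun b _ => Finset.sum_congr rfl fun j _ => ?_
    rw [inner_smul_left, inner_smul_right, inner_toLp, entry_corr, RCLike.conj_to_real]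
    ring
  rw [← hn, Real.toNNReal_pow (norm_nonneg _), norm_toNNReal]

lemma isGaussianProcess_of_hasCoordsIn (hS : IsGaussianSubspace S) {T : Type*}
    {V : T → Ω → Fin d → ℝ} (hV : ∀ t, HasCoordsIn S (V t)) : IsGaussianProcess V P := by
  have hm : ∀ t, AEMeasurable (V t) P := fun t =>
    aemeasurable_pi_iff.2 fun i => ((hV t).isL2Vec i).1.aemeasurable
  refine ⟨fun I => ⟨?_⟩⟩
  have hmI : AEMeasurable (fun ω => I.restrict (V · ω)) P :=
    aemeasurable_pi_iff.2 fun t => hm t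
  refine isGaussian_of_map_eq_gaussianReal fun L => ?_
  obtain ⟨c, -, h⟩ := map_dual_eq_gaussianReal hS (X := fun (t : I) => V t) (fun t => hV t) L
  rw [AEMeasurable.map_map_of_aemeasurable (by fun_prop) hmI]
  exact ⟨_, _, h⟩

lemma isStationary_of_corr (hS : IsGaussianSubspace S) {V : ℝ → Ω → Fin d → ℝ}
    (hV : ∀ t, HasCoordsIn S (V t))
    (h : ∀ s t u, corr P (V (s + u)) (V (t + u)) = corr P (V s) (V t)) : IsStationary V P := by
  intro I u
  have hm : ∀ t, AEMeasurable (V t) P := fun t =>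
    aemeasurable_pi_iff.2 fun i => ((hV t).isL2Vec i).1.aemeasurable
  have m1 : AEMeasurable (fun ω (t : I) => V ((t : ℝ) + u) ω) P :=
    aemeasurable_pi_iff.2 fun t => hm _
  have m2 : AEMeasurable (fun ω (t : I) => V (t : ℝ) ω) P :=
    aemeasurable_pi_iff.2 fun t => hm _
  refine ⟨m1, m2, ?_⟩
  have := Measure.isProbabilityMeasure_map m1
  have := Measure.isProbabilityMeasure_map m2
  refine Measure.ext_of_charFunDual (funext fun L => ?_)
  rw [charFunDual_eq_charFun_map_one, charFunDual_eq_charFun_map_one,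
    AEMeasurable.map_map_of_aemeasurable (by fun_prop) m1,
    AEMeasurable.map_map_of_aemeasurable (by fun_prop) m2]
  obtain ⟨c, hc, h1⟩ := map_dual_eq_gaussianReal hS (X := fun (t : I) => V ((t : ℝ) + u))
    (fun t => hV _) L
  obtain ⟨c', hc', h2⟩ := map_dual_eq_gaussianReal hS (X := fun (t : I) => V (t : ℝ))
    (fun t => hV _) L
  have hcc : c = c' := by
    classical
    funext a i
    have e := (hc (Pi.single a (Pi.single i 1))).symm.trans (hc' _)
    have h0 : ∀ c : I → Fin d → ℝ,
        ∑ b, ∑ j, c b j * (Pi.single a (Pi.single i 1) : I → Fin d → ℝ) b j = c a i := by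
      intro c
      rw [Finset.sum_eq_single a, Finset.sum_eq_single i]
      · simp
      · intro j _ hij
        simp [hij]
      · simp
      · intro b _ hab
        simp [hab]
      · simp
    rwa [h0, h0] at e
  have e1 : P.map (L ∘ fun ω (t : I) => V ((t : ℝ) + u) ω) =
      P.map (L ∘ fun ω (t : I) => V (t : ℝ) ω) := by
    refine h1.trans (Eq.trans ?_ h2.symm)
    rw [hcc]
    simp only [h]
  rw [e1]

end GaussianVectors

section NoiseMembership

variable {d : ℕ} {Ω : Type*} [MeasurableSpace Ω] {P : Measure Ω} [IsProbabilityMeasure P]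
  {W W' : ℝ → Ω → Fin d → ℝ}

lemma IsRepresented.hasCoordsIn_left {hW : IsTwoSidedBrownian W P} (hW' : IsTwoSidedBrownian W' P)
    {Ψ : ℝ → Matrix (Fin d) (Fin d) ℝ} {X : Ω → Fin d → ℝ} (h : IsRepresented hW Ψ X) :
    HasCoordsIn (noiseSpace hW hW') X :=
  ⟨h.isL2Vec, fun i => by
    rw [h.eq]
    exact Submodule.sum_mem _ fun j _ => wienerMap_mem_noiseSpace_left hW hW' j _⟩

lemma IsRepresented.hasCoordsIn_right (hW : IsTwoSidedBrownian W P) {hW' : IsTwoSidedBrownian W' P}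
    {Ψ : ℝ → Matrix (Fin d) (Fin d) ℝ} {X : Ω → Fin d → ℝ} (h : IsRepresented hW' Ψ X) :
    HasCoordsIn (noiseSpace hW hW') X :=
  ⟨h.isL2Vec, fun i => by
    rw [h.eq]
    exact Submodule.sum_mem _ fun j _ => wienerMap_mem_noiseSpace_right hW hW' j _⟩

/-- A closed subspace is stable under convolution of processes with integrable kernels, as can be
tested against its orthogonal complement. -/
lemma HasCoordsIn.kernelConv {S : Submodule ℝ (Lp ℝ 2 P)} (hS : IsClosed (S : Set (Lp ℝ 2 P)))
    {X : ℝ → Ω → Fin d → ℝ} (hX : IsBoundedProcess X P) (h : ∀ t, HasCoordsIn S (X t))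
    {A : ℝ → Matrix (Fin d) (Fin d) ℝ} (hA : ∀ i j, Measurable fun t => A t i j)
    (hA1 : ∀ i j, Integrable fun t => A t i j) (t : ℝ) : HasCoordsIn S (kernelConv A X t) := by
  have hK := (hX.kernelConv hA hA1).isL2Vec t
  refine ⟨hK, fun i => ?_⟩
  have hcl : Sᗮᗮ = S := by
    rw [Submodule.orthogonal_orthogonal_eq_closure, hS.submodule_topologicalClosure_eq]
  rw [← hcl, Submodule.mem_orthogonal']
  intro η hη
  have hξ : IsL2Vec (fun ω (_ : Fin d) => η ω) P := fun _ => Lp.memLp η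
  have h1 := congrArg (entry i i) (hX.corr_kernelConv hA1 hξ t)
  have h0 : ∀ s, corr P (X s) (fun ω (_ : Fin d) => η ω) = 0 := by
    intro s
    refine op_ext fun k l => ?_
    have := (Submodule.mem_orthogonal _ _).1 hη _ ((h s).mem k)
    rw [← Lp.toLp_coeFn η (Lp.memLp η), inner_toLp] at this
    rw [entry_corr, this, map_zero]
  have h2 := inner_toLp (hK i) (Lp.memLp η)
  rw [Lp.toLp_coeFn] at h2
  rw [h2]
  rw [entry_corr] at h1
  rw [h1]
  simp [conv, h0]

end NoiseMembership

/-! ### The autocorrelation function -/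

section Covariance

variable {d : ℕ} {Ω : Type*} [MeasurableSpace Ω] {P : Measure Ω} [IsProbabilityMeasure P]
  {D G : Matrix (Fin d) (Fin d) ℝ} {γ Γ r φ : ℝ → Matrix (Fin d) (Fin d) ℝ}
  {F₀ W W' Z : ℝ → Ω → Fin d → ℝ}

lemma corr_coloredNoise {hW' : IsTwoSidedBrownian W' P} (hφ : IsL2 φ)
    (hF : ∀ t, IsRepresented hW' (fun s => φ (t - s)) (F₀ t)) (a b : ℝ) :
    corr P (F₀ a) (F₀ b) = matOp (convReversal φ (a - b)) := by
  rw [(hF a).corr_eq (hF b), ← integral_add_right_eq_self _ b]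
  have hi := integrable_mul_trOp (hF (a - b)).isL2 (hF 0).isL2
  refine op_ext fun i j => ?_
  simp only [sub_add_eq_sub_sub_swap, sub_self]
  rw [entry_integral hi, entry_matOp, convReversal_apply hφ]
  simp only [entry_mul, entry_trOp, entry_matOp, zero_sub]
  rw [integral_finsetSum _ fun k _ => integrable_mul_reversal hφ (a - b) i k j]

lemma isL1AddLinf_mul_transpose (hφ : IsL2 φ) (G : Matrix (Fin d) (Fin d) ℝ) :
    IsL1AddLinf fun u => matOp (φ u * Gᵀ) :=
  .of_memLp_two <| memLp_matOp fun i j => hφ.mul_const Gᵀ i j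

lemma isL1AddLinf_mul_transpose_reversal (hφ : IsL2 φ) (G : Matrix (Fin d) (Fin d) ℝ) :
    IsL1AddLinf fun u => matOp (G * (φ (-u))ᵀ) :=
  .of_memLp_two <| memLp_matOp fun i j => by
    simp only [Matrix.mul_apply, Matrix.transpose_apply]
    exact memLp_finsetSum _ fun k _ => (memLp_comp_neg hφ j k).const_mul _

section

variable (hR : IsExtendedResolvent (matOp D) (fun t => matOp (Γ t)) (extOp r))
include hR

lemma matOp_doubleTerm_chi (hφ : IsL2 φ) (G : Matrix (Fin d) (Fin d) ℝ) (κ t : ℝ) :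
    matOp (doubleTerm r (chi φ G κ) t) =
      κ • (matOp (doubleTerm r (fun u => φ u * Gᵀ) t) +
        matOp (doubleTerm r (fun u => G * (φ (-u))ᵀ) t)) +
      matOp (doubleTerm r (convReversal φ) t) := by
  have h1 := isL1AddLinf_mul_transpose hφ G
  have h2 := isL1AddLinf_mul_transpose_reversal hφ G
  have h3 := isL1AddLinf_convReversal hφ
  have i1 := integrable_double hR h1 t
  have i2 := integrable_double hR h2 t
  have i3 := integrable_double hR h3 t
  have i0 := integrable_double hR (isL1AddLinf_chi hφ G κ) t
  rw [matOp_doubleTerm hR (isL1AddLinf_chi hφ G κ), matOp_doubleTerm hR h1,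
    matOp_doubleTerm hR h2, matOp_doubleTerm hR h3, integral_integral i0, integral_integral i1,
    integral_integral i2, integral_integral i3, ← integral_add i1 i2, ← integral_smul]
  have i12 : Integrable (fun p : ℝ × ℝ =>
      κ • (extOp r p.1 * matOp (φ (t + p.2 - p.1) * Gᵀ) * trOp (extOp r p.2) +
        extOp r p.1 * matOp (G * (φ (-(t + p.2 - p.1)))ᵀ) * trOp (extOp r p.2)))
      ((volume : Measure ℝ).prod volume) := (i1.add i2).smul κ
  rw [← integral_add i12 i3]
  refine integral_congr_ae (ae_of_all _ fun p => ?_)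
  simp only [chi, matOp_add, matOp_smul, mul_add, add_mul, mul_smul_comm, smul_mul_assoc, smul_add]

variable (hF : IsBoundedProcess F₀ P)
include hF

lemma corr_kernelConv_left {ξ : Ω → Fin d → ℝ} (hξ : IsL2Vec ξ P) (t : ℝ) :
    corr P (kernelConv (extendZero r) F₀ t) ξ = ∫ σ, extOp r σ * corr P (F₀ (t - σ)) ξ := by
  rw [hF.corr_kernelConv (integrable_entry_extendZero hR) hξ, conv,
    ← integral_sub_left_eq_self (fun σ => extOp r σ * corr P (F₀ (t - σ)) ξ) volume t]
  simp only [sub_sub_cancel]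
  rfl

lemma corr_kernelConv_right {ξ : Ω → Fin d → ℝ} (hξ : IsL2Vec ξ P) (t : ℝ) :
    Integrable (fun τ => corr P ξ (F₀ (t - τ)) * trOp (extOp r τ)) ∧
    corr P ξ (kernelConv (extendZero r) F₀ t) =
      ∫ τ, corr P ξ (F₀ (t - τ)) * trOp (extOp r τ) := by
  obtain ⟨C, hC⟩ := hF.bounded_corr hξ
  have hi : Integrable fun σ => extOp r σ * corr P (F₀ (t - σ)) ξ := by
    have h := integrable_mul_of_bounded hR.integrable (hF.aestronglyMeasurable_corr hξ) hC t
    have h' := h.comp_sub_left t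
    simpa only [sub_sub_cancel] using h'
  have he : ∀ σ, trOp (extOp r σ * corr P (F₀ (t - σ)) ξ) =
      corr P ξ (F₀ (t - σ)) * trOp (extOp r σ) := fun σ => by rw [trOp_mul, trOp_corr]
  constructor
  · simpa only [he] using trOp.integrable_comp hi
  · rw [← trOp_corr, corr_kernelConv_left hR hF hξ, ← trOp.integral_comp_comm hi]
    simp only [he]

variable (hr : IsDifferentialResolvent D γ r) {hW : IsTwoSidedBrownian W P}
  {hW' : IsTwoSidedBrownian W' P}

include hr in
lemma corr_kernelConv_kernelConv (hφ : IsL2 φ)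
    (hFr : ∀ t, IsRepresented hW' (fun s => φ (t - s)) (F₀ t)) (s t : ℝ) :
    corr P (kernelConv (extendZero r) F₀ (s + t)) (kernelConv (extendZero r) F₀ s) =
      matOp (doubleTerm r (convReversal φ) t) := by
  have hU := isBoundedProcess_kernelConv_extendZero hR hr hF
  rw [corr_kernelConv_left hR hF (hU.isL2Vec s),
    matOp_doubleTerm hR (isL1AddLinf_convReversal hφ)]
  refine integral_congr_ae (ae_of_all _ fun σ => ?_)
  obtain ⟨hi, he⟩ := corr_kernelConv_right hR hF (hF.isL2Vec (s + t - σ)) s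
  beta_reduce
  rw [he, ← integral_const_mul_of_integrable hi]
  refine integral_congr_ae (ae_of_all _ fun τ => ?_)
  beta_reduce
  rw [corr_coloredNoise hφ hFr, mul_assoc, show s + t - σ - (s - τ) = t + τ - σ by ring]

variable (hZ : ∀ t, IsRepresented hW (fun u => extendZero r (t - u) * G) (Z t))
include hZ

omit hF hr in
lemma corr_white_white (s : ℝ) {t : ℝ} (ht : 0 ≤ t) :
    corr P (Z (s + t)) (Z s) = matOp (singleTerm r (G * Gᵀ) t) := by
  rw [(hZ (s + t)).corr_eq (hZ s), matOp_singleTerm hR _ ht, ← integral_sub_left_eq_self _ volume s]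
  refine integral_congr_ae (ae_of_all _ fun τ => ?_)
  simp only [sub_sub_cancel, matOp_mul, trOp_mul, trOp_matOp, mul_assoc, extOp]
  rw [show s + t - (s - τ) = t + τ by ring]

omit hR hF hr in
/-- The correlation of the white noise part with the colored noise, together with the absolute
convergence of the integral. -/
lemma corr_white_colored {κ : ℝ} (hκ : IsCoupled W W' P κ)
    (hFr : ∀ t, IsRepresented hW' (fun s => φ (t - s)) (F₀ t)) (a b : ℝ) :
    Integrable (fun σ => extOp r σ * matOp (G * (φ (a - b + σ))ᵀ)) ∧
    corr P (Z b) (F₀ a) = κ • ∫ σ, extOp r σ * matOp (G * (φ (a - b + σ))ᵀ) := by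
  have he : ∀ σ, matOp (extendZero r (b - (b - σ)) * G) * trOp (matOp (φ (a - (b - σ)))) =
      extOp r σ * matOp (G * (φ (a - b + σ))ᵀ) := fun σ => by
    simp only [sub_sub_cancel, matOp_mul, trOp_matOp, mul_assoc, extOp]
    rw [show a - (b - σ) = a - b + σ by ring]
  constructor
  · have := (integrable_mul_trOp (hZ b).isL2 (hFr a).isL2).comp_sub_left b
    simpa only [he] using this
  · rw [(hZ b).corr_eq_cross hκ (hFr a), ← integral_sub_left_eq_self _ volume b]
    simp only [he]

lemma corr_kernelConv_white (hφ : IsL2 φ) {κ : ℝ} (hκ : IsCoupled W W' P κ)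
    (hFr : ∀ t, IsRepresented hW' (fun s => φ (t - s)) (F₀ t)) (s t : ℝ) :
    corr P (kernelConv (extendZero r) F₀ (s + t)) (Z s) =
      κ • matOp (doubleTerm r (fun u => φ u * Gᵀ) t) := by
  rw [corr_kernelConv_left hR hF (hZ s).isL2Vec,
    matOp_doubleTerm hR (isL1AddLinf_mul_transpose hφ G), ← integral_smul]
  refine integral_congr_ae (ae_of_all _ fun σ => ?_)
  obtain ⟨hi, he⟩ := corr_white_colored hZ hκ hFr (s + t - σ) s
  have hi' := trOp.integrable_comp hi
  beta_reduce
  rw [← trOp_corr, he, map_smul, ← trOp.integral_comp_comm hi, mul_smul_comm,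
    ← integral_const_mul_of_integrable hi']
  congr 1
  refine integral_congr_ae (ae_of_all _ fun τ => ?_)
  beta_reduce
  rw [trOp_mul, trOp_matOp, Matrix.transpose_mul, Matrix.transpose_transpose, mul_assoc,
    show s + t - σ - s + τ = t + τ - σ by ring]

lemma corr_white_kernelConv (hφ : IsL2 φ) {κ : ℝ} (hκ : IsCoupled W W' P κ)
    (hFr : ∀ t, IsRepresented hW' (fun s => φ (t - s)) (F₀ t)) (s t : ℝ) :
    corr P (Z (s + t)) (kernelConv (extendZero r) F₀ s) =
      κ • matOp (doubleTerm r (fun u => G * (φ (-u))ᵀ) t) := by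
  have hK := isL1AddLinf_mul_transpose_reversal hφ G
  rw [(corr_kernelConv_right hR hF (hZ (s + t)).isL2Vec s).2, matOp_doubleTerm hR hK,
    integral_integral_swap (integrable_double hR hK t), ← integral_smul]
  refine integral_congr_ae (ae_of_all _ fun τ => ?_)
  obtain ⟨hi, he⟩ := corr_white_colored hZ hκ hFr (s - τ) (s + t)
  beta_reduce
  rw [he, smul_mul_assoc, ← integral_mul_const_of_integrable hi]
  congr 1
  refine integral_congr_ae (ae_of_all _ fun σ => ?_)
  beta_reduce
  rw [show s - τ - (s + t) + σ = -(t + τ - σ) by ring]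

include hr in
/-- The autocorrelation of the solution, from the isometry property of the Wiener integral. -/
lemma correlation_resolventProcess (hZb : IsBoundedProcess Z P) (hφ : IsL2 φ) {κ : ℝ}
    (hκ : IsCoupled W W' P κ)
    (hFr : ∀ t, IsRepresented hW' (fun s => φ (t - s)) (F₀ t)) (s : ℝ) {t : ℝ} (ht : 0 ≤ t) :
    correlation (resolventProcess r F₀ Z) P (s + t) s =
      singleTerm r (G * Gᵀ) t + doubleTerm r (chi φ G κ) t := by
  have hU := isBoundedProcess_kernelConv_extendZero hR hr hF
  have hV := isBoundedProcess_resolventProcess hR hr hF hZb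
  refine matOp_injective ?_
  have e1 : corr P (resolventProcess r F₀ Z (s + t)) (resolventProcess r F₀ Z s) =
      corr P (Z (s + t)) (resolventProcess r F₀ Z s) +
        corr P (kernelConv (extendZero r) F₀ (s + t)) (resolventProcess r F₀ Z s) :=
    corr_add_left (hZb.isL2Vec _) (hU.isL2Vec _) (hV.isL2Vec s)
  have e2 : corr P (Z (s + t)) (resolventProcess r F₀ Z s) =
      corr P (Z (s + t)) (Z s) + corr P (Z (s + t)) (kernelConv (extendZero r) F₀ s) :=
    corr_add_right (hZb.isL2Vec s) (hU.isL2Vec s) (hZb.isL2Vec _)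
  have e3 : corr P (kernelConv (extendZero r) F₀ (s + t)) (resolventProcess r F₀ Z s) =
      corr P (kernelConv (extendZero r) F₀ (s + t)) (Z s) +
        corr P (kernelConv (extendZero r) F₀ (s + t)) (kernelConv (extendZero r) F₀ s) :=
    corr_add_right (hZb.isL2Vec s) (hU.isL2Vec s) (hU.isL2Vec _)
  rw [matOp_correlation, e1, e2, e3, corr_white_white hR hZ s ht,
    corr_white_kernelConv hR hF hZ hφ hκ hFr, corr_kernelConv_white hR hF hZ hφ hκ hFr,
    corr_kernelConv_kernelConv hR hF hr hφ hFr, matOp_add, matOp_doubleTerm_chi hR hφ G κ,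
    smul_add]
  abel

end
end Covariance

end GLE

open GLE in
theorem theorem4 {d : ℕ} {Ω : Type*} [MeasurableSpace Ω] (P : Measure Ω) [IsProbabilityMeasure P]
    (D G : Matrix (Fin d) (Fin d) ℝ) (γ r φ : ℝ → Matrix (Fin d) (Fin d) ℝ)
    (hγ : GLE.IsL1Pos γ) (hr : GLE.IsDifferentialResolvent D γ r) (hr1 : GLE.IsL1Pos r)
    (hφ : GLE.IsL2 φ)
    (W W' : ℝ → Ω → Fin d → ℝ)
    (hW : GLE.IsTwoSidedBrownian W P) (hW' : GLE.IsTwoSidedBrownian W' P)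
    (κ : ℝ)
    (hκ : (κ = 1 ∧ ∀ t, W' t =ᵐ[P] W t) ∨
      (κ = 0 ∧ IndepFun (fun ω t => W t ω) (fun ω t => W' t ω) P))
    (F₀ : ℝ → Ω → Fin d → ℝ) (hF₀ : GLE.IsColoredNoise φ W' P F₀) :
    ∃ V : ℝ → Ω → Fin d → ℝ,
      -- `V` is a bounded strong solution, also with one null set for all time intervals
      GLE.IsStrongSolution D G γ F₀ W P V ∧ GLE.IsMeanSquareBounded V P ∧
      (∀ᵐ ω ∂P, ∀ t₁ t₂, t₁ ≤ t₂ → GLE.IntegratedEquation D G γ F₀ W V t₁ t₂ ω) ∧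
      -- it is the only one
      (∀ V' : ℝ → Ω → Fin d → ℝ, GLE.IsStrongSolution D G γ F₀ W P V' →
        GLE.IsMeanSquareBounded V' P → ∀ t, V' t =ᵐ[P] V t) ∧
      -- it is a centered stationary Gaussian process
      IsGaussianProcess V P ∧ (∀ t i, ∫ ω, V t ω i ∂P = 0) ∧ GLE.IsStationary V P ∧
      -- its autocorrelation function
      (∀ t, 0 ≤ t →
        GLE.SingleTermConverges r (G * Gᵀ) t ∧ GLE.DoubleTermConverges r (GLE.chi φ G κ) t ∧
        ∀ s, GLE.correlation V P (s + t) s =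
          GLE.singleTerm r (G * Gᵀ) t + GLE.doubleTerm r (GLE.chi φ G κ) t) ∧
      -- the alternative representation
      (∀ S : Matrix (Fin d) (Fin d) ℝ, S.PosDef → ∀ t, 0 ≤ t →
        GLE.SingleTermConverges r (G * Gᵀ - D * S - S * Dᵀ) t ∧
        GLE.DoubleTermConverges r (fun u => GLE.chi φ G κ u - GLE.gammaSigma γ S u) t ∧
        ∀ s, GLE.correlation V P (s + t) s =
          r t * S + GLE.singleTerm r (G * Gᵀ - D * S - S * Dᵀ) t +
            GLE.doubleTerm r (fun u => GLE.chi φ G κ u - GLE.gammaSigma γ S u) t) := by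
  have hκ' : IsCoupled W W' P κ := hκ
  obtain ⟨Γ, hΓ⟩ := exists_isExtendedKernel hγ
  have hR : IsExtendedResolvent (matOp D) (fun t => matOp (Γ t)) (extOp r) :=
    hr.isExtendedResolvent hΓ hr1
  have hFr : ∀ t, IsRepresented hW' (fun s => φ (t - s)) (F₀ t) :=
    fun t => (hF₀.wiener t).isRepresented hW'
  have hF : IsBoundedProcess F₀ P := isBoundedProcess_of_isRepresented
    (fun i => (measurable_pi_apply i).comp hF₀.measurable) hFr
  obtain ⟨Z, hZm, hZ⟩ := exists_isRepresented hW ((isL2_extendZero hR).mul_const G)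
  have hZb : IsBoundedProcess Z P :=
    isBoundedProcess_of_isRepresented (ψ := fun u => extendZero r u * G) hZm hZ
  have hV₀ := isBoundedProcess_resolventProcess hR hr hF hZb
  obtain ⟨V, hVV, hVb, hVs, hVall⟩ := exists_version (D := D) (G := G) hΓ hV₀ hF hW
    fun t₁ t₂ h12 => resolventProcess_equation hR hr hF hZb hZ hΓ h12
  -- all coordinates of the solution belong to the Gaussian space of the noise
  have hS : IsGaussianSubspace (noiseSpace hW hW') := fun x hx =>
    map_eq_gaussianReal_of_mem_noiseSpace hW hW' hκ' hx
  have hmem : ∀ t, HasCoordsIn (noiseSpace hW hW') (V t) := fun t =>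
    (((hZ t).hasCoordsIn_left hW').add (HasCoordsIn.kernelConv
      (Submodule.isClosed_topologicalClosure _) hF (fun s => (hFr s).hasCoordsIn_right hW)
      hr.measurable_extendZero (integrable_entry_extendZero hR) t)).congr (hVV t).symm
  have hcorr : ∀ s t, 0 ≤ t → correlation V P (s + t) s =
      singleTerm r (G * Gᵀ) t + doubleTerm r (chi φ G κ) t := by
    intro s t ht
    rw [← correlation_resolventProcess hR hF hr hZ hZb hφ hκ' hFr s ht]
    refine matOp_injective ?_
    rw [matOp_correlation, matOp_correlation, corr_congr (hVV (s + t)) (hVV s)]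
  have hstat : ∀ s t u, corr P (V (s + u)) (V (t + u)) = corr P (V s) (V t) := by
    have h1 : ∀ s t u, s ≤ t → corr P (V (t + u)) (V (s + u)) = corr P (V t) (V s) := by
      intro s t u hst
      have h := (hcorr (s + u) (t - s) (sub_nonneg.2 hst)).trans
        (hcorr s (t - s) (sub_nonneg.2 hst)).symm
      rw [show s + u + (t - s) = t + u by ring, show s + (t - s) = t by ring] at h
      exact congrArg matOp h
    intro s t u
    rcases le_total s t with hst | hst
    · rw [← trOp_corr, h1 s t u hst, trOp_corr]
    · exact h1 t s u hst
  have hchi := isL1AddLinf_chi hφ G κ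
  refine ⟨V, hVs, hVb.isMeanSquareBounded, hVall, fun V' hV' hb t => ?_,
    isGaussianProcess_of_hasCoordsIn hS hmem, fun t i => (hmem t).integral_eq_zero hS i,
    isStationary_of_corr hS hmem hstat,
    fun t ht => ⟨singleTermConverges hR _ ht, doubleTermConverges hR hchi t,
      fun s => hcorr s t ht⟩,
    fun S _ t ht => ⟨singleTermConverges hR _ ht,
      doubleTermConverges hR (isL1AddLinf_chi_sub hΓ hφ G S κ) t, fun s => ?_⟩⟩
  · exact ae_eq_of_equation hR hΓ hVb (IsBoundedProcess.of_isMeanSquareBounded hV'.measurable hb)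
      hF hVs.equation hV'.equation t
  · rw [hcorr s t ht, single_add_double_eq hR hr hΓ hr1 _ S hchi
      (isL1AddLinf_chi_sub hΓ hφ G S κ) ht]
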